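/- Let $d\ge 1$ and $Q=(0,\infty)^d\subset\mathbb R^d$. For $x,y\in Q$ the product $xy$ and the quotient $y/x$ are taken coordinatewise. Let $\mathcal D(Q)$ be the space of complex-valued smooth functions with compact support in $Q$ and $\mathcal D'(Q)$ the space of distributions on $Q$. Let $\mathcal S(Q)=\{f\in\mathcal S(\mathbb R^d):\operatorname{supp} f\subset\overline Q\}$ with the topology of $\mathcal S(\mathbb R^d)$, and let $\mathcal S'(Q)$ be its dual; "$T\in\mathcal S'(Q)$" means that $T\in\mathcal D'(Q)$ extends to a (necessarily unique) continuous linear form on $\mathcal S(Q)$, again written $T$. Locally integrable functions $t$ on $Q$ are regarded as distributions via $\varphi\mapsto\int_Q t\varphi\,dx$. For $\beta\in\mathbb N_0^d$ put $\theta^\beta=\theta_1^{\beta_1}\cdots\theta_d^{\beta_d}$ with $\theta_j=x_j\partial_j$, acting on distributions by $(\theta_jT)\varphi=T(-\theta_j\varphi-\varphi)$. For $k\in\mathbb N_0$ let $$w_k(x)=\prod_{j=1}^d\bigl(x_j^{2k}+x_j^{-2k}\bigr),\qquad x\in Q,$$ so that $w_k(x)=|x|^{2k}+|x|^{-2k}$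 if $d=1$. For $S\in\mathcal D'(Q)$ and $\varphi\in\mathcal D(Q)$ the multiplicative convolution is the function $$(S\star\varphi)(y)=S_x\Bigl(\frac{1}{x_1\cdots x_d}\,\varphi(y/x)\Bigr),\qquad y\in Q,$$ that is, the density of the distribution $\psi\mapsto S_x\bigl(\int_Q\varphi(y)\psi(xy)\,dy\bigr)$. Let $\mathcal O_H'(Q)$ be the set of all $T\in\mathcal D'(Q)$ such that for every $k\in\mathbb N_0$ there are finitely many functions $t_\beta$ on $Q$ with $w_kt_\beta\in L_\infty(Q)$ and $T=\sum_\beta\theta^\beta t_\beta$. **Theorem.** For $T\in\mathcal D'(Q)$ the following are equivalent: 1. $T\in\mathcal O_H'(Q)$. 2. For every $k\in\mathbb N_0$ there are finitely many functions $t_\beta$ with $w_kt_\beta\in L_\infty(Q)$ such that $T=\sum_\beta\theta^\beta t_\beta$. 3. $T\in\mathcal S'(Q)$, and for every $\varphi\in\mathcal S(Q)$ the function $y\mapsto T_x\varphi(xy)$ on $Q$ is the restriction to $Q$ of a function in $\mathcal S(Q)$. 4. For every $\varphi\in\mathcal D(Q)$ the function $f(y)=T_x\varphi(xy)$ is continuous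 on $Q$, and $\sup_{y\in Q}|f(y)|\,w_k(y)<\infty$ for every $k\in\mathbb N_0$. 5. For every $k\in\mathbb N_0$ and every $\varphi\in\mathcal D(Q)$ the function $(w_kT)\star\varphi$ is continuous and bounded on $Q$. -/

import Mathlib

open MeasureTheory Set TopologicalSpace
open scoped ContDiff Distributions SchwartzMap

noncomputable section

namespace HadamardQ

/-- The open positive quadrant `Q = (0, ∞)^d` of `ℝ^d`. -/
def Q (d : ℕ) : Opens (Fin d → ℝ) where
  carrier := {x | ∀ j, 0 < x j}
  is_open' := by
    simp only [ofPred_forall]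
    exact isOpen_iInter_of_finite fun j => isOpen_lt continuous_const (continuous_apply j)

theorem mem_Q {d : ℕ} {x : Fin d → ℝ} : x ∈ Q d ↔ ∀ j, 0 < x j := Iff.rfl

/-- A function that is smooth on `Q` and vanishes off a compact subset of `Q` is a test function
on `Q`. -/
def mkTest {d : ℕ} (f : (Fin d → ℝ) → ℂ) (K : Set (Fin d → ℝ)) (hK : IsCompact K)
    (hKQ : K ⊆ (Q d : Set (Fin d → ℝ))) (hf : ContDiffOn ℝ ∞ f (Q d))
    (h0 : ∀ x, x ∉ K → f x = 0) : 𝓓(Q d, ℂ) where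
  toFun := f
  contDiff' := by
    rw [contDiff_iff_contDiffAt]
    intro x
    by_cases hx : x ∈ (Q d : Set (Fin d → ℝ))
    · exact hf.contDiffAt ((Q d).isOpen.mem_nhds hx)
    · have hx' : x ∈ Kᶜ := fun h => hx (hKQ h)
      have : f =ᶠ[nhds x] fun _ => 0 := by
        filter_upwards [hK.isClosed.isOpen_compl.mem_nhds hx'] with y hy using h0 y hy
      exact contDiffAt_const.congr_of_eventuallyEq this
  hasCompactSupport' := HasCompactSupport.intro hK fun x hx => h0 x hx
  tsupport_subset' :=
    (closure_minimal (fun x (hx : f x ≠ 0) => by_contra fun h => hx (h0 x h)) hK.isClosed).trans hKQ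

/-- `𝓓'(Q)`: the continuous (complex) linear forms on the space `𝓓(Q)` of complex-valued
test functions. -/
abbrev DistQ (d : ℕ) : Type := 𝓓(Q d, ℂ) →L[ℂ] ℂ

/-! ### Multiplication by smooth functions -/

/-- The test function `g φ`, for `g` smooth on `Q`. -/
def mulTest {d : ℕ} (g : (Fin d → ℝ) → ℂ) (hg : ContDiffOn ℝ ∞ g (Q d)) (φ : 𝓓(Q d, ℂ)) :
    𝓓(Q d, ℂ) :=
  mkTest (fun x => φ x * g x) (tsupport φ) φ.hasCompactSupport φ.tsupport_subset
    (φ.contDiff.contDiffOn.mul hg)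
    (fun x hx => by simp [image_eq_zero_of_notMem_tsupport hx])

theorem mulTest_apply {d : ℕ} (g : (Fin d → ℝ) → ℂ) (hg : ContDiffOn ℝ ∞ g (Q d))
    (φ : 𝓓(Q d, ℂ)) (x : Fin d → ℝ) : mulTest g hg φ x = φ x * g x := rfl

/-- A function smooth on `Q` agrees on any compact subset of `Q` with a function smooth on `ℝ^d`. -/
theorem exists_smooth_extension {d : ℕ} (g : (Fin d → ℝ) → ℂ) (hg : ContDiffOn ℝ ∞ g (Q d))
    (K : Set (Fin d → ℝ)) (hK : IsCompact K) (hKQ : K ⊆ (Q d : Set (Fin d → ℝ))) :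
    ∃ G : (Fin d → ℝ) → ℂ, ContDiff ℝ ∞ G ∧ ∀ x ∈ K, G x = g x := by
  obtain ⟨L, hL, hKL, hLQ⟩ := exists_compact_between hK (Q d).isOpen hKQ
  obtain ⟨χ, hχ, -, h0, h1⟩ := exists_contMDiff_zero_iff_one_iff_of_isClosed
    (modelWithCornersSelf ℝ (Fin d → ℝ)) (n := ⊤)
    (isOpen_interior (s := L)).isClosed_compl hK.isClosed
    (disjoint_left.2 fun x hx hx' => hx (hKL hx'))
  refine ⟨fun x => (χ x : ℂ) * g x, (mkTest (fun x => (χ x : ℂ) * g x) L hL hLQ ?_ ?_).contDiff, ?_⟩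
  · exact ((Complex.ofRealCLM.contDiff.comp hχ.contDiff).contDiffOn).mul hg
  · intro x hx
    have : χ x = 0 := (h0 x).1 fun h => hx (interior_subset h)
    simp [this]
  · intro x hx
    simp [(h1 x).1 hx]

/-- Multiplication by a function smooth on `Q`, as a continuous linear map on `𝓓(Q)`. -/
def mulCLM {d : ℕ} (g : (Fin d → ℝ) → ℂ) (hg : ContDiffOn ℝ ∞ g (Q d)) :
    𝓓(Q d, ℂ) →L[ℂ] 𝓓(Q d, ℂ) :=
  TestFunction.limitCLM ℂ (mulTest g hg)
    (fun K hKQ => (TestFunction.ofSupportedInCLM ℂ hKQ).comp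
      (ContDiffMapSupportedIn.bilinLeftCLM (ContinuousLinearMap.mul ℂ ℂ)
        (exists_smooth_extension g hg K K.isCompact hKQ).choose_spec.1))
    (by
      intro K hKQ f
      ext x
      by_cases hx : x ∈ (K : Set (Fin d → ℝ))
      · have := (exists_smooth_extension g hg K K.isCompact hKQ).choose_spec.2 x hx
        simp [mulTest_apply, this]
      · have : f x = 0 := f.zero_on_compl hx
        simp [mulTest_apply, this])

theorem mulCLM_apply {d : ℕ} (g : (Fin d → ℝ) → ℂ) (hg : ContDiffOn ℝ ∞ g (Q d))
    (φ : 𝓓(Q d, ℂ)) (x : Fin d → ℝ) : mulCLM g hg φ x = φ x * g x := rfl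

/-! ### Euler operators on distributions -/

theorem contDiffOn_coord {d : ℕ} (j : Fin d) :
    ContDiffOn ℝ ∞ (fun x : Fin d → ℝ => ((x j : ℝ) : ℂ)) (Q d) :=
  (Complex.ofRealCLM.contDiff.comp (contDiff_apply ℝ ℝ j)).contDiffOn

/-- `θ_j = x_j ∂_j` on test functions. -/
def thetaTest {d : ℕ} (j : Fin d) : 𝓓(Q d, ℂ) →L[ℂ] 𝓓(Q d, ℂ) :=
  (mulCLM (fun x => ((x j : ℝ) : ℂ)) (contDiffOn_coord j)).comp
    (TestFunction.lineDerivCLM ℂ (Pi.single j (1 : ℝ)))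

/-- `θ_j = x_j ∂_j` on distributions: `(θ_j T) φ = T (θ_j^* φ)` with `θ_j^* = -θ_j - 1`. -/
def theta {d : ℕ} (j : Fin d) (T : DistQ d) : DistQ d :=
  T.comp (-thetaTest j - ContinuousLinearMap.id ℂ (𝓓(Q d, ℂ)))

/-- `θ^β = θ_1^{β_1} ⋯ θ_d^{β_d}` on distributions. -/
def thetaPow {d : ℕ} (β : Fin d → ℕ) (T : DistQ d) : DistQ d :=
  (List.finRange d).foldr (fun j S => (theta j)^[β j] S) T

/-- The distribution `φ ↦ ∫_Q t φ dx` of a function `t` that is locally integrable on `Q`. -/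
def ofFun {d : ℕ} (t : (Fin d → ℝ) → ℂ) : DistQ d :=
  TestFunction.integralAgainstBilinCLM (ContinuousLinearMap.mul ℂ ℂ) volume t

/-! ### The weights -/

/-- `w_k(x) = ∏_j (x_j^{2k} + x_j^{-2k})`, which is `∑_{η ∈ {-1,1}^d} x^{2kη}`; for `d = 1` it is
`|x|^{2k} + |x|^{-2k}`. -/
def weight {d : ℕ} (k : ℕ) (x : Fin d → ℝ) : ℝ :=
  ∏ j, ((x j) ^ (2 * k) + ((x j) ^ (2 * k))⁻¹)

theorem contDiffOn_weight {d : ℕ} (k : ℕ) :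
    ContDiffOn ℝ ∞ (fun x : Fin d → ℝ => ((weight k x : ℝ) : ℂ)) (Q d) := by
  have hw : ContDiffOn ℝ ∞ (fun x : Fin d → ℝ => weight k x) (Q d) := by
    unfold weight
    refine contDiffOn_prod fun j _ => ?_
    have h : ContDiffOn ℝ ∞ (fun x : Fin d → ℝ => (x j) ^ (2 * k)) (Q d) :=
      ((contDiff_apply ℝ ℝ j).pow _).contDiffOn
    exact h.add (h.inv fun x hx => pow_ne_zero _ (mem_Q.1 hx j).ne')
  exact Complex.ofRealCLM.contDiff.comp_contDiffOn hw

/-- The distribution `w_k T`. -/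
def weightMul {d : ℕ} (k : ℕ) (T : DistQ d) : DistQ d :=
  T.comp (mulCLM (fun x => ((weight k x : ℝ) : ℂ)) (contDiffOn_weight k))

/-! ### `θ`-rapidly decreasing distributions -/

/-- `𝓞'_H(Q)`: for every `k`, `T` is a finite sum `∑ θ^β t_β` with `w_k t_β ∈ L_∞(Q)`. -/
def OHQ (d : ℕ) : Set (DistQ d) :=
  {T | ∀ k : ℕ, ∃ (B : Finset (Fin d → ℕ)) (t : (Fin d → ℕ) → (Fin d → ℝ) → ℂ),
    (∀ β ∈ B, MemLp (fun x => (weight k x : ℂ) * t β x) ⊤ (volume.restrict (Q d))) ∧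
    T = ∑ β ∈ B, thetaPow β (ofFun (t β))}

/-! ### The space `𝓢(Q)` and its dual -/

/-- `𝓢(Q)`: the Schwartz functions on `ℝ^d` supported in the closure of `Q`, with the topology
induced by `𝓢(ℝ^d)`. -/
def SQ (d : ℕ) : Submodule ℂ (𝓢(Fin d → ℝ, ℂ)) where
  carrier := {f | tsupport f ⊆ closure (Q d : Set (Fin d → ℝ))}
  zero_mem' := by simp [tsupport]
  add_mem' := fun {f g} hf hg => (tsupport_add f g).trans (union_subset hf hg)
  smul_mem' := fun c f hf =>
    (closure_mono (Function.support_const_smul_subset c f)).trans hf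

/-- The inclusion of `𝓓(Q)` in `𝓢(Q)`. -/
def testToSQ {d : ℕ} (φ : 𝓓(Q d, ℂ)) : SQ d :=
  ⟨φ.hasCompactSupport.toSchwartzMap φ.contDiff, φ.tsupport_subset.trans subset_closure⟩

/-- `U ∈ 𝓢'(Q)` restricts to `T ∈ 𝓓'(Q)`. As `𝓓(Q)` is dense in `𝓢(Q)`, there is at most one
such `U`, and `T ∈ 𝓢'(Q)` means that there is one. -/
def Extends {d : ℕ} (U : SQ d →L[ℂ] ℂ) (T : DistQ d) : Prop :=
  ∀ φ : 𝓓(Q d, ℂ), U (testToSQ φ) = T φ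

/-! ### Dilations and multiplicative convolution -/

/-- The linear automorphism `x ↦ x y` of `ℝ^d` (coordinatewise product), for `y ∈ Q`. -/
def dilation {d : ℕ} (y : Q d) : (Fin d → ℝ) ≃L[ℝ] (Fin d → ℝ) :=
  ContinuousLinearEquiv.piCongrRight fun j =>
    ContinuousLinearEquiv.unitsEquivAut ℝ (Units.mk0 (y.1 j) (y.2 j).ne')

theorem dilation_apply {d : ℕ} (y : Q d) (x : Fin d → ℝ) : dilation y x = x * y.1 := by
  ext j
  simp [dilation]

theorem dilation_mem_Q {d : ℕ} (y : Q d) (x : Fin d → ℝ) : dilation y x ∈ Q d ↔ x ∈ Q d := by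
  simp only [dilation_apply, mem_Q, Pi.mul_apply]
  exact forall_congr' fun j => mul_pos_iff_of_pos_right (y.2 j)

/-- The test function `x ↦ φ(x y)`, for `y ∈ Q`. -/
def dilTest {d : ℕ} (y : Q d) (φ : 𝓓(Q d, ℂ)) : 𝓓(Q d, ℂ) where
  toFun := fun x => φ (x * y.1)
  contDiff' := by
    have : (fun x => φ (x * y.1)) = φ ∘ dilation y := by ext x; simp [dilation_apply]
    rw [this]
    exact φ.contDiff.comp (dilation y).contDiff
  hasCompactSupport' := by
    have : (fun x => φ (x * y.1)) = φ ∘ (dilation y).toHomeomorph := by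
      ext x; simp [dilation_apply]
    rw [this]
    exact φ.hasCompactSupport.comp_homeomorph _
  tsupport_subset' := by
    have : (fun x => φ (x * y.1)) = φ ∘ (dilation y).toHomeomorph := by
      ext x; simp [dilation_apply]
    rw [this, tsupport_comp_eq_preimage]
    exact fun x hx => (dilation_mem_Q y x).1 (φ.tsupport_subset hx)

/-- The function `x ↦ φ(x y)` in `𝓢(Q)`, for `y ∈ Q` and `φ ∈ 𝓢(Q)`. -/
def dilSQ {d : ℕ} (y : Q d) (φ : SQ d) : SQ d :=
  ⟨SchwartzMap.compCLMOfContinuousLinearEquiv ℂ (dilation y) φ.1, by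
    change tsupport (φ.1 ∘ (dilation y).toHomeomorph) ⊆ _
    rw [tsupport_comp_eq_preimage]
    intro x hx
    have h : (dilation y).toHomeomorph x ∈ closure (Q d : Set (Fin d → ℝ)) := φ.2 hx
    rw [← mem_preimage, Homeomorph.preimage_closure] at h
    exact closure_mono (fun z hz => (dilation_mem_Q y z).1 hz) h⟩

theorem dilSQ_apply {d : ℕ} (y : Q d) (φ : SQ d) (x : Fin d → ℝ) :
    (dilSQ y φ).1 x = φ.1 (x * y.1) := by
  rw [← dilation_apply]; rfl

theorem contDiffOn_quot {d : ℕ} (y : Fin d → ℝ) :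
    ContDiffOn ℝ ∞ (fun x : Fin d → ℝ => y / x) (Q d) :=
  contDiffOn_pi.2 fun j => contDiffOn_const.div (contDiff_apply ℝ ℝ j).contDiffOn
    fun _ hx => (mem_Q.1 hx j).ne'

/-- The test function `x ↦ (x_1 ⋯ x_d)⁻¹ φ(y / x)`, for `y ∈ Q`. -/
def convTest {d : ℕ} (y : Q d) (φ : 𝓓(Q d, ℂ)) : 𝓓(Q d, ℂ) :=
  mkTest (fun x => ((∏ j, x j)⁻¹ : ℝ) * φ (y.1 / x)) ((fun z => y.1 / z) '' tsupport φ)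
    (φ.hasCompactSupport.image_of_continuousOn
      ((contDiffOn_quot y.1).continuousOn.mono φ.tsupport_subset))
    (by
      rintro _ ⟨z, hz, rfl⟩ j
      exact div_pos (y.2 j) (φ.tsupport_subset hz j))
    (by
      refine ContDiffOn.mul ?_ (φ.contDiff.comp_contDiffOn (contDiffOn_quot y.1))
      refine Complex.ofRealCLM.contDiff.comp_contDiffOn (ContDiffOn.inv ?_ ?_)
      · exact contDiffOn_prod fun j _ => (contDiff_apply ℝ ℝ j).contDiffOn
      · exact fun x hx => Finset.prod_ne_zero_iff.2 fun j _ => (mem_Q.1 hx j).ne')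
    (by
      intro x hx
      have : φ (y.1 / x) = 0 := by
        by_contra h
        refine hx ⟨y.1 / x, subset_tsupport _ h, ?_⟩
        ext j
        exact div_div_cancel₀ (y.2 j).ne'
      simp [this])

theorem convTest_apply {d : ℕ} (y : Q d) (φ : 𝓓(Q d, ℂ)) (x : Fin d → ℝ) :
    convTest y φ x = ((∏ j, x j)⁻¹ : ℝ) * φ (y.1 / x) := rfl

/-- The multiplicative convolution of `S ∈ 𝓓'(Q)` and `φ ∈ 𝓓(Q)`, as a function on `Q`:
`(S ⋆ φ)(y) = S_x((x_1 ⋯ x_d)⁻¹ φ(y / x))`. It is the density of the distribution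
`ψ ↦ S_x(∫_Q φ(y) ψ(x y) dy)`, that is, of `ψ ↦ S_x(R_y ψ(x y))` with `R = φ(y) dy`. -/
def mulConv {d : ℕ} (S : DistQ d) (φ : 𝓓(Q d, ℂ)) (y : Q d) : ℂ :=
  S (convTest y φ)

end HadamardQ

end

/-! The conditions, counted in the order of the list, are linked by 2 → 3 → 4 → 2 and 4 → 5 → 2; the
first two are the same by definition. Everything is written in terms of the Euler operators `θ_j`,
which commute with the dilations `x ↦ x y`, so that local estimates can be transported over the
multiplicative group `Q`.

From decay to a representation (4 → 2): by the Banach–Steinhaus theorem on the Fréchet spaces `𝓓_K`,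
the bounds on `T_x φ(x y)` are uniform in `φ` with support in the cube `[1/2, 2]^d` and bounded Euler
derivatives of some order (`exists_dil_bound`). A test function is cut into pieces along a dyadic
partition of unity, each piece is moved to the cube, and suprema of Euler derivatives are estimated by
integrals with a Sobolev inequality that is invariant under dilations. The result is a bound of `|T φ|`
by an integral of the Euler derivatives of `φ` with a weight `w_{k+1}⁻¹` (`exists_integral_bound`). By
the Hahn–Banach theorem and the duality of `L_1` and `L_∞` such a `T` is a sum `∑ θ^β t_β` with
`w_{k+1} t_β` bounded (`exists_representation`).

For 5 → 2 the same bound is applied to `w_K T` for a large `K`, with a growing weight in place of a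
decreasing one, and transferred to `T` by the estimates of the Euler derivatives of `w_K⁻¹`. For 4 → 5
the weight `w_k` is a sum of monomials `x^η = y^η (x / y)^η`, which expresses the convolutions of
`w_k T` by the functions `y ↦ T_x φ(x y)` (`mulConv_weightMul`).

For 3 → 4, the elements of `𝓢(Q)` vanish to infinite order on the boundary of `Q` and decrease rapidly
at infinity, so that their products with the weights are bounded (`exists_norm_mul_weight_le`).

For 2 → 3, a representation with index `k` expresses `T_x φ(x y)` by integrals
`∫ t_β(x) (A^β φ)(x y) dx` with `A^β` the adjoint of `θ^β`. They make sense for all `y ∈ ℝ^d`, vanish off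
`Q`, and can be differentiated a number of times that grows with `k`, with decay of the derivatives.
All the representations define the same form on `𝓢(Q)`, since each of its values is a limit of values
of `T` (`tendsto_pairing_cutoff`); so the function is smooth and rapidly decreasing. -/

noncomputable section

namespace HadamardQ

/-! ### Euler operators on functions -/

/-- The Euler operator `θ_j = x_j ∂_j` on functions. -/
def euler {d : ℕ} (j : Fin d) (f : (Fin d → ℝ) → ℂ) : (Fin d → ℝ) → ℂ :=
  fun x => (x j : ℂ) * fderiv ℝ f x (Pi.single j 1)

/-- The formal adjoint `-θ_j - 1` of the Euler operator `θ_j`. -/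
def eulerAdj {d : ℕ} (j : Fin d) (f : (Fin d → ℝ) → ℂ) : (Fin d → ℝ) → ℂ :=
  fun x => -euler j f x - f x

/-- The sum of `|θ_{j_1} ⋯ θ_{j_m} f (x)|` over all words `j_1 ⋯ j_m` of length at most `n`, each
counted with some positive multiplicity. -/
def eulerSum {d : ℕ} : ℕ → ((Fin d → ℝ) → ℂ) → (Fin d → ℝ) → ℝ
  | 0, f, x => ‖f x‖
  | n + 1, f, x => eulerSum n f x + ∑ j, eulerSum n (euler j f) x

theorem contDiffOn_euler {d : ℕ} (j : Fin d) {f : (Fin d → ℝ) → ℂ}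
    (hf : ContDiffOn ℝ ∞ f (Q d)) : ContDiffOn ℝ ∞ (euler j f) (Q d) :=
  (contDiffOn_coord j).mul
    ((hf.fderiv_of_isOpen (Q d).isOpen (m := ∞) le_rfl).clm_apply contDiffOn_const)

theorem contDiff_euler {d : ℕ} (j : Fin d) {f : (Fin d → ℝ) → ℂ}
    (hf : ContDiff ℝ ∞ f) : ContDiff ℝ ∞ (euler j f) :=
  (Complex.ofRealCLM.contDiff.comp (contDiff_apply ℝ ℝ j)).mul
    ((hf.fderiv_right (m := ∞) le_rfl).clm_apply contDiff_const)

theorem differentiableAt_of_contDiffOn {d : ℕ} {f : (Fin d → ℝ) → ℂ}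
    (hf : ContDiffOn ℝ ∞ f (Q d)) {x : Fin d → ℝ} (hx : x ∈ Q d) : DifferentiableAt ℝ f x :=
  (hf.contDiffAt ((Q d).isOpen.mem_nhds hx)).differentiableAt (by simp)

theorem eventuallyEq_euler {d : ℕ} (j : Fin d) {f g : (Fin d → ℝ) → ℂ} {x : Fin d → ℝ}
    (h : f =ᶠ[nhds x] g) : euler j f =ᶠ[nhds x] euler j g := by
  filter_upwards [h.fderiv (𝕜 := ℝ)] with y hy
  simp [euler, hy]

theorem eventuallyEq_eulerAdj {d : ℕ} (j : Fin d) {f g : (Fin d → ℝ) → ℂ} {x : Fin d → ℝ}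
    (h : f =ᶠ[nhds x] g) : eulerAdj j f =ᶠ[nhds x] eulerAdj j g := by
  filter_upwards [eventuallyEq_euler j h, h] with y hy hy'
  simp [eulerAdj, hy, hy']

theorem eulerSum_congr {d : ℕ} (n : ℕ) {f g : (Fin d → ℝ) → ℂ} {x : Fin d → ℝ}
    (h : f =ᶠ[nhds x] g) : eulerSum n f x = eulerSum n g x := by
  induction n generalizing f g with
  | zero => simp [eulerSum, h.eq_of_nhds]
  | succ n ih => simp [eulerSum, ih h, fun j => ih (eventuallyEq_euler j h)]

theorem eulerSum_congr_of_eqOn {d : ℕ} (n : ℕ) {f g : (Fin d → ℝ) → ℂ}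
    (h : EqOn f g (Q d)) {x : Fin d → ℝ} (hx : x ∈ Q d) : eulerSum n f x = eulerSum n g x :=
  eulerSum_congr n (h.eventuallyEq_of_mem ((Q d).isOpen.mem_nhds hx))

theorem eulerSum_nonneg {d : ℕ} (n : ℕ) (f : (Fin d → ℝ) → ℂ) (x : Fin d → ℝ) :
    0 ≤ eulerSum n f x := by
  induction n generalizing f with
  | zero => exact norm_nonneg _
  | succ n ih => exact add_nonneg (ih f) (Finset.sum_nonneg fun j _ => ih _)

theorem eulerSum_le_succ {d : ℕ} (n : ℕ) (f : (Fin d → ℝ) → ℂ) (x : Fin d → ℝ) :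
    eulerSum n f x ≤ eulerSum (n + 1) f x :=
  le_add_of_nonneg_right (Finset.sum_nonneg fun _ _ => eulerSum_nonneg _ _ _)

theorem eulerSum_euler_le {d : ℕ} (n : ℕ) (j : Fin d) (f : (Fin d → ℝ) → ℂ) (x : Fin d → ℝ) :
    eulerSum n (euler j f) x ≤ eulerSum (n + 1) f x :=
  (Finset.single_le_sum (f := fun j => eulerSum n (euler j f) x)
    (fun _ _ => eulerSum_nonneg _ _ _) (Finset.mem_univ j)).trans
    (le_add_of_nonneg_left (eulerSum_nonneg _ _ _))

theorem euler_add_eqOn {d : ℕ} (j : Fin d) {f g : (Fin d → ℝ) → ℂ}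
    (hf : ContDiffOn ℝ ∞ f (Q d)) (hg : ContDiffOn ℝ ∞ g (Q d)) :
    EqOn (euler j fun x => f x + g x) (fun x => euler j f x + euler j g x) (Q d) := by
  intro x hx
  have := fderiv_fun_add (differentiableAt_of_contDiffOn hf hx)
    (differentiableAt_of_contDiffOn hg hx)
  simp [euler, this, mul_add]

theorem euler_mul_eqOn {d : ℕ} (j : Fin d) {f g : (Fin d → ℝ) → ℂ}
    (hf : ContDiffOn ℝ ∞ f (Q d)) (hg : ContDiffOn ℝ ∞ g (Q d)) :
    EqOn (euler j fun x => f x * g x) (fun x => euler j f x * g x + f x * euler j g x)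
      (Q d) := by
  intro x hx
  have := fderiv_fun_mul (differentiableAt_of_contDiffOn hf hx)
    (differentiableAt_of_contDiffOn hg hx)
  simp [euler, this]
  ring

theorem eulerSum_add_le {d : ℕ} (n : ℕ) {f g : (Fin d → ℝ) → ℂ}
    (hf : ContDiffOn ℝ ∞ f (Q d)) (hg : ContDiffOn ℝ ∞ g (Q d)) {x : Fin d → ℝ} (hx : x ∈ Q d) :
    eulerSum n (fun x => f x + g x) x ≤ eulerSum n f x + eulerSum n g x := by
  induction n generalizing f g with
  | zero => exact norm_add_le _ _
  | succ n ih =>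
    have h : ∀ j, eulerSum n (euler j fun x => f x + g x) x ≤
        eulerSum n (euler j f) x + eulerSum n (euler j g) x := fun j => by
      rw [eulerSum_congr_of_eqOn n (euler_add_eqOn j hf hg) hx]
      exact ih (contDiffOn_euler j hf) (contDiffOn_euler j hg)
    have := Finset.sum_le_sum fun j (_ : j ∈ Finset.univ) => h j
    rw [Finset.sum_add_distrib] at this
    have := ih hf hg
    simp only [eulerSum]
    linarith

theorem euler_const_mul {d : ℕ} (j : Fin d) (c : ℂ) (f : (Fin d → ℝ) → ℂ) :
    euler j (fun x => c * f x) = fun x => c * euler j f x := by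
  ext x
  have h : fderiv ℝ (fun x => c * f x) x = c • fderiv ℝ f x :=
    congrFun (fderiv_const_smul_field (𝕜 := ℝ) (f := f) c) x
  simp [euler, h]
  ring

theorem eulerSum_const_mul {d : ℕ} (n : ℕ) (c : ℂ) (f : (Fin d → ℝ) → ℂ) (x : Fin d → ℝ) :
    eulerSum n (fun x => c * f x) x = ‖c‖ * eulerSum n f x := by
  induction n generalizing f with
  | zero => simp [eulerSum]
  | succ n ih => simp [eulerSum, ih, euler_const_mul, mul_add, Finset.mul_sum]

theorem eulerSum_eulerAdj_le {d : ℕ} (n : ℕ) (j : Fin d) {f : (Fin d → ℝ) → ℂ}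
    (hf : ContDiffOn ℝ ∞ f (Q d)) {x : Fin d → ℝ} (hx : x ∈ Q d) :
    eulerSum n (eulerAdj j f) x ≤ eulerSum (n + 1) f x := by
  have h1 : eulerAdj j f = fun x => (-1) * (euler j f x + f x) := by
    ext x; simp [eulerAdj]; ring
  have h2 := eulerSum_add_le n (contDiffOn_euler j hf) hf hx
  have h3 := Finset.single_le_sum (f := fun j => eulerSum n (euler j f) x)
    (fun _ _ => eulerSum_nonneg _ _ _) (Finset.mem_univ j)
  rw [h1, eulerSum_const_mul]
  simp only [norm_neg, norm_one, one_mul, eulerSum] at h3 ⊢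
  linarith

/-- The opposite comparison: `θ_j` is recovered from its adjoint. -/
theorem eulerSum_euler_le_eulerAdj {d : ℕ} (n : ℕ) (j : Fin d) {f : (Fin d → ℝ) → ℂ}
    (hf : ContDiffOn ℝ ∞ f (Q d)) {x : Fin d → ℝ} (hx : x ∈ Q d) :
    eulerSum n (euler j f) x ≤ eulerSum n (eulerAdj j f) x + eulerSum n f x := by
  have h1 : euler j f = fun x => (-1) * (eulerAdj j f x + f x) := by
    ext x; simp [eulerAdj]
  have h4 : ContDiffOn ℝ ∞ (eulerAdj j f) (Q d) := (contDiffOn_euler j hf).neg.sub hf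
  have h2 := eulerSum_add_le n h4 hf hx
  rw [h1, eulerSum_const_mul]
  simpa using h2

/-- Leibniz rule in the form of an estimate. -/
theorem eulerSum_mul_le {d : ℕ} (n : ℕ) {f g : (Fin d → ℝ) → ℂ}
    (hf : ContDiffOn ℝ ∞ f (Q d)) (hg : ContDiffOn ℝ ∞ g (Q d)) {x : Fin d → ℝ} (hx : x ∈ Q d) :
    eulerSum n (fun x => f x * g x) x ≤ 2 ^ n * (eulerSum n f x * eulerSum n g x) := by
  induction n generalizing f g with
  | zero => simp [eulerSum]
  | succ n ih =>
    have h : ∀ j, eulerSum n (euler j fun x => f x * g x) x ≤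
        2 ^ n * (eulerSum n (euler j f) x * eulerSum n g x +
          eulerSum n f x * eulerSum n (euler j g) x) := fun j => by
      have hf' := contDiffOn_euler j hf
      have hg' := contDiffOn_euler j hg
      rw [eulerSum_congr_of_eqOn n (euler_mul_eqOn j hf hg) hx, mul_add]
      exact (eulerSum_add_le n (hf'.mul hg) (hf.mul hg') hx).trans
        (add_le_add (ih hf' hg) (ih hf hg'))
    have h1 := Finset.sum_le_sum fun j (_ : j ∈ Finset.univ) => h j
    rw [← Finset.mul_sum, Finset.sum_add_distrib, ← Finset.sum_mul, ← Finset.mul_sum] at h1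
    have h2 := ih hf hg
    simp only [eulerSum]
    set a := eulerSum n f x
    set b := eulerSum n g x
    set a' := ∑ j, eulerSum n (euler j f) x
    set b' := ∑ j, eulerSum n (euler j g) x
    have ha : 0 ≤ a := eulerSum_nonneg _ _ _
    have hb : 0 ≤ b := eulerSum_nonneg _ _ _
    have ha' : 0 ≤ a' := Finset.sum_nonneg fun _ _ => eulerSum_nonneg _ _ _
    have hb' : 0 ≤ b' := Finset.sum_nonneg fun _ _ => eulerSum_nonneg _ _ _
    calc _ ≤ 2 ^ n * (a * b) + 2 ^ n * (a' * b + a * b') := add_le_add h2 h1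
      _ ≤ 2 ^ n * (2 * ((a + a') * (b + b'))) := by
        rw [← mul_add]
        gcongr
        nlinarith [mul_nonneg ha hb, mul_nonneg ha' hb', mul_nonneg ha' hb, mul_nonneg ha hb']
      _ = _ := by ring

theorem eulerSum_sum_le {d : ℕ} {ι : Type*} (n : ℕ) (s : Finset ι) {f : ι → (Fin d → ℝ) → ℂ}
    (hf : ∀ i ∈ s, ContDiffOn ℝ ∞ (f i) (Q d)) {x : Fin d → ℝ} (hx : x ∈ Q d) :
    eulerSum n (fun x => ∑ i ∈ s, f i x) x ≤ ∑ i ∈ s, eulerSum n (f i) x := by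
  classical
  induction s using Finset.induction_on with
  | empty =>
    have : (fun _ : Fin d → ℝ => (0 : ℂ)) = fun x => (0 : ℂ) * (fun _ => (0 : ℂ)) x := by simp
    simp only [Finset.sum_empty]
    rw [this, eulerSum_const_mul]
    simp
  | insert a s ha ih =>
    simp only [Finset.sum_insert ha]
    exact (eulerSum_add_le n (hf a (by simp))
      (ContDiffOn.sum fun i hi => hf i (by simp [hi])) hx).trans
      (add_le_add le_rfl (ih fun i hi => hf i (by simp [hi])))

/-! ### Dilations -/

theorem euler_comp_mul {d : ℕ} (j : Fin d) (y : Q d) (f : (Fin d → ℝ) → ℂ) :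
    euler j (fun x => f (x * y.1)) = fun x => euler j f (x * y.1) := by
  ext x
  have h1 : (fun x => f (x * y.1)) = f ∘ dilation y := by ext x; simp [dilation_apply]
  have h2 : (dilation y) (Pi.single j 1) = y.1 j • (Pi.single j 1 : Fin d → ℝ) := by
    rw [dilation_apply]
    ext i
    rcases eq_or_ne i j with rfl | h <;> simp [*]
  rw [h1]
  simp only [euler, (dilation y).comp_right_fderiv, ContinuousLinearMap.comp_apply,
    ContinuousLinearEquiv.coe_coe, h2, dilation_apply]
  simp
  ring

theorem eulerAdj_comp_mul {d : ℕ} (j : Fin d) (y : Q d) (f : (Fin d → ℝ) → ℂ) :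
    eulerAdj j (fun x => f (x * y.1)) = fun x => eulerAdj j f (x * y.1) := by
  ext x
  simp [eulerAdj, euler_comp_mul]

/-- Euler derivatives commute with dilations: this makes estimates in terms of `eulerSum` on a fixed
compact set valid, with the same constants, on all its dilates. -/
theorem eulerSum_comp_mul {d : ℕ} (n : ℕ) (y : Q d) (f : (Fin d → ℝ) → ℂ) (x : Fin d → ℝ) :
    eulerSum n (fun x => f (x * y.1)) x = eulerSum n f (x * y.1) := by
  induction n generalizing f with
  | zero => rfl
  | succ n ih => simp [eulerSum, ih, euler_comp_mul]

/-! ### Supports -/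

theorem tsupport_euler_subset {d : ℕ} (j : Fin d) (f : (Fin d → ℝ) → ℂ) :
    tsupport (euler j f) ⊆ tsupport f := by
  refine (closure_mono fun x hx => ?_).trans (tsupport_fderiv_subset ℝ)
  exact fun h => hx (by simp [euler, h])

theorem tsupport_eulerAdj_subset {d : ℕ} (j : Fin d) (f : (Fin d → ℝ) → ℂ) :
    tsupport (eulerAdj j f) ⊆ tsupport f := by
  refine (tsupport_sub _ _).trans (union_subset ?_ subset_rfl)
  exact (tsupport_neg (euler j f)).subset.trans (tsupport_euler_subset j f)

theorem eulerSum_eq_zero {d : ℕ} (n : ℕ) {f : (Fin d → ℝ) → ℂ} {x : Fin d → ℝ}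
    (hx : x ∉ tsupport f) : eulerSum n f x = 0 := by
  induction n generalizing f with
  | zero => simp [eulerSum, image_eq_zero_of_notMem_tsupport hx]
  | succ n ih =>
    simp [eulerSum, ih hx, fun j => ih fun h => hx (tsupport_euler_subset j f h)]

theorem continuous_eulerSum {d : ℕ} (n : ℕ) {f : (Fin d → ℝ) → ℂ} (hf : ContDiff ℝ ∞ f) :
    Continuous (eulerSum n f) := by
  induction n generalizing f with
  | zero => exact hf.continuous.norm
  | succ n ih =>
    exact (ih hf).add (continuous_finsetSum _ fun j _ => ih (contDiff_euler j hf))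

/-! ### Euler operators on test functions -/

/-- The adjoint `-θ_j - 1` on test functions. -/
def eulerAdjTest {d : ℕ} (j : Fin d) : 𝓓(Q d, ℂ) →L[ℂ] 𝓓(Q d, ℂ) :=
  -thetaTest j - ContinuousLinearMap.id ℂ (𝓓(Q d, ℂ))

theorem coe_thetaTest {d : ℕ} (j : Fin d) (φ : 𝓓(Q d, ℂ)) : ⇑(thetaTest j φ) = euler j φ := by
  ext x
  change (TestFunction.lineDerivCLM ℂ (Pi.single j (1 : ℝ)) φ : 𝓓(Q d, ℂ)) x * (x j : ℂ) = _
  rw [TestFunction.lineDerivCLM_eq_fderivCLM, TestFunction.fderivCLM_apply_of_le _ (by simp),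
    mul_comm, euler]

theorem coe_eulerAdjTest {d : ℕ} (j : Fin d) (φ : 𝓓(Q d, ℂ)) :
    ⇑(eulerAdjTest j φ) = eulerAdj j φ := by
  ext x
  simp [eulerAdjTest, eulerAdj, ← coe_thetaTest]

theorem theta_apply {d : ℕ} (j : Fin d) (T : DistQ d) (φ : 𝓓(Q d, ℂ)) :
    theta j T φ = T (eulerAdjTest j φ) := rfl

/-! ### Weights -/

/-- The weight `t^{2k} + t^{-2k}` of one variable. -/
def weightOne (k : ℕ) (t : ℝ) : ℝ := t ^ (2 * k) + (t ^ (2 * k))⁻¹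

theorem weight_eq_prod {d : ℕ} (k : ℕ) (x : Fin d → ℝ) : weight k x = ∏ j, weightOne k (x j) := rfl

theorem weightOne_pos (k : ℕ) {t : ℝ} (ht : 0 < t) : 0 < weightOne k t := by
  unfold weightOne; positivity

theorem weightOne_mul_le_two (k l : ℕ) {t : ℝ} (ht : 0 < t) :
    weightOne k t * weightOne l t ≤ 2 * weightOne (k + l) t := by
  have h : t ^ (2 * (k + l)) = t ^ (2 * k) * t ^ (2 * l) := by rw [mul_add, pow_add]
  unfold weightOne
  rw [h, mul_inv]
  -- `2 w_{k+l} - w_k w_l = (u - u⁻¹) (v - v⁻¹)` with `u = t^{2k}` and `v = t^{2l}`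
  have key : 0 ≤ (t ^ (2 * k) - (t ^ (2 * k))⁻¹) * (t ^ (2 * l) - (t ^ (2 * l))⁻¹) := by
    rcases le_total 1 t with h1 | h1
    · have a1 : 1 ≤ t ^ (2 * k) := one_le_pow₀ h1
      have a2 : 1 ≤ t ^ (2 * l) := one_le_pow₀ h1
      exact mul_nonneg (sub_nonneg.2 ((inv_le_one_of_one_le₀ a1).trans a1))
        (sub_nonneg.2 ((inv_le_one_of_one_le₀ a2).trans a2))
    · have a1 : t ^ (2 * k) ≤ 1 := pow_le_one₀ ht.le h1
      have a2 : t ^ (2 * l) ≤ 1 := pow_le_one₀ ht.le h1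
      exact mul_nonneg_of_nonpos_of_nonpos
        (sub_nonpos.2 (a1.trans ((one_le_inv₀ (by positivity)).2 a1)))
        (sub_nonpos.2 (a2.trans ((one_le_inv₀ (by positivity)).2 a2)))
  nlinarith

theorem zpow_le_weightOne {k : ℕ} {n : ℤ} (hn : |n| ≤ 2 * k) {t : ℝ} (ht : 0 < t) :
    t ^ n ≤ weightOne k t := by
  obtain ⟨h1, h2⟩ := abs_le.1 hn
  have e1 : t ^ (2 * k) = t ^ ((2 * k : ℕ) : ℤ) := (zpow_natCast _ _).symm
  have e2 : (t ^ (2 * k))⁻¹ = t ^ (-((2 * k : ℕ) : ℤ)) := by rw [zpow_neg, zpow_natCast]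
  have p1 : 0 < t ^ (2 * k) := by positivity
  have p2 : 0 < (t ^ (2 * k))⁻¹ := by positivity
  unfold weightOne
  rcases le_total 1 t with h | h
  · have : t ^ n ≤ t ^ (2 * k) := by
      rw [e1]; exact zpow_le_zpow_right₀ h (by push_cast; exact h2)
    linarith
  · have : t ^ n ≤ (t ^ (2 * k))⁻¹ := by
      rw [e2]; exact zpow_le_zpow_right_of_le_one₀ ht h (by push_cast; exact h1)
    linarith

theorem weightOne_mul_arg_le (k : ℕ) {s t : ℝ} (hs : 0 < s) (ht : 0 < t) :
    weightOne k (s * t) ≤ weightOne k s * weightOne k t := by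
  unfold weightOne
  rw [mul_pow, mul_inv]
  have h1 : 0 < s ^ (2 * k) * (t ^ (2 * k))⁻¹ := by positivity
  have h2 : 0 < (s ^ (2 * k))⁻¹ * t ^ (2 * k) := by positivity
  nlinarith

theorem weightOne_inv (k : ℕ) (t : ℝ) : weightOne k t⁻¹ = weightOne k t := by
  simp [weightOne, add_comm]

theorem weight_pos {d : ℕ} (k : ℕ) {x : Fin d → ℝ} (hx : x ∈ Q d) : 0 < weight k x :=
  Finset.prod_pos fun j _ => weightOne_pos k (hx j)

theorem weight_mul_le {d : ℕ} (k l : ℕ) {x : Fin d → ℝ} (hx : x ∈ Q d) :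
    weight k x * weight l x ≤ 2 ^ d * weight (k + l) x := by
  have : (2 : ℝ) ^ d = ∏ _j : Fin d, 2 := by simp
  simp only [weight_eq_prod, this, ← Finset.prod_mul_distrib]
  exact Finset.prod_le_prod
    (fun j _ => (mul_pos (weightOne_pos _ (hx j)) (weightOne_pos _ (hx j))).le)
    fun j _ => weightOne_mul_le_two k l (hx j)

theorem prod_zpow_le_weight {d : ℕ} {k : ℕ} {n : Fin d → ℤ} (hn : ∀ j, |n j| ≤ 2 * k)
    {x : Fin d → ℝ} (hx : x ∈ Q d) : ∏ j, x j ^ n j ≤ weight k x :=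
  Finset.prod_le_prod (fun j _ => (zpow_pos (hx j) _).le) fun j _ => zpow_le_weightOne (hn j) (hx j)

theorem one_le_weight {d : ℕ} (k : ℕ) {x : Fin d → ℝ} (hx : x ∈ Q d) : 1 ≤ weight k x := by
  simpa using prod_zpow_le_weight (k := k) (n := fun _ => 0) (by simp) hx

theorem weight_mul_arg_le {d : ℕ} (k : ℕ) {x y : Fin d → ℝ} (hx : x ∈ Q d) (hy : y ∈ Q d) :
    weight k (x * y) ≤ weight k x * weight k y := by
  simp only [weight_eq_prod, ← Finset.prod_mul_distrib]
  exact Finset.prod_le_prod (fun j _ => (weightOne_pos _ (mul_pos (hx j) (hy j))).le)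
    fun j _ => weightOne_mul_arg_le k (hx j) (hy j)

theorem weight_inv {d : ℕ} (k : ℕ) (x : Fin d → ℝ) : weight k x⁻¹ = weight k x := by
  simp [weight_eq_prod, weightOne_inv]

theorem norm_pow_le_weight {d : ℕ} {k n : ℕ} (hn : n ≤ 2 * k) {x : Fin d → ℝ} (hx : x ∈ Q d) :
    ‖x‖ ^ n ≤ weight k x := by
  rcases Nat.eq_zero_or_pos d with rfl | hd
  · have : ‖x‖ = 0 := by rw [Subsingleton.elim x 0, norm_zero]
    rw [this]
    exact (pow_le_one₀ le_rfl zero_le_one).trans (one_le_weight k hx)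
  · have : Nonempty (Fin d) := ⟨⟨0, hd⟩⟩
    obtain ⟨i, hi⟩ : ∃ i, ‖x‖ = ‖x i‖ := by
      obtain ⟨i, hi⟩ := Finite.exists_max fun i => ‖x i‖
      exact ⟨i, le_antisymm ((pi_norm_le_iff_of_nonneg (norm_nonneg _)).2 hi)
        (norm_le_pi_norm x i)⟩
    rw [hi, Real.norm_of_nonneg (hx i).le]
    have h := prod_zpow_le_weight (k := k) (n := Pi.single i (n : ℤ)) (fun j => by
      rcases eq_or_ne j i with rfl | h
      · simp; exact_mod_cast hn
      · simp [h]) hx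
    rw [Finset.prod_eq_single i (fun j _ h => by simp [h]) (by simp)] at h
    simpa using h

theorem continuousOn_weight {d : ℕ} (k : ℕ) : ContinuousOn (weight (d := d) k) (Q d) := by
  unfold weight
  refine continuousOn_finsetProd _ fun j _ => ?_
  have h : ContinuousOn (fun x : Fin d → ℝ => (x j) ^ (2 * k)) (Q d) :=
    ((continuous_apply j).pow _).continuousOn
  exact h.add (h.inv₀ fun x hx => pow_ne_zero _ (mem_Q.1 hx j).ne')

/-- The inverse of a point of the multiplicative group `Q`. -/
def invQ {d : ℕ} (y : Q d) : Q d := ⟨y.1⁻¹, fun j => inv_pos.2 (y.2 j)⟩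

theorem mul_mem_Q {d : ℕ} {x y : Fin d → ℝ} (hx : x ∈ Q d) (hy : y ∈ Q d) : x * y ∈ Q d :=
  fun j => mul_pos (hx j) (hy j)

theorem mul_invQ_cancel {d : ℕ} (x : Fin d → ℝ) (y : Q d) : x * y.1 * (invQ y).1 = x := by
  ext j
  simp [invQ, (y.2 j).ne']

theorem invQ_mul_cancel {d : ℕ} (x : Fin d → ℝ) (y : Q d) : x * (invQ y).1 * y.1 = x := by
  ext j
  simp [invQ, (y.2 j).ne']

/-- On a compact set of multipliers, `w_k(x)` and `w_k(x y)` are comparable. -/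
theorem exists_weight_compare {d : ℕ} (k : ℕ) {K : Set (Fin d → ℝ)} (hK : IsCompact K)
    (hKQ : K ⊆ Q d) : ∃ C : ℝ, 0 < C ∧ ∀ x ∈ Q d, ∀ y ∈ Q d, x * y ∈ K →
      weight k x ≤ C * weight k y := by
  obtain ⟨C, hC⟩ := hK.exists_bound_of_continuousOn ((continuousOn_weight k).mono hKQ)
  refine ⟨max C 1, by positivity, fun x hx y hy hxy => ?_⟩
  have h1 : x = x * y * y⁻¹ := by ext j; simp [(hy j).ne']
  have hy' : y⁻¹ ∈ Q d := (invQ ⟨y, hy⟩).2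
  have h2 := weight_mul_arg_le k (hKQ hxy) hy'
  rw [← h1, weight_inv] at h2
  refine h2.trans (mul_le_mul_of_nonneg_right ?_ (weight_pos k hy).le)
  exact (Real.le_norm_self _).trans ((hC _ hxy).trans (le_max_left _ _))

theorem integrableOn_inv_weight_one (d : ℕ) :
    IntegrableOn (fun x : Fin d → ℝ => (weight 1 x)⁻¹) (Q d) := by
  have hQ : (Q d : Set (Fin d → ℝ)) = univ.pi fun _ => Ioi 0 := by
    ext x
    simp [mem_Q]
  have h1 : IntegrableOn (fun t : ℝ => (weightOne 1 t)⁻¹) (Ioi 0) := by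
    refine Integrable.mono' ((integrable_inv_one_add_sq.integrableOn (s := Ioi 0)).const_mul 2)
      (ContinuousOn.aestronglyMeasurable ?_ measurableSet_Ioi) ?_
    · refine ContinuousOn.inv₀ ?_ fun t ht => (weightOne_pos 1 ht).ne'
      unfold weightOne
      exact (continuous_pow 2).continuousOn.add ((continuous_pow 2).continuousOn.inv₀
        fun t ht => pow_ne_zero _ (mem_Ioi.1 ht).ne')
    · refine (ae_restrict_iff' measurableSet_Ioi).2 (.of_forall fun t (ht : 0 < t) => ?_)
      rw [Real.norm_of_nonneg (inv_pos.2 (weightOne_pos 1 ht)).le]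
      have e : weightOne 1 t = (t ^ 4 + 1) / t ^ 2 := by
        unfold weightOne; field_simp; ring
      rw [e, inv_div, ← div_eq_mul_inv, div_le_div_iff₀ (by positivity) (by positivity)]
      nlinarith [sq_nonneg (t ^ 2 - 1), sq_nonneg t]
  have h2 := Integrable.fintype_prod (μ := fun _ : Fin d => volume.restrict (Ioi (0 : ℝ)))
    (f := fun _ t => (weightOne 1 t)⁻¹) fun _ => h1
  rw [IntegrableOn, hQ, volume_pi, Measure.restrict_pi_pi]
  simpa [weight_eq_prod, Finset.prod_inv_distrib] using h2

theorem integrableOn_inv_weight (d k : ℕ) :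
    IntegrableOn (fun x : Fin d → ℝ => (weight (k + 1) x)⁻¹) (Q d) := by
  refine Integrable.mono' ((integrableOn_inv_weight_one d).const_mul (2 ^ d))
    (ContinuousOn.aestronglyMeasurable ((continuousOn_weight _).inv₀
      fun x hx => (weight_pos _ hx).ne') (Q d).isOpen.measurableSet) ?_
  refine (ae_restrict_iff' (Q d).isOpen.measurableSet).2 (.of_forall fun x hx => ?_)
  have hx : x ∈ Q d := hx
  have p1 := weight_pos 1 hx
  have p2 := weight_pos (k + 1) hx
  rw [Real.norm_of_nonneg (inv_pos.2 p2).le, ← div_eq_mul_inv, inv_eq_one_div,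
    div_le_div_iff₀ p2 p1, one_mul]
  have h := weight_mul_le k 1 hx
  have h3 := one_le_weight k hx
  nlinarith

/-! ### Euler derivatives of the weights -/

/-- Multiplication by a common eigenfunction of the Euler operators. -/
theorem eulerSum_of_eigen {d : ℕ} {f : (Fin d → ℝ) → ℂ} {c : Fin d → ℂ}
    (hf : ∀ j, EqOn (euler j f) (fun x => c j * f x) (Q d)) (n : ℕ) {x : Fin d → ℝ}
    (hx : x ∈ Q d) : eulerSum n f x = (1 + ∑ j, ‖c j‖) ^ n * ‖f x‖ := by
  induction n with
  | zero => simp [eulerSum]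
  | succ n ih =>
    simp only [eulerSum, fun j => eulerSum_congr_of_eqOn n (hf j) hx, eulerSum_const_mul, ih]
    rw [← Finset.sum_mul]
    ring

/-- Monomials are eigenfunctions of the Euler operators. -/
theorem euler_zpow_eqOn {d : ℕ} (i j : Fin d) (m : ℤ) :
    EqOn (euler i fun x : Fin d → ℝ => ((x j ^ m : ℝ) : ℂ))
      (fun x => (if i = j then (m : ℂ) else 0) * ((x j ^ m : ℝ) : ℂ)) (Q d) := by
  intro x hx
  have hx0 : x j ≠ 0 := (mem_Q.1 hx j).ne'
  have h1 : HasFDerivAt (fun x : Fin d → ℝ => ((x j ^ m : ℝ) : ℂ))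
      (Complex.ofRealCLM.comp ((m * x j ^ (m - 1)) • (ContinuousLinearMap.proj (R := ℝ)
        (φ := fun _ : Fin d => ℝ) j))) x := by
    have h2 : HasFDerivAt (fun x : Fin d → ℝ => x j)
      (ContinuousLinearMap.proj (R := ℝ) (φ := fun _ : Fin d => ℝ) j) x := hasFDerivAt_apply j x
    have h3 : HasFDerivAt (fun x : Fin d → ℝ => x j ^ m) ((m * x j ^ (m - 1)) •
        (ContinuousLinearMap.proj (R := ℝ) (φ := fun _ : Fin d => ℝ) j)) x := by
      have h4 := hasDerivAt_zpow m (x j) (Or.inl hx0)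
      exact h4.comp_hasFDerivAt x h2
    exact Complex.ofRealCLM.hasFDerivAt.comp x h3
  simp only [euler, h1.fderiv]
  by_cases hij : i = j
  · subst hij
    simp [zpow_sub_one₀ hx0]
    have : (x i : ℂ) ≠ 0 := by exact_mod_cast hx0
    field_simp
  · simp [hij]

theorem contDiffOn_zpow_coord {d : ℕ} (j : Fin d) (m : ℤ) :
    ContDiffOn ℝ ∞ (fun x : Fin d → ℝ => ((x j ^ m : ℝ) : ℂ)) (Q d) := by
  suffices h0 : ContDiffOn ℝ ∞ (fun x : Fin d → ℝ => x j ^ m) (Q d) from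
    Complex.ofRealCLM.contDiff.comp_contDiffOn h0
  have h : ContDiffOn ℝ ∞ (fun x : Fin d → ℝ => x j) (Q d) := (contDiff_apply ℝ ℝ j).contDiffOn
  cases m with
  | ofNat m => simpa using! h.pow m
  | negSucc m =>
    simpa [zpow_negSucc] using! (h.pow (m + 1)).inv fun x hx => pow_ne_zero _ (mem_Q.1 hx j).ne'

theorem exists_eulerSum_weightOne_le {d : ℕ} (j : Fin d) (k n : ℕ) :
    ∃ C : ℝ, 0 ≤ C ∧ ∀ x ∈ Q d,
      eulerSum n (fun x => ((weightOne k (x j) : ℝ) : ℂ)) x ≤ C * weightOne k (x j) := by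
  set c : ℤ → Fin d → ℂ := fun m i => if i = j then (m : ℂ) else 0
  set A : ℤ → ℝ := fun m => (1 + ∑ i, ‖c m i‖) ^ n
  have hA : ∀ m, 0 ≤ A m := fun m => by positivity
  refine ⟨A (2 * k : ℕ) + A (-(2 * k : ℕ)), add_nonneg (hA _) (hA _), fun x hx => ?_⟩
  have h0 : ∀ x : Fin d → ℝ, ((weightOne k (x j) : ℝ) : ℂ) =
      ((x j ^ ((2 * k : ℕ) : ℤ) : ℝ) : ℂ) + ((x j ^ (-((2 * k : ℕ) : ℤ)) : ℝ) : ℂ) := fun x => by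
    rw [zpow_neg, zpow_natCast, ← Complex.ofReal_add, weightOne]
  simp_rw [h0]
  refine (eulerSum_add_le n (contDiffOn_zpow_coord j _) (contDiffOn_zpow_coord j _) hx).trans ?_
  rw [eulerSum_of_eigen (fun i => euler_zpow_eqOn i j _) n hx,
    eulerSum_of_eigen (fun i => euler_zpow_eqOn i j _) n hx, add_mul]
  have hz : ∀ m : ℤ, |m| ≤ 2 * k → ‖((x j ^ m : ℝ) : ℂ)‖ ≤ weightOne k (x j) := fun m hm => by
    rw [Complex.norm_real, Real.norm_of_nonneg (zpow_pos (hx j) _).le]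
    exact zpow_le_weightOne hm (hx j)
  exact add_le_add (mul_le_mul_of_nonneg_left (hz _ (by simp)) (hA _))
    (mul_le_mul_of_nonneg_left (hz _ (by simp)) (hA _))

theorem exists_eulerSum_weight_le {d : ℕ} (k n : ℕ) :
    ∃ C : ℝ, 0 ≤ C ∧ ∀ x ∈ Q d,
      eulerSum n (fun x : Fin d → ℝ => ((weight k x : ℝ) : ℂ)) x ≤ C * weight k x := by
  classical
  have hsm : ∀ j : Fin d, ContDiffOn ℝ ∞ (fun x : Fin d → ℝ => ((weightOne k (x j) : ℝ) : ℂ))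
      (Q d) := fun j => by
    have h := (contDiffOn_zpow_coord j (2 * k : ℕ)).add (contDiffOn_zpow_coord j (-(2 * k : ℕ)))
    refine h.congr fun x _ => ?_
    rw [zpow_neg, zpow_natCast, ← Complex.ofReal_add, weightOne]
  suffices h : ∀ s : Finset (Fin d), ∃ C : ℝ, 0 ≤ C ∧ ∀ x ∈ Q d,
      eulerSum n (fun x : Fin d → ℝ => ∏ j ∈ s, ((weightOne k (x j) : ℝ) : ℂ)) x ≤
        C * ∏ j ∈ s, weightOne k (x j) by
    simpa [weight_eq_prod] using h Finset.univ
  intro s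
  induction s using Finset.induction_on with
  | empty =>
    have h1 : ∀ j, EqOn (euler j fun _ : Fin d → ℝ => (1 : ℂ)) (fun _ => 0 * 1) (Q d) :=
      fun j x _ => by simp [euler]
    exact ⟨(1 + ∑ _j : Fin d, ‖(0 : ℂ)‖) ^ n, by positivity, fun x hx => by
      simp only [Finset.prod_empty]
      rw [eulerSum_of_eigen h1 n hx]; simp⟩
  | insert a s ha ih =>
    obtain ⟨C, hC0, hC⟩ := ih
    obtain ⟨C', hC0', hC'⟩ := exists_eulerSum_weightOne_le a k n
    refine ⟨2 ^ n * (C' * C), by positivity, fun x hx => ?_⟩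
    simp only [Finset.prod_insert ha]
    refine (eulerSum_mul_le n (hsm a) (contDiffOn_prod fun j _ => hsm j) hx).trans ?_
    have p : 0 ≤ weightOne k (x a) := (weightOne_pos k (hx a)).le
    calc _ ≤ 2 ^ n * ((C' * weightOne k (x a)) * (C * ∏ j ∈ s, weightOne k (x j))) :=
          mul_le_mul_of_nonneg_left (mul_le_mul (hC' x hx) (hC x hx) (eulerSum_nonneg _ _ _)
            (mul_nonneg hC0' p)) (by positivity)
      _ = _ := by ring

theorem contDiffOn_inv_weight {d : ℕ} (k : ℕ) :
    ContDiffOn ℝ ∞ (fun x : Fin d → ℝ => ((weight k x : ℝ) : ℂ)⁻¹) (Q d) :=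
  (contDiffOn_weight k).inv fun x hx => by exact_mod_cast (weight_pos k hx).ne'

/-- Follows from the corresponding estimate for `w_k` and `θ_j w_k⁻¹ = -(θ_j w_k) w_k⁻¹ w_k⁻¹`. -/
theorem exists_eulerSum_inv_weight_le {d : ℕ} (k n : ℕ) :
    ∃ C : ℝ, 0 ≤ C ∧ ∀ x ∈ Q d,
      eulerSum n (fun x : Fin d → ℝ => ((weight k x : ℝ) : ℂ)⁻¹) x ≤ C * (weight k x)⁻¹ := by
  set w : (Fin d → ℝ) → ℂ := fun x => ((weight k x : ℝ) : ℂ)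
  set v : (Fin d → ℝ) → ℂ := fun x => (w x)⁻¹
  have hw : ContDiffOn ℝ ∞ w (Q d) := contDiffOn_weight k
  have hv : ContDiffOn ℝ ∞ v (Q d) := contDiffOn_inv_weight k
  have hev : ∀ j, EqOn (euler j v) (fun x => (-1) * (euler j w x * (v x * v x))) (Q d) := by
    intro j x hx
    have hx0 : w x ≠ 0 := by
      change ((weight k x : ℝ) : ℂ) ≠ 0
      exact_mod_cast (weight_pos k hx).ne'
    have h1 : euler j (fun x => w x * v x) x = 0 := by
      have : (fun x => w x * v x) =ᶠ[nhds x] fun _ => 1 := by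
        filter_upwards [(Q d).isOpen.mem_nhds hx] with y hy
        have : w y ≠ 0 := by
          change ((weight k y : ℝ) : ℂ) ≠ 0
          exact_mod_cast (weight_pos k hy).ne'
        exact mul_inv_cancel₀ this
      rw [(eventuallyEq_euler j this).eq_of_nhds]
      simp [euler]
    rw [euler_mul_eqOn j hw hv hx] at h1
    have h2 : w x * v x = 1 := mul_inv_cancel₀ hx0
    linear_combination v x * h1 - euler j v x * h2
  induction n with
  | zero =>
    refine ⟨1, zero_le_one, fun x hx => ?_⟩
    simp [eulerSum, v, w, abs_of_pos (weight_pos k hx)]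
  | succ n ih =>
    obtain ⟨C, hC0, hC⟩ := ih
    obtain ⟨D, hD0, hD⟩ := exists_eulerSum_weight_le (d := d) k (n + 1)
    refine ⟨C + d * (2 ^ n * (D * (2 ^ n * (C * C)))), by positivity, fun x hx => ?_⟩
    have hp := weight_pos k hx
    have h1 : ∀ j, eulerSum n (euler j v) x ≤
        2 ^ n * (D * (2 ^ n * (C * C))) * (weight k x)⁻¹ := fun j => by
      rw [eulerSum_congr_of_eqOn n (hev j) hx, eulerSum_const_mul, norm_neg, norm_one, one_mul]
      calc _ ≤ 2 ^ n * (eulerSum n (euler j w) x * (2 ^ n * (eulerSum n v x * eulerSum n v x))) :=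
            (eulerSum_mul_le n (contDiffOn_euler j hw) (hv.mul hv) hx).trans
              (mul_le_mul_of_nonneg_left (mul_le_mul_of_nonneg_left (eulerSum_mul_le n hv hv hx)
                (eulerSum_nonneg _ _ _)) (by positivity))
        _ ≤ 2 ^ n * ((D * weight k x) * (2 ^ n * ((C * (weight k x)⁻¹) * (C * (weight k x)⁻¹)))) := by
            have a1 := (eulerSum_euler_le n j w x).trans (hD x hx)
            have a2 := hC x hx
            have a3 := eulerSum_nonneg n v x
            have a4 := eulerSum_nonneg n (euler j w) x
            gcongr
        _ = _ := by field_simp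
    calc eulerSum (n + 1) v x
        ≤ C * (weight k x)⁻¹ + ∑ _j : Fin d, 2 ^ n * (D * (2 ^ n * (C * C))) * (weight k x)⁻¹ :=
          add_le_add (hC x hx) (Finset.sum_le_sum fun j _ => h1 j)
      _ = _ := by simp; ring

/-! ### Uniform boundedness on spaces of test functions -/

/-- Uniform limits of all derivatives are the derivatives of the limit, so the functions in
`𝓓_K` form a closed subspace of the product of spaces of bounded continuous functions in which
they embed through their derivatives. -/
instance instCompleteSpaceSupportedIn {E F : Type*} [NormedAddCommGroup E] [NormedSpace ℝ E]
    [NormedAddCommGroup F] [NormedSpace ℝ F] [CompleteSpace F] (K : Compacts E) :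
    CompleteSpace 𝓓_{K}(E, F) := by
  have hΦ := ContDiffMapSupportedIn.isUniformEmbedding_pi_structureMapCLM ℝ (E := E) (F := F)
    (n := ⊤) (K := K)
  set Φ : 𝓓_{K}(E, F) →L[ℝ] Π i, BoundedContinuousFunction E (E [×i]→L[ℝ] F) :=
    ContinuousLinearMap.pi (ContDiffMapSupportedIn.structureMapCLM ℝ ⊤)
  rw [completeSpace_iff_isComplete_range hΦ.isUniformInducing]
  refine IsClosed.isComplete (isClosed_of_closure_subset fun g hg => ?_)
  set l : Filter 𝓓_{K}(E, F) := Filter.comap Φ (nhds g)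
  have hl : l.NeBot := Filter.comap_neBot fun t ht => by
    obtain ⟨_, h1, f, rfl⟩ := mem_closure_iff_nhds.1 hg t ht
    exact ⟨f, h1⟩
  have hlim : Filter.Tendsto Φ l (nhds g) := Filter.tendsto_comap
  have hi : ∀ i, Filter.Tendsto (fun f => Φ f i) l (nhds (g i)) := tendsto_pi_nhds.1 hlim
  have hΦi : ∀ f i x, Φ f i x = iteratedFDeriv ℝ i f x := fun f i x => by
    simp [Φ, ContDiffMapSupportedIn.structureMapCLM_apply]
  have hu : ∀ i, TendstoUniformly (fun (f : 𝓓_{K}(E, F)) x => iteratedFDeriv ℝ i f x) (g i) l :=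
    fun i => by
      have := BoundedContinuousFunction.tendsto_iff_tendstoUniformly.1 (hi i)
      have h2 : (fun (f : 𝓓_{K}(E, F)) x => iteratedFDeriv ℝ i f x) = fun f => ⇑(Φ f i) := by
        funext f x
        exact (hΦi f i x).symm
      rw [h2]
      exact this
  have hp : ∀ i x, Filter.Tendsto (fun f : 𝓓_{K}(E, F) => iteratedFDeriv ℝ i f x) l
      (nhds (g i x)) := fun i x => (hu i).tendsto_at x
  set f₀ : E → F := fun x => (g 0 x).curry0
  have hT : HasFTaylorSeriesUpTo ∞ f₀ fun x i => g i x := by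
    refine ⟨fun x => rfl, fun m _ x => ?_, fun m _ => (g m).continuous⟩
    have hu' : TendstoUniformly
        (fun (f : 𝓓_{K}(E, F)) x => (iteratedFDeriv ℝ (m + 1) f x).curryLeft)
        (fun x => (g (m + 1) x).curryLeft) l :=
      (continuousMultilinearCurryLeftEquiv ℝ (fun _ : Fin (m + 1) => E) F).toContinuousLinearEquiv
        |>.toContinuousLinearMap.uniformContinuous.comp_tendstoUniformly (hu (m + 1))
    refine hasFDerivAt_of_tendstoUniformly hu' (fun f x => ?_) (fun x => hp m x) x
    have h := (f.contDiff.ftaylorSeries).fderiv m (WithTop.coe_lt_coe.2 (ENat.natCast_lt_top m)) x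
    exact h
  have h0 : ∀ x, Filter.Tendsto (fun f : 𝓓_{K}(E, F) => f x) l (nhds (f₀ x)) := fun x => by
    have := ((continuousMultilinearCurryFin0 ℝ E F).continuous.tendsto _).comp (hp 0 x)
    exact this
  refine ⟨⟨f₀, hT.contDiff, fun x hx => ?_⟩, ?_⟩
  · refine tendsto_nhds_unique (h0 x) ?_
    refine tendsto_const_nhds.congr fun f => ?_
    exact (f.zero_on_compl hx).symm
  · funext i
    ext1 x
    rw [hΦi]
    exact ((hT.eq_iteratedFDeriv (by exact_mod_cast le_top) x)).symm

instance instBarrelledSpaceSupportedIn {E F : Type*} [NormedAddCommGroup E] [NormedSpace ℝ E]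
    [NormedAddCommGroup F] [NormedSpace ℂ F] [CompleteSpace F] (K : Compacts E) :
    BarrelledSpace ℂ 𝓓_{K}(E, F) := by
  have : (uniformity 𝓓_{K}(E, F)).IsCountablyGenerated := by
    rw [← (ContDiffMapSupportedIn.isUniformEmbedding_pi_structureMapCLM ℝ (E := E) (F := F)
      (n := ⊤) (K := K)).isUniformInducing.comap_uniformity]
    infer_instance
  infer_instance

/-- The composition with the dilation by `y`, from test functions supported in `K` to test
functions supported in `K'`; `K'` has to contain the support of these compositions. -/
def dilSupportedIn {d : ℕ} (y : Q d) {K K' : Compacts (Fin d → ℝ)}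
    (h : ∀ x, x * y.1 ∈ K → x ∈ K') :
    𝓓_{K}(Fin d → ℝ, ℂ) →L[ℂ] 𝓓_{K'}(Fin d → ℝ, ℂ) :=
  ContDiffMapSupportedIn.mkCLM ℂ (fun φ x => φ (dilation y x)) (fun _ _ _ => rfl)
    (fun _ _ _ => rfl) (fun φ => φ.contDiff.comp (dilation y).contDiff)
    (fun φ x hx => φ.zero_on_compl fun hx' => hx (h x (by rwa [dilation_apply] at hx')))
    (fun i _ => ⟨{i}, ‖((dilation y : (Fin d → ℝ) ≃L[ℝ] (Fin d → ℝ)) :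
        (Fin d → ℝ) →L[ℝ] (Fin d → ℝ))‖ ^ i, by positivity, fun φ x _ => by
      have h1 := ((dilation y : (Fin d → ℝ) ≃L[ℝ] (Fin d → ℝ)) :
        (Fin d → ℝ) →L[ℝ] (Fin d → ℝ)).iteratedFDeriv_comp_right (f := φ) φ.contDiff x
        (i := i) (by exact_mod_cast le_top)
      have h2 := ContinuousMultilinearMap.norm_compContinuousLinearMap_le
        (iteratedFDeriv ℝ i φ (dilation y x)) (fun _ : Fin i =>
          ((dilation y : (Fin d → ℝ) ≃L[ℝ] (Fin d → ℝ)) : (Fin d → ℝ) →L[ℝ] (Fin d → ℝ)))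
      have h3 := ContDiffMapSupportedIn.norm_iteratedFDeriv_apply_le_seminorm_top ℂ (i := i)
        (f := φ) (x := dilation y x)
      refine (le_of_eq (congrArg norm h1)).trans (h2.trans ?_)
      rw [Finset.prod_const, Finset.card_univ, Fintype.card_fin, mul_comm, Finset.sup_singleton]
      gcongr⟩)

theorem dilSupportedIn_apply {d : ℕ} (y : Q d) {K K' : Compacts (Fin d → ℝ)}
    (h : ∀ x, x * y.1 ∈ K → x ∈ K') (φ : 𝓓_{K}(Fin d → ℝ, ℂ)) (x : Fin d → ℝ) :
    dilSupportedIn y h φ x = φ (x * y.1) := by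
  rw [← dilation_apply]; rfl

/-- The compact set `y⁻¹ K`. -/
def dilCompacts {d : ℕ} (y : Q d) (K : Compacts (Fin d → ℝ)) : Compacts (Fin d → ℝ) :=
  K.map (dilation y).symm (dilation y).symm.continuous

theorem mem_dilCompacts {d : ℕ} {y : Q d} {K : Compacts (Fin d → ℝ)} {x : Fin d → ℝ} :
    x ∈ dilCompacts y K ↔ x * y.1 ∈ K := by
  rw [← dilation_apply]
  constructor
  · rintro ⟨z, hz, rfl⟩
    have : dilation y ((dilation y).symm z) = z := (dilation y).apply_symm_apply z
    rwa [this]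
  · exact fun hx => ⟨dilation y x, hx, (dilation y).symm_apply_apply x⟩

/-- The functional `φ ↦ T_x φ(x y)` on the test functions supported in `K`. -/
def dilFunctional {d : ℕ} (T : DistQ d) (y : Q d) (K : Compacts (Fin d → ℝ))
    (hK : (K : Set (Fin d → ℝ)) ⊆ Q d) : 𝓓_{K}(Fin d → ℝ, ℂ) →L[ℂ] ℂ :=
  have hK' : (dilCompacts y K : Set (Fin d → ℝ)) ⊆ Q d := fun x hx =>
    (dilation_mem_Q y x).1 (by rw [dilation_apply]; exact hK (mem_dilCompacts.1 hx))
  T.comp ((TestFunction.ofSupportedInCLM ℂ hK').comp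
    (dilSupportedIn (K' := dilCompacts y K) y fun _ => mem_dilCompacts.2))

theorem dilFunctional_apply {d : ℕ} (T : DistQ d) (y : Q d) (K : Compacts (Fin d → ℝ))
    (hK : (K : Set (Fin d → ℝ)) ⊆ Q d) (φ : 𝓓_{K}(Fin d → ℝ, ℂ)) :
    dilFunctional T y K hK φ = T (dilTest y (TestFunction.ofSupportedIn hK φ)) := by
  refine congrArg T ?_
  ext x
  exact dilSupportedIn_apply (K' := dilCompacts y K) y (fun _ => mem_dilCompacts.2) φ x

theorem one_mem_Q {d : ℕ} : (1 : Fin d → ℝ) ∈ Q d := fun _ => zero_lt_one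

theorem nonneg_of_eulerSum_le {d n : ℕ} {f : (Fin d → ℝ) → ℂ} {M : ℝ}
    (h : ∀ x ∈ Q d, eulerSum n f x ≤ M) : 0 ≤ M :=
  (eulerSum_nonneg n f 1).trans (h 1 one_mem_Q)

/-- Multiplication by a smooth function is continuous for the seminorms of `𝓓_K`. -/
theorem exists_seminorm_mul_le {d : ℕ} (K : Compacts (Fin d → ℝ)) {G : (Fin d → ℝ) → ℂ}
    (hG : ContDiff ℝ ∞ G) (i : ℕ) : ∃ C : ℝ, 0 ≤ C ∧ ∀ (g f : 𝓓_{K}(Fin d → ℝ, ℂ)) (M : ℝ),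
      (∀ x, f x = g x * G x) → (∀ l ≤ i, N[ℂ]_{K, l} g ≤ M) → N[ℂ]_{K, i} f ≤ C * M := by
  have h1 : ∀ l, ∃ C : ℝ, ∀ x ∈ K, ‖iteratedFDeriv ℝ l G x‖ ≤ C := fun l =>
    K.isCompact.exists_bound_of_continuousOn
      (hG.continuous_iteratedFDeriv (m := l) (by exact_mod_cast le_top)).continuousOn
  choose B hB using h1
  refine ⟨∑ l ∈ Finset.range (i + 1), (i.choose l : ℝ) * |B (i - l)|, by positivity,
    fun g f M hf hM => ?_⟩
  have hM0 : 0 ≤ M := (apply_nonneg _ _).trans (hM 0 (Nat.zero_le i))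
  refine (ContDiffMapSupportedIn.seminorm_top_le_iff ℂ (by positivity) i f).2 fun x hx => ?_
  have e : (f : (Fin d → ℝ) → ℂ) = fun x => g x * G x := funext hf
  rw [e]
  refine (norm_iteratedFDeriv_mul_le g.contDiff hG x (n := i)
    (by exact_mod_cast le_top)).trans ?_
  rw [Finset.sum_mul]
  refine Finset.sum_le_sum fun l hl => ?_
  have a1 := (ContDiffMapSupportedIn.norm_iteratedFDeriv_apply_le_seminorm_top ℂ (f := g)
    (x := x)).trans (hM l (Finset.mem_range_succ_iff.1 hl))
  have a2 := (hB (i - l) x hx).trans (le_abs_self _)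
  calc _ ≤ (i.choose l : ℝ) * M * |B (i - l)| := by gcongr
    _ = _ := by ring

/-- The map `c ↦ (v ↦ v_j c)`, which puts together a derivative from partial derivatives. -/
def coordSmul {d : ℕ} (j : Fin d) : ℂ →L[ℝ] (Fin d → ℝ) →L[ℝ] ℂ :=
  ContinuousLinearMap.smulRightL ℝ (Fin d → ℝ) ℂ
    (ContinuousLinearMap.proj (R := ℝ) (φ := fun _ : Fin d => ℝ) j)

theorem sum_coordSmul {d : ℕ} (L : (Fin d → ℝ) →L[ℝ] ℂ) :
    ∑ j, coordSmul j (L (Pi.single j 1)) = L := by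
  ext v
  have hv : v = ∑ j, v j • (Pi.single j 1 : Fin d → ℝ) := by
    ext i; simp [Finset.sum_apply, Pi.single_apply]
  conv_rhs => rw [hv]
  simp only [map_sum, map_smul, sum_apply]
  rfl

/-- On a compact subset of `Q` the derivatives of order at most `i` are estimated by the Euler
derivatives of order at most `i`, since `∂_j = x_j⁻¹ θ_j`. -/
theorem exists_seminorm_le {d : ℕ} (K : Compacts (Fin d → ℝ))
    (hK : (K : Set (Fin d → ℝ)) ⊆ Q d) (i : ℕ) :
    ∃ C : ℝ, 0 ≤ C ∧ ∀ (φ : 𝓓_{K}(Fin d → ℝ, ℂ)) (M : ℝ),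
      (∀ x ∈ Q d, eulerSum i φ x ≤ M) → ∀ l ≤ i, N[ℂ]_{K, l} φ ≤ C * M := by
  induction i with
  | zero =>
    refine ⟨1, zero_le_one, fun φ M hM l hl => ?_⟩
    obtain rfl : l = 0 := by omega
    have hM0 := nonneg_of_eulerSum_le hM
    refine (ContDiffMapSupportedIn.seminorm_top_le_iff ℂ (by linarith) 0 φ).2 fun x hx => ?_
    rw [norm_iteratedFDeriv_zero, one_mul]
    exact hM x (hK hx)
  | succ i ih =>
    obtain ⟨C, hC0, hC⟩ := ih
    have hG : ∀ j : Fin d, ∃ G : (Fin d → ℝ) → ℂ, ContDiff ℝ ∞ G ∧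
        ∀ x ∈ (K : Set (Fin d → ℝ)), G x = ((x j : ℝ) : ℂ)⁻¹ := fun j =>
      exists_smooth_extension _ ((contDiffOn_coord j).inv fun x hx => by
        exact_mod_cast (mem_Q.1 hx j).ne') K K.isCompact hK
    choose G hGs hG using hG
    choose B hB0 hB using fun j => exists_seminorm_mul_le K (hGs j) i
    set R : Fin d → ℂ →L[ℝ] (Fin d → ℝ) →L[ℝ] ℂ := coordSmul
    have hS : 0 ≤ ∑ j, ‖R j‖ * (B j * C) := Finset.sum_nonneg fun j _ =>
      mul_nonneg (R j).opNorm_nonneg (mul_nonneg (hB0 j) hC0)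
    refine ⟨C + ∑ j, ‖R j‖ * (B j * C), by positivity, fun φ M hM l hl => ?_⟩
    have hM0 := nonneg_of_eulerSum_le hM
    have hM' : ∀ x ∈ Q d, eulerSum i φ x ≤ M := fun x hx =>
      (eulerSum_le_succ i φ x).trans (hM x hx)
    rcases Nat.lt_or_ge i l with hil | hil
    swap
    · refine (hC φ M hM' l hil).trans (mul_le_mul_of_nonneg_right ?_ hM0)
      linarith
    obtain rfl : l = i + 1 := by omega
    have hv : ∀ x ∉ (K : Set (Fin d → ℝ)), fderiv ℝ φ x = 0 := fun x hx =>
      image_eq_zero_of_notMem_tsupport fun h =>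
        hx (φ.tsupport_subset (tsupport_fderiv_subset ℝ h))
    set θφ : Fin d → 𝓓_{K}(Fin d → ℝ, ℂ) := fun j => ⟨euler j φ, contDiff_euler j φ.contDiff,
      fun x hx => by simp [euler, hv x hx]⟩
    set Dφ : Fin d → 𝓓_{K}(Fin d → ℝ, ℂ) := fun j => ⟨fun x => fderiv ℝ φ x (Pi.single j 1),
      (φ.contDiff.fderiv_right (m := ∞) le_rfl).clm_apply contDiff_const,
      fun x hx => by simp [hv x hx]⟩
    have hD : ∀ j x, Dφ j x = θφ j x * G j x := fun j x => by
      change fderiv ℝ φ x (Pi.single j 1) = (x j : ℂ) * fderiv ℝ φ x (Pi.single j 1) * G j x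
      by_cases hx : x ∈ (K : Set (Fin d → ℝ))
      · have : ((x j : ℝ) : ℂ) ≠ 0 := by exact_mod_cast (mem_Q.1 (hK hx) j).ne'
        rw [hG j x hx]
        field_simp
      · simp [hv x hx]
    have h1 : ∀ j, N[ℂ]_{K, i} (Dφ j) ≤ B j * (C * M) := fun j =>
      hB j (θφ j) (Dφ j) (C * M) (hD j) fun l hl => hC (θφ j) M
        (fun x hx => (eulerSum_euler_le i j φ x).trans (hM x hx)) l hl
    have h2 : fderiv ℝ φ = fun x => ∑ j, R j (Dφ j x) :=
      funext fun x => (sum_coordSmul (fderiv ℝ φ x)).symm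
    refine (ContDiffMapSupportedIn.seminorm_top_le_iff ℂ (by positivity) _ φ).2 fun x hx => ?_
    rw [← norm_iteratedFDeriv_fderiv, h2]
    have h3 : iteratedFDeriv ℝ i (fun x => ∑ j, R j (Dφ j x)) x =
        ∑ j, iteratedFDeriv ℝ i (fun x => R j (Dφ j x)) x :=
      iteratedFDeriv_fun_sum_apply fun j _ =>
        (((R j).contDiff.comp (Dφ j).contDiff).of_le (by exact_mod_cast le_top)).contDiffAt
    rw [h3]
    calc ‖∑ j, iteratedFDeriv ℝ i (fun x => R j (Dφ j x)) x‖
        ≤ ∑ j, ‖R j‖ * (B j * (C * M)) := by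
          refine (norm_sum_le _ _).trans (Finset.sum_le_sum fun j _ => ?_)
          refine ((R j).norm_iteratedFDeriv_comp_left (f := Dφ j) (Dφ j).contDiff.contDiffAt
            (by exact_mod_cast le_top)).trans ?_
          gcongr
          exact (ContDiffMapSupportedIn.norm_iteratedFDeriv_apply_le_seminorm_top ℂ).trans (h1 j)
      _ = (∑ j, ‖R j‖ * (B j * C)) * M := by
          rw [Finset.sum_mul]; exact Finset.sum_congr rfl fun j _ => by ring
      _ ≤ _ := mul_le_mul_of_nonneg_right (by linarith) hM0

/-- Banach–Steinhaus for the functionals `φ ↦ T_x φ(x y)`, with `y ∈ Q`: bounds by `b y` which hold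
for each test function are uniform over the test functions with support in `K` and bounded Euler
derivatives of some order. -/
theorem exists_dil_bound {d : ℕ} (T : DistQ d) (b : Q d → ℝ) (hb : ∀ y, 0 < b y)
    (hT : ∀ φ : 𝓓(Q d, ℂ), ∃ C : ℝ, ∀ y, ‖T (dilTest y φ)‖ ≤ C * b y)
    {K : Set (Fin d → ℝ)} (hKc : IsCompact K) (hK : K ⊆ Q d) :
    ∃ C : ℝ, 0 ≤ C ∧ ∃ n : ℕ, ∀ (φ : 𝓓(Q d, ℂ)), tsupport φ ⊆ K → ∀ M : ℝ,
      (∀ x ∈ Q d, eulerSum n φ x ≤ M) → ∀ y, ‖T (dilTest y φ)‖ ≤ C * M * b y := by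
  set K' : Compacts (Fin d → ℝ) := ⟨K, hKc⟩
  set L : Q d → 𝓓_{K'}(Fin d → ℝ, ℂ) →L[ℂ] ℂ := fun y =>
    ((b y : ℂ)⁻¹) • dilFunctional T y K' hK
  have hL : ∀ y φ, ‖L y φ‖ = (b y)⁻¹ * ‖T (dilTest y (TestFunction.ofSupportedIn hK φ))‖ :=
    fun y φ => by
      simp [L, dilFunctional_apply, abs_of_pos (hb y)]
  have hbdd : ∀ (k : Fin 1) φ, BddAbove (range fun y => normSeminorm ℂ ℂ (L y φ)) := by
    intro _ φ
    obtain ⟨C, hC⟩ := hT (TestFunction.ofSupportedIn hK φ)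
    refine ⟨C, ?_⟩
    rintro _ ⟨y, rfl⟩
    simp only [coe_normSeminorm, hL]
    rw [inv_mul_le_iff₀ (hb y), mul_comm]
    exact hC y
  have hue := (norm_withSeminorms ℂ ℂ).banach_steinhaus (𝓕 := L) hbdd
  obtain ⟨p, hp, hpL⟩ := ((norm_withSeminorms ℂ ℂ).uniformEquicontinuous_iff_exists_continuous_seminorm
    (fun y => (L y).toLinearMap)).1 hue 0
  obtain ⟨s, C, -, hpC⟩ := Seminorm.bound_of_continuous
    (ContDiffMapSupportedIn.withSeminorms ℂ (Fin d → ℝ) ℂ ⊤ K') p hp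
  -- the largest order of the seminorms in `s`
  obtain ⟨D, hD0, hD⟩ := exists_seminorm_le K' hK (s.sup id)
  refine ⟨C * D, by positivity, s.sup id, fun φ hφ M hM y => ?_⟩
  set ψ : 𝓓_{K'}(Fin d → ℝ, ℂ) := ⟨φ, φ.contDiff, fun x hx =>
    image_eq_zero_of_notMem_tsupport fun h => hx (hφ h)⟩
  have h1 : (s.sup fun i => N[ℂ]_{K', i}) ψ ≤ D * M :=
    Seminorm.finset_sup_apply_le (mul_nonneg hD0 (nonneg_of_eulerSum_le hM)) fun i hi =>
      hD ψ M hM i (Finset.le_sup (f := id) hi)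
  have h2 : ‖L y ψ‖ ≤ C * (D * M) := by
    refine (hpL y ψ).trans ((hpC ψ).trans ?_)
    exact mul_le_mul_of_nonneg_left h1 C.2
  rw [hL, inv_mul_le_iff₀ (hb y)] at h2
  calc ‖T (dilTest y φ)‖ ≤ b y * (C * (D * M)) := h2
    _ = _ := by ring

/-! ### A Sobolev inequality -/

/-- The fundamental theorem of calculus for `t ↦ t φ(x_1, …, t, …, x_d)`, whose derivative is
`-(θ_j^* φ)`. -/
theorem enorm_mul_le_lintegral_eulerAdj {d : ℕ} (φ : 𝓓(Q d, ℂ)) (i : Fin d) (x : Fin d → ℝ) :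
    ENNReal.ofReal (x i) * ‖φ x‖ₑ ≤
      ∫⁻ t, ‖eulerAdj i φ (Function.update x i t)‖ₑ := by
  set h : ℝ → ℂ := fun t => (t : ℂ) * φ (Function.update x i t)
  have hd : ∀ t, HasDerivAt h (-eulerAdj i φ (Function.update x i t)) t := by
    intro t
    have h1 : HasDerivAt (fun t => φ (Function.update x i t))
        (fderiv ℝ φ (Function.update x i t) (Pi.single i 1)) t :=
      ((φ.contDiff.differentiable (by simp)).differentiableAt.hasFDerivAt).comp_hasDerivAt t
        (hasDerivAt_update x i t)
    have h2 : HasDerivAt (fun t : ℝ => (t : ℂ)) 1 t := Complex.ofRealCLM.hasDerivAt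
    refine (h2.mul h1).congr_deriv ?_
    simp [eulerAdj, euler]
  have hs : ContDiff ℝ 1 h :=
    (Complex.ofRealCLM.contDiff).mul
      ((φ.contDiff.of_le (by exact_mod_cast le_top)).comp (contDiff_update 1 x i))
  have hc : HasCompactSupport h :=
    (φ.hasCompactSupport.comp_isClosedEmbedding (isClosedEmbedding_update x i)).mul_left
  have h3 := hc.enorm_le_lintegral_Ici_deriv hs (x i)
  have h4 : ENNReal.ofReal (x i) ≤ ‖((x i : ℝ) : ℂ)‖ₑ := by
    rw [← ofReal_norm, Complex.norm_real]
    exact ENNReal.ofReal_le_ofReal (Real.le_norm_self _)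
  calc ENNReal.ofReal (x i) * ‖φ x‖ₑ ≤ ‖h (x i)‖ₑ := by
        simp only [h, Function.update_eq_self, enorm_mul]
        gcongr
    _ ≤ ∫⁻ t in Iic (x i), ‖deriv h t‖ₑ := h3
    _ ≤ ∫⁻ t, ‖deriv h t‖ₑ := lintegral_mono' Measure.restrict_le_self le_rfl
    _ = _ := by simp [fun t => (hd t).deriv]

theorem notMem_tsupport_of_notMem_Q {d : ℕ} (φ : 𝓓(Q d, ℂ)) {x : Fin d → ℝ} (hx : x ∉ Q d) :
    x ∉ tsupport φ := fun h => hx (φ.tsupport_subset h)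

/-- The preceding estimate, iterated over the coordinates in `s`. -/
theorem ofReal_prod_mul_enorm_le_lmarginal {d : ℕ} (s : Finset (Fin d)) (φ : 𝓓(Q d, ℂ))
    (x : Fin d → ℝ) : ENNReal.ofReal (∏ j ∈ s, x j) * ‖φ x‖ₑ ≤
      (∫⋯∫⁻_s, (fun z => ENNReal.ofReal (eulerSum s.card φ z)) ∂fun _ => volume) x := by
  induction s using Finset.induction_on generalizing φ x with
  | empty => simp [eulerSum]
  | insert i s hi ih =>
    by_cases hx : x ∈ Q d
    swap
    · simp [image_eq_zero_of_notMem_tsupport (notMem_tsupport_of_notMem_Q φ hx)]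
    have hm : Measurable fun z => ENNReal.ofReal (eulerSum (insert i s).card φ z) :=
      ENNReal.measurable_ofReal.comp (continuous_eulerSum _ φ.contDiff).measurable
    rw [lmarginal_insert _ hm hi, Finset.prod_insert hi,
      ENNReal.ofReal_mul (hx i).le, mul_comm (ENNReal.ofReal (x i)), mul_assoc]
    calc _ ≤ ENNReal.ofReal (∏ j ∈ s, x j) *
          ∫⁻ t, ‖eulerAdj i φ (Function.update x i t)‖ₑ := by
          gcongr
          exact enorm_mul_le_lintegral_eulerAdj φ i x
      _ = ∫⁻ t, ENNReal.ofReal (∏ j ∈ s, x j) * ‖eulerAdj i φ (Function.update x i t)‖ₑ := by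
          rw [lintegral_const_mul']
          exact ENNReal.ofReal_ne_top
      _ ≤ _ := by
          refine lintegral_mono fun t => ?_
          have h1 := ih (eulerAdjTest i φ) (Function.update x i t)
          have h2 : ∏ j ∈ s, Function.update x i t j = ∏ j ∈ s, x j :=
            Finset.prod_congr rfl fun j hj => Function.update_of_ne
              (ne_of_mem_of_not_mem hj hi) _ _
          rw [h2, coe_eulerAdjTest] at h1
          refine h1.trans (lmarginal_mono (fun z => ENNReal.ofReal_le_ofReal ?_) _)
          rw [Finset.card_insert_of_notMem hi]
          by_cases hz : z ∈ Q d
          · exact eulerSum_eulerAdj_le _ _ φ.contDiff.contDiffOn hz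
          · have hz' := notMem_tsupport_of_notMem_Q φ hz
            rw [eulerSum_eq_zero _ fun h => hz' (tsupport_eulerAdj_subset i φ h),
              eulerSum_eq_zero _ hz']

theorem hasCompactSupport_eulerSum {d : ℕ} (n : ℕ) (φ : 𝓓(Q d, ℂ)) :
    HasCompactSupport (eulerSum n φ) :=
  HasCompactSupport.intro φ.hasCompactSupport fun _ hx => eulerSum_eq_zero n hx

theorem integrable_eulerSum {d : ℕ} (n : ℕ) (φ : 𝓓(Q d, ℂ)) :
    Integrable (eulerSum n φ) :=
  (continuous_eulerSum n φ.contDiff).integrable_of_hasCompactSupport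
    (hasCompactSupport_eulerSum n φ)

theorem prod_mul_norm_le_integral {d : ℕ} (φ : 𝓓(Q d, ℂ)) {x : Fin d → ℝ} (hx : x ∈ Q d) :
    (∏ j, x j) * ‖φ x‖ ≤ ∫ z, eulerSum d φ z := by
  have h := ofReal_prod_mul_enorm_le_lmarginal Finset.univ φ x
  rw [lmarginal_univ, ← ofReal_norm, ← ENNReal.ofReal_mul
    (Finset.prod_nonneg fun j _ => (hx j).le), Finset.card_univ, Fintype.card_fin,
    ← volume_pi, ← ofReal_integral_eq_lintegral_ofReal (integrable_eulerSum d φ)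
      (.of_forall fun z => eulerSum_nonneg _ _ _)] at h
  exact (ENNReal.ofReal_le_ofReal_iff (integral_nonneg fun z => eulerSum_nonneg _ _ _)).1 h

/-- The Sobolev inequality `x_1 ⋯ x_d |φ(x)| ≤ ∑ ∫ |θ^α φ|` for `φ` and its Euler derivatives. Its sides
scale in the same way under dilations. -/
theorem prod_mul_eulerSum_le_integral {d : ℕ} (m : ℕ) (φ : 𝓓(Q d, ℂ)) {x : Fin d → ℝ}
    (hx : x ∈ Q d) : (∏ j, x j) * eulerSum m φ x ≤ ∫ z, eulerSum (m + d) φ z := by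
  induction m generalizing φ with
  | zero => simpa [eulerSum] using prod_mul_norm_le_integral φ hx
  | succ m ih =>
    have h1 : ∀ j, (∏ j, x j) * eulerSum m (euler j φ) x ≤
        ∫ z, eulerSum (m + d) (euler j φ) z := fun j => by
      rw [← coe_thetaTest]; exact ih (thetaTest j φ)
    have h2 : (∫ z, eulerSum (m + 1 + d) φ z) =
        (∫ z, eulerSum (m + d) φ z) + ∑ j, ∫ z, eulerSum (m + d) (euler j φ) z := by
      have hi : ∀ j, Integrable (eulerSum (m + d) (euler j φ)) := fun j => by
        rw [← coe_thetaTest]; exact integrable_eulerSum _ _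
      rw [← integral_finsetSum _ fun j _ => hi j, ← integral_add (integrable_eulerSum _ φ)
        (integrable_finsetSum _ fun j _ => hi j), show m + 1 + d = m + d + 1 by omega]
      rfl
    rw [h2]
    simp only [eulerSum, mul_add, Finset.mul_sum]
    exact add_le_add (ih φ) (Finset.sum_le_sum fun j _ => h1 j)

/-! ### A dyadic partition of unity -/

/-- A smooth function which is `0` on `(-∞, 1]` and `1` on `[2, ∞)`. -/
def stepFn (t : ℝ) : ℝ := Real.smoothTransition (t - 1)

theorem stepFn_eq_zero {t : ℝ} (ht : t ≤ 1) : stepFn t = 0 :=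
  Real.smoothTransition.zero_of_nonpos (by linarith)

theorem stepFn_eq_one {t : ℝ} (ht : 2 ≤ t) : stepFn t = 1 :=
  Real.smoothTransition.one_of_one_le (by linarith)

theorem contDiff_stepFn : ContDiff ℝ ∞ stepFn :=
  Real.smoothTransition.contDiff.comp (contDiff_id.sub contDiff_const)

/-- The cube `[1/2, 2]^d`. -/
def cube (d : ℕ) : Set (Fin d → ℝ) := univ.pi fun _ => Icc (1 / 2) 2

theorem isCompact_cube (d : ℕ) : IsCompact (cube d) := isCompact_univ_pi fun _ => isCompact_Icc

theorem cube_subset_Q (d : ℕ) : cube d ⊆ Q d := fun x hx j => by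
  have := (hx j (mem_univ j)).1
  linarith

/-- A smooth function supported in `[1/2, 2]^d` whose dyadic dilates sum up to `1`. -/
def bumpFn {d : ℕ} (x : Fin d → ℝ) : ℝ := ∏ j, (stepFn (2 * x j) - stepFn (x j))

theorem contDiff_bumpFn {d : ℕ} : ContDiff ℝ ∞ (bumpFn (d := d)) := by
  refine contDiff_prod fun j _ => ?_
  have h : ContDiff ℝ ∞ fun x : Fin d → ℝ => x j := contDiff_apply ℝ ℝ j
  exact (contDiff_stepFn.comp (contDiff_const.mul h)).sub (contDiff_stepFn.comp h)

theorem bumpFn_eq_zero {d : ℕ} {x : Fin d → ℝ} (hx : x ∉ cube d) : bumpFn x = 0 := by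
  obtain ⟨j, hj⟩ : ∃ j, x j ∉ Icc (1 / 2 : ℝ) 2 := by
    by_contra! h
    exact hx fun j _ => h j
  refine Finset.prod_eq_zero (Finset.mem_univ j) ?_
  by_cases h : 1 / 2 ≤ x j
  · have h2 : 2 < x j := not_le.1 fun h' => hj ⟨h, h'⟩
    rw [stepFn_eq_one (by linarith), stepFn_eq_one h2.le, sub_self]
  · rw [stepFn_eq_zero (by linarith), stepFn_eq_zero (by linarith), sub_self]

/-- `bumpFn` as a test function. -/
def bump (d : ℕ) : 𝓓(Q d, ℂ) :=
  mkTest (fun x => (bumpFn x : ℂ)) (cube d) (isCompact_cube d) (cube_subset_Q d)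
    (Complex.ofRealCLM.contDiff.comp contDiff_bumpFn).contDiffOn
    (fun x hx => by rw [bumpFn_eq_zero hx, Complex.ofReal_zero])

theorem bump_apply {d : ℕ} (x : Fin d → ℝ) : bump d x = (bumpFn x : ℂ) := rfl

theorem tsupport_bump_subset (d : ℕ) : tsupport (bump d) ⊆ cube d :=
  closure_minimal (fun x (hx : bump d x ≠ 0) => by_contra fun h => hx (by
    rw [bump_apply, bumpFn_eq_zero h, Complex.ofReal_zero])) (isCompact_cube d).isClosed

/-- The point `(2^{i_1 - N}, …, 2^{i_d - N})` of `Q`. -/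
def dyadic {d : ℕ} (N : ℕ) (i : Fin d → ℕ) : Q d :=
  ⟨fun j => 2 ^ ((i j : ℤ) - N), fun _ => zpow_pos two_pos _⟩

/-- The indices `i` of the points `dyadic N i` with coordinates from `2^{-N}` to `2^{N-1}`. -/
def dyadicBox (d N : ℕ) : Finset (Fin d → ℕ) := Fintype.piFinset fun _ => Finset.range (2 * N)

/-- The sum telescopes in each coordinate. -/
theorem sum_bump_dyadic {d : ℕ} (N : ℕ) (x : Fin d → ℝ) :
    ∑ i ∈ dyadicBox d N, bump d (x * (dyadic N i).1) =
      ((∏ j, (stepFn (x j * 2 ^ (N : ℤ)) - stepFn (x j * 2 ^ (-(N : ℤ)))) : ℝ) : ℂ) := by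
  have h1 : ∀ j, ∑ i ∈ Finset.range (2 * N), (stepFn (2 * (x j * 2 ^ ((i : ℤ) - N))) -
      stepFn (x j * 2 ^ ((i : ℤ) - N))) =
        stepFn (x j * 2 ^ (N : ℤ)) - stepFn (x j * 2 ^ (-(N : ℤ))) := fun j => by
    have h2 := Finset.sum_range_sub (fun i : ℕ => stepFn (x j * 2 ^ ((i : ℤ) - N))) (2 * N)
    have e1 : ((2 * N : ℕ) : ℤ) - N = N := by push_cast; ring
    have e2 : ((0 : ℕ) : ℤ) - N = -N := by simp
    rw [e1, e2] at h2
    rw [← h2]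
    refine Finset.sum_congr rfl fun i _ => ?_
    have e3 : ((i + 1 : ℕ) : ℤ) - N = (i : ℤ) - N + 1 := by push_cast; ring
    rw [e3, zpow_add_one₀ two_ne_zero]
    ring_nf
  simp_rw [← h1]
  rw [Finset.prod_univ_sum, Complex.ofReal_sum]
  rfl

theorem exists_sum_bump_eq_one {d : ℕ} {K : Set (Fin d → ℝ)} (hK : IsCompact K) (hKQ : K ⊆ Q d) :
    ∃ N₀ : ℕ, ∀ N ≥ N₀, ∀ x ∈ K, ∑ i ∈ dyadicBox d N, bump d (x * (dyadic N i).1) = 1 := by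
  obtain ⟨R, hR⟩ := hK.exists_bound_of_continuousOn (f := fun x => x) continuousOn_id
  have hinv : ContinuousOn (fun x : Fin d → ℝ => x⁻¹) K :=
    continuousOn_pi.2 fun j => (continuous_apply j).continuousOn.inv₀ fun x hx => (hKQ hx j).ne'
  obtain ⟨R', hR'⟩ := hK.exists_bound_of_continuousOn hinv
  obtain ⟨N₀, hN₀⟩ := pow_unbounded_of_one_lt (max R (2 * R')) (one_lt_two)
  refine ⟨N₀, fun N hN x hx => ?_⟩
  have hN : max R (2 * R') ≤ 2 ^ N := hN₀.le.trans (pow_le_pow_right₀ one_le_two hN)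
  have hp : (0 : ℝ) < 2 ^ N := by positivity
  rw [sum_bump_dyadic, Complex.ofReal_eq_one]
  refine Finset.prod_eq_one fun j _ => ?_
  have hxj := hKQ hx j
  have h1 : x j ≤ 2 ^ N := (Real.le_norm_self _).trans (((norm_le_pi_norm x j).trans
    (hR x hx)).trans ((le_max_left _ _).trans hN))
  have h2 : 2 * (x j)⁻¹ ≤ 2 ^ N := by
    have := (Real.le_norm_self _).trans ((norm_le_pi_norm x⁻¹ j).trans (hR' x hx))
    rw [Pi.inv_apply] at this
    have := (le_max_right R (2 * R')).trans hN
    linarith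
  rw [← div_eq_mul_inv, div_le_iff₀ hxj] at h2
  rw [zpow_neg, zpow_natCast, stepFn_eq_one (by linarith), stepFn_eq_zero, sub_zero]
  rw [← div_eq_mul_inv, div_le_one hp]
  exact h1

/-- The sum is dominated by a product of two-sided geometric series, since
`w_1(2^m) ≥ 4^{|m|}` in one variable. -/
theorem sum_inv_weight_dyadic_le (d N : ℕ) :
    ∑ i ∈ dyadicBox d N, (weight 1 (dyadic N i).1)⁻¹ ≤ 4 ^ d := by
  have hg : ∀ n : ℕ, ∑ i ∈ Finset.range n, ((1 : ℝ) / 4) ^ i ≤ 2 := fun n => by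
    have : ∑ i ∈ Finset.range n, ((1 : ℝ) / 4) ^ i = 4 / 3 * (1 - (1 / 4) ^ n) := by
      induction n with
      | zero => simp
      | succ n ih => rw [Finset.sum_range_succ, ih]; ring
    have h2 : (0 : ℝ) < (1 / 4) ^ n := by positivity
    linarith
  have hw : ∀ (m : ℤ) (l : ℕ), (l : ℤ) ≤ |m| → (weightOne 1 ((2 : ℝ) ^ m))⁻¹ ≤ (1 / 4) ^ l := by
    intro m l hl
    have h0 : (0 : ℝ) < 4 ^ l := by positivity
    rw [one_div, inv_pow]
    refine inv_anti₀ h0 ?_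
    have e1 : ((2 : ℝ) ^ m) ^ (2 * 1) = 4 ^ m := by
      rw [mul_one, ← zpow_natCast, ← zpow_mul, mul_comm, zpow_mul]; norm_num
    have e2 : (4 : ℝ) ^ l ≤ 4 ^ |m| := by
      rw [← zpow_natCast]; exact zpow_le_zpow_right₀ (by norm_num) hl
    have p1 : (0 : ℝ) < 4 ^ m := by positivity
    have p2 : (0 : ℝ) < (4 ^ m)⁻¹ := by positivity
    rw [weightOne, e1]
    rcases abs_cases m with ⟨h, _⟩ | ⟨h, _⟩
    · rw [h] at e2; linarith
    · rw [h, zpow_neg] at e2; linarith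
  have h1 : ∑ i ∈ Finset.range (2 * N), (weightOne 1 ((2 : ℝ) ^ ((i : ℤ) - N)))⁻¹ ≤ 4 := by
    rw [two_mul, Finset.sum_range_add, ← Finset.sum_range_reflect]
    have a1 : ∑ i ∈ Finset.range N, (weightOne 1 ((2 : ℝ) ^ (((N - 1 - i : ℕ) : ℤ) - N)))⁻¹ ≤ 2 :=
      (Finset.sum_le_sum fun i hi => hw _ i (by
        have := Finset.mem_range.1 hi
        rw [le_abs]; right; omega)).trans (hg N)
    have a2 : ∑ i ∈ Finset.range N, (weightOne 1 ((2 : ℝ) ^ (((N + i : ℕ) : ℤ) - N)))⁻¹ ≤ 2 :=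
      (Finset.sum_le_sum fun i hi => hw _ i (by rw [le_abs]; left; omega)).trans (hg N)
    linarith
  calc ∑ i ∈ dyadicBox d N, (weight 1 (dyadic N i).1)⁻¹
      = ∏ _j : Fin d, ∑ i ∈ Finset.range (2 * N), (weightOne 1 ((2 : ℝ) ^ ((i : ℤ) - N)))⁻¹ := by
        rw [Finset.prod_univ_sum]
        refine Finset.sum_congr rfl fun i _ => ?_
        rw [weight_eq_prod, Finset.prod_inv_distrib]
        rfl
    _ ≤ ∏ _j : Fin d, (4 : ℝ) := Finset.prod_le_prod (fun j _ => Finset.sum_nonneg fun i _ =>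
        (inv_pos.2 (weightOne_pos 1 (zpow_pos two_pos _))).le) fun j _ => h1
    _ = 4 ^ d := by simp

/-! ### From pointwise bounds to integral bounds -/

theorem exists_eulerSum_bump_le (d n : ℕ) : ∃ B : ℝ, 0 ≤ B ∧ ∀ x, eulerSum n (bump d) x ≤ B := by
  obtain ⟨B, hB⟩ := (continuous_eulerSum n (bump d).contDiff).bounded_above_of_compact_support
    (hasCompactSupport_eulerSum n (bump d))
  exact ⟨B, (norm_nonneg _).trans (hB 0), fun x => (Real.le_norm_self _).trans (hB x)⟩

/-- A localized test function: `φ` times a dilate of `bump`. -/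
def localize {d : ℕ} (c : Q d) (φ : 𝓓(Q d, ℂ)) : 𝓓(Q d, ℂ) :=
  mulTest φ φ.contDiff.contDiffOn (dilTest c (bump d))

theorem localize_apply {d : ℕ} (c : Q d) (φ : 𝓓(Q d, ℂ)) (x : Fin d → ℝ) :
    localize c φ x = bump d (x * c.1) * φ x := rfl

theorem sum_localize {d : ℕ} (φ : 𝓓(Q d, ℂ)) :
    ∃ N, φ = ∑ i ∈ dyadicBox d N, localize (dyadic N i) φ := by
  obtain ⟨N, hN⟩ := exists_sum_bump_eq_one φ.hasCompactSupport φ.tsupport_subset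
  refine ⟨N, ?_⟩
  ext x
  have h1 : (∑ i ∈ dyadicBox d N, localize (dyadic N i) φ) x =
      ∑ i ∈ dyadicBox d N, localize (dyadic N i) φ x := by simp
  rw [h1]
  simp only [localize_apply, ← Finset.sum_mul]
  by_cases hx : x ∈ tsupport φ
  · rw [hN N le_rfl x hx, one_mul]
  · rw [image_eq_zero_of_notMem_tsupport hx, mul_zero]

theorem bump_eq_zero_of_notMem {d : ℕ} {x : Fin d → ℝ} (hx : x ∉ cube d) : bump d x = 0 := by
  rw [bump_apply, bumpFn_eq_zero hx, Complex.ofReal_zero]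

/-- If the functions `y ↦ T_x φ(x y)` are all of size `b`, then `T` is bounded by a weighted
`L_1` norm of the Euler derivatives of the test function. The test function is cut into pieces
supported in dyadic cubes, which are dilated to the unit cube, where the uniform bound of
`exists_dil_bound` applies; suprema are estimated by `L_1` norms with the Sobolev inequality. -/
theorem exists_integral_bound {d : ℕ} (T : DistQ d) (b : Q d → ℝ) (hb : ∀ y, 0 < b y)
    (hT : ∀ φ : 𝓓(Q d, ℂ), ∃ C : ℝ, ∀ y, ‖T (dilTest y φ)‖ ≤ C * b y)
    (v : (Fin d → ℝ) → ℝ) (hv0 : ∀ x ∈ Q d, 0 ≤ v x) (hvc : ContinuousOn v (Q d))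
    (hbv : ∃ C : ℝ, 0 ≤ C ∧ ∀ c : Q d, ∀ x ∈ Q d, x * c.1 ∈ cube d →
      (∏ j, c.1 j) * weight 1 c.1 * b c ≤ C * v x) :
    ∃ C : ℝ, 0 ≤ C ∧ ∃ n : ℕ, ∀ φ : 𝓓(Q d, ℂ),
      ‖T φ‖ ≤ C * ∫ x, eulerSum n φ x * v x := by
  obtain ⟨C₁, hC₁, m, hm⟩ := exists_dil_bound T b hb hT (isCompact_cube d) (cube_subset_Q d)
  obtain ⟨C₂, hC₂, hvb⟩ := hbv
  obtain ⟨B, hB0, hB⟩ := exists_eulerSum_bump_le d (m + d)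
  refine ⟨C₁ * 2 ^ d * (2 ^ (m + d) * B * C₂) * 4 ^ d, by positivity, m + d, fun φ => ?_⟩
  have hint : Integrable fun x => eulerSum (m + d) φ x * v x := by
    rw [← integrableOn_iff_integrable_of_support_subset (s := tsupport φ)]
    · exact ((continuous_eulerSum _ φ.contDiff).continuousOn.mul
        (hvc.mono φ.tsupport_subset)).integrableOn_compact φ.hasCompactSupport
    · intro x hx
      by_contra h
      exact hx (by simp [eulerSum_eq_zero _ h])
  set I := ∫ x, eulerSum (m + d) φ x * v x
  -- the estimate of one piece
  have hpiece : ∀ c : Q d, ‖T (localize c φ)‖ ≤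
      C₁ * 2 ^ d * (2 ^ (m + d) * B * C₂) * I * (weight 1 c.1)⁻¹ := by
    intro c
    have hc0 : 0 < ∏ j, c.1 j := Finset.prod_pos fun j _ => c.2 j
    have hw0 := weight_pos 1 c.2
    set g := dilTest (invQ c) (localize c φ)
    have hg : ∀ x, g x = localize c φ (x * (invQ c).1) := fun x => rfl
    have hgT : dilTest c g = localize c φ := by
      ext x
      change g (x * c.1) = _
      rw [hg, mul_invQ_cancel]
    -- the piece near `c⁻¹`, moved to the cube
    have hgs : tsupport g ⊆ cube d := by
      refine closure_minimal (fun x (hx : g x ≠ 0) => ?_) (isCompact_cube d).isClosed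
      by_contra h
      refine hx ?_
      rw [hg, localize_apply, invQ_mul_cancel, bump_eq_zero_of_notMem h, zero_mul]
    set J := ∫ z, eulerSum (m + d) (localize c φ) z
    have hJ0 : 0 ≤ J := integral_nonneg fun _ => eulerSum_nonneg _ _ _
    -- the Sobolev inequality, with `∏ x_j ≥ 2^{-d}` on the cube
    have hsup : ∀ x ∈ Q d, eulerSum m g x ≤ 2 ^ d * (∏ j, c.1 j) * J := by
      intro x hx
      by_cases hxc : x ∈ cube d
      · have h1 : eulerSum m g x = eulerSum m (localize c φ) (x * (invQ c).1) :=
          eulerSum_comp_mul m (invQ c) (localize c φ) x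
        have h2 := prod_mul_eulerSum_le_integral m (localize c φ) (mul_mem_Q hx (invQ c).2)
        rw [← h1] at h2
        have h3 : ∏ j, (x * (invQ c).1) j = (∏ j, x j) * (∏ j, c.1 j)⁻¹ := by
          simp [invQ, Finset.prod_mul_distrib, Finset.prod_inv_distrib]
        have h4 : (1 / 2 : ℝ) ^ d ≤ ∏ j, x j := by
          have : (1 / 2 : ℝ) ^ d = ∏ _j : Fin d, (1 / 2 : ℝ) := by simp
          rw [this]
          exact Finset.prod_le_prod (fun _ _ => by norm_num) fun j _ => (hxc j (mem_univ j)).1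
        have h5 : (1 / 2 : ℝ) ^ d * (∏ j, c.1 j)⁻¹ * eulerSum m g x ≤ J := by
          refine le_trans ?_ h2
          rw [h3]
          gcongr
          exact eulerSum_nonneg _ _ _
        have h6 : (1 / 2 : ℝ) ^ d * (∏ j, c.1 j)⁻¹ * eulerSum m g x =
            (2 ^ d * ∏ j, c.1 j)⁻¹ * eulerSum m g x := by
          rw [mul_inv, one_div, inv_pow]
        rw [h6, inv_mul_le_iff₀ (by positivity)] at h5
        exact h5
      · rw [eulerSum_eq_zero m fun h => hxc (hgs h)]
        positivity
    -- the hypothesis on `v` turns the factor of the dilation into a summable one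
    have hJ : (∏ j, c.1 j) * b c * J ≤ 2 ^ (m + d) * B * C₂ * I * (weight 1 c.1)⁻¹ := by
      have h1 : ∀ z, (∏ j, c.1 j) * b c * eulerSum (m + d) (localize c φ) z ≤
          2 ^ (m + d) * B * C₂ * (weight 1 c.1)⁻¹ * (eulerSum (m + d) φ z * v z) := by
        intro z
        by_cases hz : z ∈ Q d
        swap
        · rw [eulerSum_eq_zero _ (notMem_tsupport_of_notMem_Q _ hz),
            eulerSum_eq_zero _ (notMem_tsupport_of_notMem_Q _ hz)]
          simp
        have hG : 0 ≤ eulerSum (m + d) φ z := eulerSum_nonneg _ _ _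
        by_cases hzc : z * c.1 ∈ cube d
        · have h2 := eulerSum_mul_le (m + d) (dilTest c (bump d)).contDiff.contDiffOn
            φ.contDiff.contDiffOn hz
          have h3 : eulerSum (m + d) (dilTest c (bump d)) z ≤ B := by
            have := eulerSum_comp_mul (m + d) c (bump d) z
            exact this.le.trans (hB _)
          have h4 : (∏ j, c.1 j) * b c ≤ C₂ * v z * (weight 1 c.1)⁻¹ := by
            rw [le_mul_inv_iff₀ hw0]
            calc _ = (∏ j, c.1 j) * weight 1 c.1 * b c := by ring
              _ ≤ _ := hvb c z hz hzc
          calc (∏ j, c.1 j) * b c * eulerSum (m + d) (localize c φ) z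
              ≤ (C₂ * v z * (weight 1 c.1)⁻¹) * (2 ^ (m + d) * (B * eulerSum (m + d) φ z)) := by
                have hbc := hb c
                refine mul_le_mul h4 (h2.trans ?_) (eulerSum_nonneg _ _ _) ?_
                · gcongr
                · exact le_trans (by positivity) h4
            _ = _ := by ring
        · have h0 : eulerSum (m + d) (localize c φ) z = 0 := by
            refine eulerSum_eq_zero _ fun h => hzc ?_
            have hcl : IsClosed {z : Fin d → ℝ | z * c.1 ∈ cube d} :=
              (isCompact_cube d).isClosed.preimage (continuous_id.mul continuous_const)
            refine closure_minimal (fun x (hx : localize c φ x ≠ 0) => ?_) hcl h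
            by_contra h'
            exact hx (by rw [localize_apply, bump_eq_zero_of_notMem h', zero_mul])
          rw [h0, mul_zero]
          have := hv0 z hz
          positivity
      calc (∏ j, c.1 j) * b c * J
          = ∫ z, (∏ j, c.1 j) * b c * eulerSum (m + d) (localize c φ) z :=
            (integral_const_mul _ _).symm
        _ ≤ ∫ z, 2 ^ (m + d) * B * C₂ * (weight 1 c.1)⁻¹ * (eulerSum (m + d) φ z * v z) :=
            integral_mono ((integrable_eulerSum _ _).const_mul _) (hint.const_mul _) h1
        _ = 2 ^ (m + d) * B * C₂ * (weight 1 c.1)⁻¹ * I := integral_const_mul _ _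
        _ = _ := by ring
    calc ‖T (localize c φ)‖ = ‖T (dilTest c g)‖ := by rw [hgT]
      _ ≤ C₁ * (2 ^ d * (∏ j, c.1 j) * J) * b c := hm g hgs _ hsup c
      _ = C₁ * 2 ^ d * ((∏ j, c.1 j) * b c * J) := by ring
      _ ≤ C₁ * 2 ^ d * (2 ^ (m + d) * B * C₂ * I * (weight 1 c.1)⁻¹) := by gcongr
      _ = _ := by ring
  have hI0 : 0 ≤ I := integral_nonneg fun x => by
    by_cases hx : x ∈ Q d
    · exact mul_nonneg (eulerSum_nonneg _ _ _) (hv0 x hx)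
    · simp [eulerSum_eq_zero _ (notMem_tsupport_of_notMem_Q φ hx)]
  obtain ⟨N, hN⟩ := sum_localize φ
  calc ‖T φ‖ = ‖∑ i ∈ dyadicBox d N, T (localize (dyadic N i) φ)‖ := by
        conv_lhs => rw [hN, map_sum]
    _ ≤ ∑ i ∈ dyadicBox d N, C₁ * 2 ^ d * (2 ^ (m + d) * B * C₂) * I *
          (weight 1 (dyadic N i).1)⁻¹ :=
        (norm_sum_le _ _).trans (Finset.sum_le_sum fun i _ => hpiece _)
    _ ≤ C₁ * 2 ^ d * (2 ^ (m + d) * B * C₂) * I * 4 ^ d := by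
        rw [← Finset.mul_sum]
        gcongr
        exact sum_inv_weight_dyadic_le d N
    _ = _ := by ring

/-! ### Multi-index powers of the Euler operators -/

/-- The product `a_{j_r}^{β_{j_r}} ⋯ a_{j_1}^{β_{j_1}}` for the list `j_1, …, j_r`. -/
def opPow {M : Type*} [Monoid M] {d : ℕ} (a : Fin d → M) (β : Fin d → ℕ) : List (Fin d) → M
  | [] => 1
  | j :: l => opPow a β l * a j ^ β j

theorem opPow_congr {M : Type*} [Monoid M] {d : ℕ} (a : Fin d → M) {β γ : Fin d → ℕ}
    (l : List (Fin d)) (h : ∀ j ∈ l, β j = γ j) : opPow a β l = opPow a γ l := by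
  induction l with
  | nil => rfl
  | cons j l ih =>
    simp only [opPow]
    rw [ih fun i hi => h i (List.mem_cons_of_mem _ hi), h j List.mem_cons_self]

theorem opPow_zero {M : Type*} [Monoid M] {d : ℕ} (a : Fin d → M) (l : List (Fin d)) :
    opPow a 0 l = 1 := by
  induction l with
  | nil => rfl
  | cons j l ih => simp [opPow, ih]

theorem opPow_add_single {M : Type*} [Monoid M] {d : ℕ} {a : Fin d → M}
    (ha : ∀ i j, Commute (a i) (a j)) (β : Fin d → ℕ) (i : Fin d) {l : List (Fin d)}
    (hl : l.Nodup) (hi : i ∈ l) : opPow a (β + Pi.single i 1) l = opPow a β l * a i := by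
  induction l with
  | nil => simp at hi
  | cons j l ih =>
    obtain ⟨hj, hl'⟩ := List.nodup_cons.1 hl
    simp only [opPow]
    rcases eq_or_ne i j with rfl | hij
    · rw [opPow_congr a (γ := β) l fun k hk => by
        have : k ≠ i := fun h => hj (h ▸ hk)
        simp [this]]
      simp [pow_succ, mul_assoc]
    · have h1 : i ∈ l := (List.mem_cons.1 hi).resolve_left hij
      have h2 : (β + Pi.single i 1 : Fin d → ℕ) j = β j := by simp [hij.symm]
      rw [ih hl' h1, h2, mul_assoc, mul_assoc, ((ha i j).pow_right (β j)).eq]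

/-- The operator `∏_j (-θ_j - 1)^{β_j}` on functions, the factors with `j` in the list. -/
def eulerAdjPow {d : ℕ} (β : Fin d → ℕ) : List (Fin d) → ((Fin d → ℝ) → ℂ) → ((Fin d → ℝ) → ℂ)
  | [], f => f
  | j :: l, f => eulerAdjPow β l ((eulerAdj j)^[β j] f)

/-- A realization `h` of the elements of `X` by functions which turns the operators `a j` into the
adjoints of the Euler operators also respects their powers. -/
theorem coe_opPow_smul {M X : Type*} [Monoid M] [MulAction M X] {d : ℕ} {a : Fin d → M}
    {h : X → (Fin d → ℝ) → ℂ} (ha : ∀ j x, h (a j • x) = eulerAdj j (h x)) (β : Fin d → ℕ)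
    (l : List (Fin d)) (x : X) : h (opPow a β l • x) = eulerAdjPow β l (h x) := by
  have hp : ∀ j n x, h (a j ^ n • x) = (eulerAdj j)^[n] (h x) := fun j n => by
    induction n with
    | zero => simp
    | succ n ih => intro x; rw [pow_succ, mul_smul, ih, ha, Function.iterate_succ_apply]
  induction l generalizing x with
  | nil => simp [opPow, eulerAdjPow]
  | cons j l ih => rw [opPow, mul_smul, ih, hp, eulerAdjPow]

/-- The adjoint of `θ^β` on test functions. -/
def eulerAdjPowTest {d : ℕ} (β : Fin d → ℕ) : 𝓓(Q d, ℂ) →L[ℂ] 𝓓(Q d, ℂ) :=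
  opPow eulerAdjTest β (List.finRange d)

theorem coe_eulerAdjPowTest {d : ℕ} (β : Fin d → ℕ) (φ : 𝓓(Q d, ℂ)) :
    ⇑(eulerAdjPowTest β φ) = eulerAdjPow β (List.finRange d) φ :=
  coe_opPow_smul (X := 𝓓(Q d, ℂ)) (a := eulerAdjTest) (h := fun φ => ⇑φ) coe_eulerAdjTest β _ φ

theorem thetaPow_apply {d : ℕ} (β : Fin d → ℕ) (T : DistQ d) (φ : 𝓓(Q d, ℂ)) :
    thetaPow β T φ = T (eulerAdjPowTest β φ) := by
  have hp : ∀ j n (S : DistQ d) φ, (theta j)^[n] S φ = S ((eulerAdjTest j ^ n) φ) := by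
    intro j n
    induction n with
    | zero => intro S φ; rfl
    | succ n ih =>
      intro S φ
      rw [Function.iterate_succ_apply, ih, theta_apply, pow_succ']
      rfl
  unfold thetaPow eulerAdjPowTest
  generalize List.finRange d = l
  induction l generalizing φ with
  | nil => rfl
  | cons j l ih => rw [List.foldr_cons, hp, ih]; rfl

theorem euler_comm {d : ℕ} (i j : Fin d) {f : (Fin d → ℝ) → ℂ} (hf : ContDiff ℝ ∞ f) :
    euler i (euler j f) = euler j (euler i f) := by
  rcases eq_or_ne i j with rfl | hij
  · rfl
  have h : ∀ i j : Fin d, i ≠ j → ∀ x, euler i (euler j f) x =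
      (x i : ℂ) * (x j : ℂ) * fderiv ℝ (fderiv ℝ f) x (Pi.single i 1) (Pi.single j 1) := by
    intro i j hij x
    have h1 : HasFDerivAt (fun x : Fin d → ℝ => (x j : ℂ)) (Complex.ofRealCLM.comp
        (ContinuousLinearMap.proj (R := ℝ) (φ := fun _ : Fin d => ℝ) j)) x :=
      (Complex.ofRealCLM.comp
        (ContinuousLinearMap.proj (R := ℝ) (φ := fun _ : Fin d => ℝ) j)).hasFDerivAt
    have h2 : DifferentiableAt ℝ (fderiv ℝ f) x :=
      ((hf.fderiv_right (m := ∞) le_rfl).differentiable (by simp)).differentiableAt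
    have h3 := h1.mul (h2.hasFDerivAt.clm_apply (hasFDerivAt_const (Pi.single j 1 : Fin d → ℝ) x))
    have h4 : fderiv ℝ (euler j f) x = _ := h3.fderiv
    rw [euler, h4]
    simp [hij.symm]
    ring
  ext x
  have hs := (hf.contDiffAt (x := x)).isSymmSndFDerivAt
    (by
      rw [minSmoothness_of_isRCLikeNormedField]
      exact WithTop.coe_le_coe.2 (le_top (a := (2 : ℕ∞))))
    (Pi.single i 1) (Pi.single j 1)
  rw [h i j hij, h j i hij.symm, hs]
  ring

theorem commute_eulerAdjTest {d : ℕ} (i j : Fin d) :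
    Commute (eulerAdjTest i) (eulerAdjTest (d := d) j) := by
  have h : Commute (thetaTest i) (thetaTest (d := d) j) := by
    refine ContinuousLinearMap.ext fun φ => ?_
    ext x
    change thetaTest i (thetaTest j φ) x = thetaTest j (thetaTest i φ) x
    simp only [coe_thetaTest, euler_comm i j φ.contDiff]
  have h1 : Commute (-thetaTest i) (-thetaTest (d := d) j) := (h.neg_left).neg_right
  exact ((h1.sub_left (Commute.one_left _)).sub_right (Commute.one_right _))

theorem eulerAdjPowTest_eulerAdjTest {d : ℕ} (β : Fin d → ℕ) (j : Fin d) (φ : 𝓓(Q d, ℂ)) :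
    eulerAdjPowTest β (eulerAdjTest j φ) = eulerAdjPowTest (β + Pi.single j 1) φ := by
  have h := opPow_add_single commute_eulerAdjTest β j (List.nodup_finRange d) (List.mem_finRange j)
  exact (congrArg (fun A : 𝓓(Q d, ℂ) →L[ℂ] 𝓓(Q d, ℂ) => A φ) h).symm

/-- The multi-indices of `B` and their successors. -/
def succIndices {d : ℕ} (B : Finset (Fin d → ℕ)) : Finset (Fin d → ℕ) :=
  B ∪ Finset.univ.biUnion fun j => B.image fun β => β + Pi.single j 1

theorem sum_add_single_le {d : ℕ} (B : Finset (Fin d → ℕ)) (s : (Fin d → ℕ) → ℝ)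
    (hs : ∀ γ, 0 ≤ s γ) (j : Fin d) :
    ∑ β ∈ B, s (β + Pi.single j 1) ≤ ∑ γ ∈ succIndices B, s γ := by
  classical
  rw [← Finset.sum_image (f := s) (g := fun β => β + Pi.single j 1)
    fun _ _ _ _ h => add_right_cancel h]
  refine Finset.sum_le_sum_of_subset_of_nonneg (fun γ hγ => ?_) fun γ _ _ => hs γ
  simp only [succIndices, Finset.mem_union, Finset.mem_biUnion, Finset.mem_univ, true_and]
  refine Or.inr ⟨j, ?_⟩
  simpa using hγ

/-- The Euler derivatives of order at most `n` are combinations of the adjoints of the powers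
`θ^β` with `β` in a finite set. -/
theorem exists_eulerSum_le_sum {d : ℕ} (n : ℕ) : ∃ B : Finset (Fin d → ℕ), ∃ C : ℝ, 0 ≤ C ∧
    ∀ (φ : 𝓓(Q d, ℂ)) (x : Fin d → ℝ),
      eulerSum n φ x ≤ C * ∑ β ∈ B, ‖eulerAdjPowTest β φ x‖ := by
  induction n with
  | zero =>
    refine ⟨{0}, 1, zero_le_one, fun φ x => ?_⟩
    simp [eulerSum, eulerAdjPowTest, opPow_zero]
  | succ n ih =>
    obtain ⟨B, C, hC0, hC⟩ := ih
    refine ⟨succIndices B, C + d * (C + C), by positivity, fun φ x => ?_⟩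
    set s : (Fin d → ℕ) → ℝ := fun γ => ‖eulerAdjPowTest γ φ x‖ with hs
    have hs0 : ∀ γ, 0 ≤ s γ := fun γ => norm_nonneg _
    have h1 : ∑ β ∈ B, s β ≤ ∑ γ ∈ succIndices B, s γ :=
      Finset.sum_le_sum_of_subset_of_nonneg Finset.subset_union_left fun γ _ _ => hs0 γ
    have h2 : ∀ j, ∑ β ∈ B, ‖eulerAdjPowTest β (eulerAdjTest j φ) x‖ ≤
        ∑ γ ∈ succIndices B, s γ := fun j => by
      simp only [eulerAdjPowTest_eulerAdjTest]
      exact sum_add_single_le B s hs0 j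
    have h0 : 0 ≤ ∑ γ ∈ succIndices B, s γ := Finset.sum_nonneg fun γ _ => hs0 γ
    have hn : eulerSum n φ x ≤ C * ∑ γ ∈ succIndices B, s γ :=
      (hC φ x).trans (mul_le_mul_of_nonneg_left h1 hC0)
    clear_value s
    generalize ∑ γ ∈ succIndices B, s γ = S at *
    have h3 : ∀ j, eulerSum n (euler j φ) x ≤ (C + C) * S := fun j => by
      by_cases hx : x ∈ Q d
      · refine (eulerSum_euler_le_eulerAdj n j φ.contDiff.contDiffOn hx).trans ?_
        rw [← coe_eulerAdjTest, add_mul]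
        exact add_le_add ((hC _ x).trans (mul_le_mul_of_nonneg_left (h2 j) hC0)) hn
      · rw [eulerSum_eq_zero n fun h => notMem_tsupport_of_notMem_Q φ hx
          (tsupport_euler_subset j φ h)]
        positivity
    calc eulerSum (n + 1) φ x ≤ C * S + ∑ _j : Fin d, (C + C) * S :=
          add_le_add hn (Finset.sum_le_sum fun j _ => h3 j)
      _ = _ := by simp; ring

/-! ### Duality -/

/-- A linear form bounded by the norm of `ι` factors through `ι`, by the Hahn–Banach theorem. -/
theorem exists_factor_of_norm_le {V E : Type*} [AddCommGroup V] [Module ℂ V]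
    [NormedAddCommGroup E] [NormedSpace ℂ E] (ι : V →ₗ[ℂ] E) (T : V →ₗ[ℂ] ℂ) (C : ℝ)
    (h : ∀ v, ‖T v‖ ≤ C * ‖ι v‖) : ∃ F : E →L[ℂ] ℂ, ∀ v, F (ι v) = T v := by
  obtain ⟨s, hs⟩ := ι.rangeRestrict.exists_rightInverse_of_surjective ι.range_rangeRestrict
  have hs' : ∀ p : LinearMap.range ι, ι (s p) = p := fun p =>
    congrArg Subtype.val (LinearMap.congr_fun hs p)
  set f : LinearMap.range ι →L[ℂ] ℂ := (T.comp s).mkContinuous C fun p => by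
    have := h (s p)
    rw [hs'] at this
    exact this
  obtain ⟨F, hF, -⟩ := exists_extension_norm_eq (LinearMap.range ι) f
  refine ⟨F, fun v => ?_⟩
  have h1 : F (ι v) = T (s ⟨ι v, v, rfl⟩) := hF ⟨ι v, v, rfl⟩
  rw [h1, ← sub_eq_zero, ← map_sub, ← norm_le_zero_iff]
  refine (h _).trans ?_
  rw [map_sub, hs']
  simp

/-- A continuous linear form on `L_1` of a finite measure is given by a bounded function. The
function comes from the Riesz representation in `L_2`, and its integral over a set is at most
the norm of the form times the measure of the set. -/
theorem exists_memLp_top_of_dual_L1 {α : Type*} [MeasurableSpace α] (μ : Measure α)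
    [IsFiniteMeasure μ] (F : Lp ℂ 1 μ →L[ℂ] ℂ) :
    ∃ h : α → ℂ, MemLp h ⊤ μ ∧ ∀ (g : α → ℂ) (hg1 : MemLp g 1 μ), MemLp g 2 μ →
      F hg1.toLp = ∫ x, h x * g x ∂μ := by
  have hle : ∀ g : Lp ℂ 2 μ, MemLp g 1 μ := fun g =>
    (Lp.memLp g).mono_exponent (by norm_num)
  set J : Lp ℂ 2 μ →ₗ[ℂ] Lp ℂ 1 μ :=
    { toFun := fun g => (hle g).toLp
      map_add' := fun f g => by
        rw [← MemLp.toLp_add]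
        exact MemLp.toLp_congr _ _ (Lp.coeFn_add f g)
      map_smul' := fun c g => by
        rw [RingHom.id_apply, ← MemLp.toLp_const_smul]
        exact MemLp.toLp_congr _ _ (Lp.coeFn_smul c g) }
  have hJ : ∀ g, ‖J g‖ ≤ (μ univ ^ (1 / 2 : ℝ)).toReal * ‖g‖ := fun g => by
    change ‖(hle g).toLp‖ ≤ _
    rw [Lp.norm_toLp, Lp.norm_def, mul_comm, ← ENNReal.toReal_mul]
    refine ENNReal.toReal_mono (ENNReal.mul_ne_top (Lp.eLpNorm_ne_top g)
      (ENNReal.rpow_ne_top_of_nonneg (by norm_num) (measure_ne_top μ univ))) ?_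
    refine (eLpNorm_le_eLpNorm_mul_rpow_measure_univ (p := 1) (q := 2) (by norm_num)
      (Lp.aestronglyMeasurable g)).trans (le_of_eq ?_)
    norm_num
  set F' : StrongDual ℂ (Lp ℂ 2 μ) := F.comp (J.mkContinuous _ hJ)
  set r : Lp ℂ 2 μ := (InnerProductSpace.toDual ℂ (Lp ℂ 2 μ)).symm F'
  set h : α → ℂ := fun x => starRingEnd ℂ (r x)
  have hr : MemLp h 2 μ := (Lp.memLp r).star
  have key : ∀ (g : α → ℂ) (hg1 : MemLp g 1 μ), MemLp g 2 μ → F hg1.toLp = ∫ x, h x * g x ∂μ := by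
    intro g hg1 hg2
    have h1 : F' hg2.toLp = F hg1.toLp := by
      refine congrArg F ?_
      exact MemLp.toLp_congr (hle _) hg1 hg2.coeFn_toLp
    rw [← h1, ← InnerProductSpace.toDual_symm_apply, L2.inner_def]
    refine integral_congr_ae ?_
    filter_upwards [hg2.coeFn_toLp] with x hx
    rw [hx, RCLike.inner_apply, mul_comm]
  have hint : Integrable h μ := hr.integrable (by norm_num)
  have hset : ∀ s, MeasurableSet s → ‖∫ x in s, h x ∂μ‖ ≤ ‖F‖ * μ.real s := by
    intro s hs
    have hi : ∀ p, MemLp (s.indicator fun _ => (1 : ℂ)) p μ := fun p =>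
      memLp_indicator_const p hs 1 (Or.inr (measure_ne_top μ s))
    have h1 := key _ (hi 1) (hi 2)
    have h2 : ∫ x, h x * s.indicator (fun _ => (1 : ℂ)) x ∂μ = ∫ x in s, h x ∂μ := by
      rw [← integral_indicator hs]
      congr 1
      ext x
      by_cases hx : x ∈ s <;> simp [hx]
    rw [← h2, ← h1]
    refine (F.le_opNorm _).trans (mul_le_mul_of_nonneg_left (le_of_eq ?_) (norm_nonneg _))
    rw [Lp.norm_toLp, eLpNorm_indicator_const hs one_ne_zero ENNReal.one_ne_top]
    simp [Measure.real]
  have hre : ∀ c : ℂ, ‖c‖ = 1 → ∀ᵐ x ∂μ, (c * h x).re ≤ ‖F‖ := by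
    intro c hc
    have hci : Integrable (fun x => (c * h x).re) μ := (hint.const_mul c).re
    refine ae_le_of_forall_setIntegral_le hci (integrable_const ‖F‖) fun s hs _ => ?_
    have e1 : ∫ x in s, (c * h x).re ∂μ = (c * ∫ x in s, h x ∂μ).re := by
      rw [← integral_const_mul]
      exact integral_re (hint.const_mul c).integrableOn
    rw [e1, setIntegral_const, smul_eq_mul]
    refine (Complex.re_le_norm _).trans ?_
    rw [norm_mul, hc, one_mul]
    exact (hset s hs).trans_eq (mul_comm _ _)
  refine ⟨h, memLp_top_of_bound hr.aestronglyMeasurable (‖F‖ + ‖F‖) ?_, key⟩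
  filter_upwards [hre 1 (by simp), hre (-1) (by simp), hre Complex.I (by simp),
    hre (-Complex.I) (by simp)] with x h1 h2 h3 h4
  refine (Complex.norm_le_abs_re_add_abs_im _).trans (add_le_add ?_ ?_)
  · exact abs_le.2 ⟨by simp at h2; linarith, by simpa using h1⟩
  · exact abs_le.2 ⟨by simp at h3; linarith, by simpa using h4⟩

/-! ### Representation by weighted bounded functions -/

theorem weight_nonneg {d : ℕ} (k : ℕ) (x : Fin d → ℝ) : 0 ≤ weight k x :=
  Finset.prod_nonneg fun j _ => by
    have : 0 ≤ x j ^ (2 * k) := (even_two_mul k).pow_nonneg _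
    positivity

theorem measurable_weight {d : ℕ} (k : ℕ) : Measurable (weight (d := d) k) := by
  unfold weight
  fun_prop

theorem measurable_ofReal_inv_weight {d : ℕ} (k : ℕ) :
    Measurable fun x : Fin d → ℝ => ENNReal.ofReal (weight k x)⁻¹ :=
  (measurable_weight k).inv.ennreal_ofReal

theorem ae_mem_Q {d : ℕ} : ∀ᵐ x ∂(volume.restrict (Q d : Set (Fin d → ℝ))), x ∈ Q d :=
  ae_restrict_mem (Q d).isOpen.measurableSet

theorem exists_norm_le_inv_weight {d : ℕ} {k : ℕ} {t : (Fin d → ℝ) → ℂ}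
    (ht : MemLp (fun x => (weight k x : ℂ) * t x) ⊤ (volume.restrict (Q d))) :
    ∃ C : ℝ, 0 ≤ C ∧ ∀ᵐ x ∂(volume.restrict (Q d : Set (Fin d → ℝ))), ‖t x‖ ≤ C * (weight k x)⁻¹ := by
  refine ⟨(eLpNormEssSup (fun x => (weight k x : ℂ) * t x) (volume.restrict (Q d))).toReal,
    ENNReal.toReal_nonneg, ?_⟩
  have h := ht.2.ne
  rw [eLpNorm_exponent_top] at h
  filter_upwards [ae_mem_Q, ae_le_eLpNormEssSup (f := fun x => (weight k x : ℂ) * t x)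
    (μ := volume.restrict (Q d : Set (Fin d → ℝ)))] with x hx h1
  have hw := weight_pos k hx
  have h2 := ENNReal.toReal_mono h h1
  rw [toReal_enorm, norm_mul, Complex.norm_real, Real.norm_of_nonneg hw.le, mul_comm] at h2
  exact (le_mul_inv_iff₀ hw).2 h2

theorem aestronglyMeasurable_of_weight_mul {d : ℕ} {k : ℕ} {t : (Fin d → ℝ) → ℂ}
    (ht : MemLp (fun x => (weight k x : ℂ) * t x) ⊤ (volume.restrict (Q d))) :
    AEStronglyMeasurable t (volume.restrict (Q d)) := by
  have h1 : AEStronglyMeasurable (fun x => ((weight k x : ℝ) : ℂ)⁻¹)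
      (volume.restrict (Q d : Set (Fin d → ℝ))) :=
    ((Complex.measurable_ofReal.comp (measurable_weight k)).inv).aestronglyMeasurable
  refine (h1.mul ht.1).congr ?_
  filter_upwards [ae_mem_Q] with x hx
  have : (weight k x : ℂ) ≠ 0 := by exact_mod_cast (weight_pos k hx).ne'
  simp [inv_mul_cancel_left₀ this]

/-- The shift of the index is due to `w_0⁻¹`, which is constant and not integrable. -/
theorem integrableOn_of_weight_mul {d : ℕ} {k : ℕ} {t : (Fin d → ℝ) → ℂ}
    (ht : MemLp (fun x => (weight (k + 1) x : ℂ) * t x) ⊤ (volume.restrict (Q d))) :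
    IntegrableOn t (Q d) := by
  obtain ⟨C, hC, h⟩ := exists_norm_le_inv_weight ht
  exact Integrable.mono' ((integrableOn_inv_weight d k).const_mul C)
    (aestronglyMeasurable_of_weight_mul ht) h

theorem ofFun_apply {d : ℕ} {t : (Fin d → ℝ) → ℂ} (ht : IntegrableOn t (Q d)) (φ : 𝓓(Q d, ℂ)) :
    ofFun t φ = ∫ x in Q d, t x * φ x := by
  rw [ofFun, TestFunction.integralAgainstBilinCLM_eq_integral ht.locallyIntegrableOn,
    setIntegral_eq_integral_of_forall_compl_eq_zero]
  · simp [mul_comm]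
  · intro x hx
    rw [image_eq_zero_of_notMem_tsupport (notMem_tsupport_of_notMem_Q φ hx), mul_zero]

theorem weight_le_add {d : ℕ} (k m : ℕ) {x : Fin d → ℝ} (hx : x ∈ Q d) :
    weight k x ≤ 2 ^ d * weight (k + m) x :=
  (le_mul_of_one_le_right (weight_pos k hx).le (one_le_weight m hx)).trans (weight_mul_le k m hx)

/-- If `|a| w_k ≤ c w_l` on `Q`, then `w_k a t` is bounded whenever `w_l t` is. -/
theorem memLp_weight_mul_mul {d : ℕ} {k l : ℕ} {t a : (Fin d → ℝ) → ℂ} (c : ℝ)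
    (ha : Measurable a) (hac : ∀ x ∈ Q d, weight k x * ‖a x‖ ≤ c * weight l x)
    (ht : MemLp (fun x => (weight l x : ℂ) * t x) ⊤ (volume.restrict (Q d))) :
    MemLp (fun x => (weight k x : ℂ) * (a x * t x)) ⊤ (volume.restrict (Q d)) := by
  obtain ⟨C, hC, h⟩ := exists_norm_le_inv_weight ht
  refine memLp_top_of_bound (C := c * C) ?_ ?_
  · exact ((Complex.measurable_ofReal.comp (measurable_weight k)).aestronglyMeasurable).mul
      (ha.aestronglyMeasurable.mul (aestronglyMeasurable_of_weight_mul ht))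
  · filter_upwards [h, ae_mem_Q] with x hx hxQ
    have hw := weight_pos l hxQ
    rw [norm_mul, norm_mul, Complex.norm_real, Real.norm_of_nonneg (weight_nonneg k x), ← mul_assoc]
    calc weight k x * ‖a x‖ * ‖t x‖ ≤ (c * weight l x) * (C * (weight l x)⁻¹) :=
          mul_le_mul (hac x hxQ) hx (norm_nonneg _)
            ((mul_nonneg (weight_nonneg k x) (norm_nonneg _)).trans (hac x hxQ))
      _ = c * C := by field_simp

theorem memLp_weight_mul_of_le {d : ℕ} {k l : ℕ} (hkl : k ≤ l) {t : (Fin d → ℝ) → ℂ}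
    (ht : MemLp (fun x => (weight l x : ℂ) * t x) ⊤ (volume.restrict (Q d))) :
    MemLp (fun x => (weight k x : ℂ) * t x) ⊤ (volume.restrict (Q d)) := by
  obtain ⟨m, rfl⟩ := Nat.exists_eq_add_of_le hkl
  have h := memLp_weight_mul_mul (k := k) (a := fun _ => 1) (2 ^ d) measurable_const
    (fun x hx => by simpa using weight_le_add k m hx) ht
  simpa using h

/-- The finite measure `w_{k+1}⁻¹ dx` on `Q`. -/
def weightMeasure (d k : ℕ) : Measure (Fin d → ℝ) :=
  (volume.restrict (Q d)).withDensity fun x => ENNReal.ofReal (weight (k + 1) x)⁻¹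

instance instIsFiniteMeasureWeightMeasure (d k : ℕ) : IsFiniteMeasure (weightMeasure d k) :=
  isFiniteMeasure_withDensity_ofReal (integrableOn_inv_weight d k).2

theorem integral_weightMeasure {d k : ℕ} {E : Type*} [NormedAddCommGroup E] [NormedSpace ℝ E]
    (g : (Fin d → ℝ) → E) :
    ∫ x, g x ∂(weightMeasure d k) = ∫ x in Q d, (weight (k + 1) x)⁻¹ • g x := by
  rw [weightMeasure, integral_withDensity_eq_integral_toReal_smul
    (measurable_ofReal_inv_weight (k + 1)) (.of_forall fun _ => ENNReal.ofReal_lt_top)]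
  refine integral_congr_ae (.of_forall fun x => ?_)
  simp only [ENNReal.toReal_ofReal (inv_nonneg.2 (weight_nonneg (k + 1) x))]

theorem restrict_absolutelyContinuous_weightMeasure (d k : ℕ) :
    volume.restrict (Q d : Set (Fin d → ℝ)) ≪ weightMeasure d k :=
  withDensity_absolutelyContinuous' (measurable_ofReal_inv_weight (k + 1)).aemeasurable <| by
    filter_upwards [ae_mem_Q] with x hx
    simpa using weight_pos (k + 1) hx

theorem memLp_weightMeasure {d : ℕ} (k : ℕ) (p : ENNReal) (φ : 𝓓(Q d, ℂ)) :
    MemLp φ p (weightMeasure d k) :=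
  φ.continuous.memLp_of_hasCompactSupport φ.hasCompactSupport

/-- The adjoint Euler derivatives of a test function with indices in `B`, as elements of
`L_1(w_{k+1}⁻¹ dx)`. -/
def eulerAdjPowL1 {d : ℕ} (k : ℕ) (B : Finset (Fin d → ℕ)) :
    𝓓(Q d, ℂ) →ₗ[ℂ] (B → Lp ℂ 1 (weightMeasure d k)) where
  toFun φ β := (memLp_weightMeasure k 1 (eulerAdjPowTest β.1 φ)).toLp
  map_add' φ ψ := by
    ext1 β
    rw [Pi.add_apply, ← MemLp.toLp_add]
    exact MemLp.toLp_congr _ _ (.of_forall fun x => by rw [map_add]; rfl)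
  map_smul' c φ := by
    ext1 β
    rw [Pi.smul_apply, RingHom.id_apply, ← MemLp.toLp_const_smul]
    exact MemLp.toLp_congr _ _ (.of_forall fun x => by rw [map_smul]; rfl)

theorem norm_eulerAdjPowL1_apply {d : ℕ} (k : ℕ) (B : Finset (Fin d → ℕ)) (φ : 𝓓(Q d, ℂ)) (β : B) :
    ‖eulerAdjPowL1 k B φ β‖ = ∫ x in Q d, (weight (k + 1) x)⁻¹ * ‖eulerAdjPowTest β.1 φ x‖ := by
  have h := L1.norm_of_fun_eq_integral_norm (f := eulerAdjPowTest β.1 φ)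
    ((memLp_weightMeasure k 1 (eulerAdjPowTest β.1 φ)).integrable le_rfl)
  rw [integral_weightMeasure] at h
  exact h

/-- A distribution bounded by a weighted `L_1` norm of Euler derivatives is a sum of Euler
derivatives of weighted bounded functions: by the Hahn–Banach theorem it factors through a finite
power of `L_1(w_{k+1}⁻¹ dx)`. -/
theorem exists_representation {d : ℕ} (T : DistQ d) (k n : ℕ) {C : ℝ} (hC0 : 0 ≤ C)
    (hC : ∀ φ : 𝓓(Q d, ℂ), ‖T φ‖ ≤ C * ∫ x, eulerSum n φ x * (weight (k + 1) x)⁻¹) :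
    ∃ (B : Finset (Fin d → ℕ)) (t : (Fin d → ℕ) → (Fin d → ℝ) → ℂ),
      (∀ β ∈ B, MemLp (fun x => (weight (k + 1) x : ℂ) * t β x) ⊤ (volume.restrict (Q d))) ∧
      T = ∑ β ∈ B, thetaPow β (ofFun (t β)) := by
  classical
  obtain ⟨B, C', hC'0, hC'⟩ := exists_eulerSum_le_sum (d := d) n
  have hi : ∀ (β : Fin d → ℕ) (φ : 𝓓(Q d, ℂ)),
      IntegrableOn (fun x => (weight (k + 1) x)⁻¹ * ‖eulerAdjPowTest β φ x‖) (Q d) := by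
    intro β φ
    set ψ := eulerAdjPowTest β φ
    refine Integrable.integrableOn ?_
    rw [← integrableOn_iff_integrable_of_support_subset (s := tsupport ψ)]
    · exact ((((continuousOn_weight _).inv₀ fun x hx => (weight_pos _ hx).ne').mono
        ψ.tsupport_subset).mul ψ.continuous.norm.continuousOn).integrableOn_compact
        ψ.hasCompactSupport
    · intro x hx
      by_contra h
      exact hx (by simp [image_eq_zero_of_notMem_tsupport h])
  have hbound : ∀ φ, ‖T φ‖ ≤ (C * (C' * B.card)) * ‖eulerAdjPowL1 k B φ‖ := by
    intro φ
    refine (hC φ).trans ?_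
    rw [mul_assoc]
    refine mul_le_mul_of_nonneg_left ?_ hC0
    rw [← setIntegral_eq_integral_of_forall_compl_eq_zero (s := Q d) fun x hx => by
      rw [eulerSum_eq_zero _ (notMem_tsupport_of_notMem_Q φ hx), zero_mul]]
    calc ∫ x in Q d, eulerSum n φ x * (weight (k + 1) x)⁻¹
        ≤ ∫ x in Q d, C' * ∑ β ∈ B, (weight (k + 1) x)⁻¹ * ‖eulerAdjPowTest β φ x‖ := by
          refine integral_mono_of_nonneg (.of_forall fun x => mul_nonneg (eulerSum_nonneg _ _ _)
            (inv_nonneg.2 (weight_nonneg _ _)))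
            ((integrable_finsetSum _ fun β _ => hi β φ).const_mul C') (.of_forall fun x => ?_)
          have := mul_le_mul_of_nonneg_right (hC' φ x) (inv_nonneg.2 (weight_nonneg (k + 1) x))
          refine this.trans_eq ?_
          simp only [← Finset.mul_sum]
          ring
      _ = C' * ∑ β : B, ‖eulerAdjPowL1 k B φ β‖ := by
          rw [integral_const_mul, integral_finsetSum _ fun β _ => hi β φ,
            ← Finset.sum_coe_sort B]
          simp only [norm_eulerAdjPowL1_apply]
      _ ≤ C' * ∑ _β : B, ‖eulerAdjPowL1 k B φ‖ :=
          mul_le_mul_of_nonneg_left (Finset.sum_le_sum fun β _ => norm_le_pi_norm _ β) hC'0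
      _ = _ := by simp [mul_assoc]
  obtain ⟨F, hF⟩ := exists_factor_of_norm_le (eulerAdjPowL1 k B) T.toLinearMap _ hbound
  choose h hh hF' using fun β : B => exists_memLp_top_of_dual_L1 (weightMeasure d k)
    (F.comp (ContinuousLinearMap.single ℂ (fun _ : B => Lp ℂ 1 (weightMeasure d k)) β))
  set t : (Fin d → ℕ) → (Fin d → ℝ) → ℂ := fun β x =>
    if hβ : β ∈ B then ((weight (k + 1) x : ℝ) : ℂ)⁻¹ * h ⟨β, hβ⟩ x else 0 with ht
  have htB : ∀ β : B, ∀ x, t β.1 x = ((weight (k + 1) x : ℝ) : ℂ)⁻¹ * h β x := fun β x => by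
    simp [ht]
  have hmem : ∀ β ∈ B,
      MemLp (fun x => (weight (k + 1) x : ℂ) * t β x) ⊤ (volume.restrict (Q d)) := by
    intro β hβ
    have h1 : MemLp (h ⟨β, hβ⟩) ⊤ (volume.restrict (Q d : Set (Fin d → ℝ))) := by
      refine ⟨(hh ⟨β, hβ⟩).1.mono_ac (restrict_absolutelyContinuous_weightMeasure d k), ?_⟩
      have h2 := (hh ⟨β, hβ⟩).2
      rw [eLpNorm_exponent_top] at h2 ⊢
      exact (eLpNormEssSup_mono_measure _
        (restrict_absolutelyContinuous_weightMeasure d k)).trans_lt h2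
    refine h1.ae_eq ?_
    filter_upwards [ae_mem_Q] with x hx
    have : (weight (k + 1) x : ℂ) ≠ 0 := by exact_mod_cast (weight_pos (k + 1) hx).ne'
    rw [htB ⟨β, hβ⟩, mul_inv_cancel_left₀ this]
  refine ⟨B, t, hmem, ContinuousLinearMap.ext fun φ => ?_⟩
  have h1 : T φ = ∑ β : B, F (Pi.single β (eulerAdjPowL1 k B φ β)) := by
    rw [← map_sum, Finset.univ_sum_single]
    exact (hF φ).symm
  rw [h1, sum_apply, ← Finset.sum_coe_sort B]
  refine Finset.sum_congr rfl fun β _ => ?_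
  rw [thetaPow_apply, ofFun_apply (integrableOn_of_weight_mul (hmem β.1 β.2))]
  refine (hF' β _ (memLp_weightMeasure k 1 (eulerAdjPowTest β.1 φ))
    (memLp_weightMeasure k 2 _)).trans ?_
  rw [integral_weightMeasure]
  refine integral_congr_ae (.of_forall fun x => ?_)
  simp only [htB, Complex.real_smul, Complex.ofReal_inv, mul_assoc]

theorem prod_le_weight_one {d : ℕ} {x : Fin d → ℝ} (hx : x ∈ Q d) : ∏ j, x j ≤ weight 1 x := by
  simpa using prod_zpow_le_weight (k := 1) (n := fun _ => 1) (by simp) hx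

theorem inv_prod_le_weight_one {d : ℕ} {x : Fin d → ℝ} (hx : x ∈ Q d) :
    (∏ j, x j)⁻¹ ≤ weight 1 x := by
  have := prod_le_weight_one (x := x⁻¹) fun j => inv_pos.2 (hx j)
  simpa [weight_inv] using this

/-- Rapid decay of the functions `y ↦ T_x φ(x y)` gives a representation with functions of
prescribed decay. -/
theorem exists_representation_of_dilTest_decay {d : ℕ} (T : DistQ d)
    (hT : ∀ (φ : 𝓓(Q d, ℂ)) (k : ℕ), ∃ C : ℝ, ∀ y : Q d, ‖T (dilTest y φ)‖ * weight k y.1 ≤ C)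
    (k : ℕ) : ∃ (B : Finset (Fin d → ℕ)) (t : (Fin d → ℕ) → (Fin d → ℝ) → ℂ),
      (∀ β ∈ B, MemLp (fun x => (weight k x : ℂ) * t β x) ⊤ (volume.restrict (Q d))) ∧
      T = ∑ β ∈ B, thetaPow β (ofFun (t β)) := by
  obtain ⟨C₁, hC₁, hcmp⟩ := exists_weight_compare (d := d) (k + 1) (isCompact_cube d)
    (cube_subset_Q d)
  -- decay of order `k + 3`: one order for `∏ c_j ≤ w_1(c)`, one for the summation over the dyadic
  -- pieces, and one for the integrability of `w_{k+1}⁻¹`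
  obtain ⟨C, hC0, n, hC⟩ := exists_integral_bound T (fun y => (weight (k + 3) y.1)⁻¹)
    (fun y => inv_pos.2 (weight_pos _ y.2))
    (fun φ => (hT φ (k + 3)).imp fun C hC y => (le_mul_inv_iff₀ (weight_pos _ y.2)).2 (hC y))
    (fun x => (weight (k + 1) x)⁻¹) (fun x hx => (inv_pos.2 (weight_pos _ hx)).le)
    ((continuousOn_weight _).inv₀ fun x hx => (weight_pos _ hx).ne') <| by
      refine ⟨2 ^ d * 2 ^ d * C₁, by positivity, fun c x hx hxc => ?_⟩
      have h1 := weight_pos 1 c.2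
      have h2 := weight_pos 2 c.2
      have h3 := weight_pos (k + 1) hx
      have h4 := weight_pos (k + 3) c.2
      have h5 := weight_pos (k + 1) c.2
      rw [mul_inv_le_iff₀ h4]
      calc (∏ j, c.1 j) * weight 1 c.1 ≤ weight 1 c.1 * weight 1 c.1 :=
            mul_le_mul_of_nonneg_right (prod_le_weight_one c.2) h1.le
        _ ≤ 2 ^ d * weight 2 c.1 := weight_mul_le 1 1 c.2
        _ = 2 ^ d * (weight 2 c.1 * weight (k + 1) x) * (weight (k + 1) x)⁻¹ := by field_simp
        _ ≤ 2 ^ d * (weight 2 c.1 * (C₁ * weight (k + 1) c.1)) * (weight (k + 1) x)⁻¹ := by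
            gcongr
            exact hcmp x hx c.1 c.2 hxc
        _ = 2 ^ d * C₁ * (weight 2 c.1 * weight (k + 1) c.1) * (weight (k + 1) x)⁻¹ := by ring
        _ ≤ 2 ^ d * C₁ * (2 ^ d * weight (k + 3) c.1) * (weight (k + 1) x)⁻¹ := by
            have := weight_mul_le 2 (k + 1) c.2
            rw [show 2 + (k + 1) = k + 3 by omega] at this
            exact mul_le_mul_of_nonneg_right (mul_le_mul_of_nonneg_left this (by positivity))
              (inv_pos.2 h3).le
        _ = _ := by ring
  obtain ⟨B, t, ht, hTt⟩ := exists_representation T k n hC0 hC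
  exact ⟨B, t, fun β hβ => memLp_weight_mul_of_le k.le_succ (ht β hβ), hTt⟩

/-! ### Dilations and multiplicative convolutions -/

/-- The map `φ ↦ (x_1 ⋯ x_d)⁻¹ φ(1 / x)` turns dilations into multiplicative convolutions. -/
theorem convTest_convTest_one {d : ℕ} (y : Q d) (φ : 𝓓(Q d, ℂ)) :
    convTest y (convTest ⟨1, one_mem_Q⟩ φ) = (((∏ j, y.1 j)⁻¹ : ℝ) : ℂ) • dilTest (invQ y) φ := by
  ext x
  change _ = (((∏ j, y.1 j)⁻¹ : ℝ) : ℂ) * φ (x * (invQ y).1)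
  rw [convTest_apply, convTest_apply]
  have hy : ∀ j, y.1 j ≠ 0 := fun j => (y.2 j).ne'
  have e : (1 : Fin d → ℝ) / (y.1 / x) = x * (invQ y).1 := by
    ext j
    simp [invQ, div_eq_mul_inv]
  rw [e]
  by_cases hx : x ∈ Q d
  · have hx0 : ∏ j, x j ≠ 0 := Finset.prod_ne_zero_iff.2 fun j _ => (hx j).ne'
    have hy0 : ∏ j, y.1 j ≠ 0 := Finset.prod_ne_zero_iff.2 fun j _ => hy j
    rw [← mul_assoc, ← Complex.ofReal_mul]
    congr 2
    simp only [Pi.div_apply, Finset.prod_div_distrib]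
    field_simp
  · have : x * (invQ y).1 ∉ Q d := fun h => hx fun j => by
      have := h j
      rw [Pi.mul_apply] at this
      exact pos_of_mul_pos_left this ((invQ y).2 j).le
    rw [image_eq_zero_of_notMem_tsupport (notMem_tsupport_of_notMem_Q φ this)]
    simp

theorem dilTest_invQ_one {d : ℕ} (φ : 𝓓(Q d, ℂ)) : dilTest (invQ ⟨1, one_mem_Q⟩) φ = φ := by
  ext x
  change φ (x * (invQ ⟨1, one_mem_Q⟩).1) = φ x
  congr 1
  ext j
  simp [invQ]

theorem convTest_one_convTest_one {d : ℕ} (φ : 𝓓(Q d, ℂ)) :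
    convTest ⟨1, one_mem_Q⟩ (convTest ⟨1, one_mem_Q⟩ φ) = φ := by
  rw [convTest_convTest_one, dilTest_invQ_one]
  simp

theorem invQ_invQ {d : ℕ} (y : Q d) : invQ (invQ y) = y := by
  ext j
  simp [invQ]

theorem dilTest_eq_smul_convTest {d : ℕ} (y : Q d) (φ : 𝓓(Q d, ℂ)) :
    dilTest y φ = (((∏ j, y.1 j)⁻¹ : ℝ) : ℂ) • convTest (invQ y) (convTest ⟨1, one_mem_Q⟩ φ) := by
  have hy0 : ∏ j, y.1 j ≠ 0 := Finset.prod_ne_zero_iff.2 fun j _ => (y.2 j).ne'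
  rw [convTest_convTest_one, invQ_invQ, smul_smul, ← Complex.ofReal_mul]
  have : (∏ j, y.1 j)⁻¹ * (∏ j, (invQ y).1 j)⁻¹ = 1 := by
    simp only [invQ, Pi.inv_apply, Finset.prod_inv_distrib, inv_inv]
    exact inv_mul_cancel₀ hy0
  rw [this, Complex.ofReal_one, one_smul]

/-- If the multiplicative convolutions of all `w_K T` with test functions are bounded, then `T` has a
representation with functions of prescribed decay: `S = w_K T` is bounded by an `L_1` norm with the
weight `w_3`, and `T = w_K⁻¹ S`. -/
theorem exists_representation_of_mulConv_bounded {d : ℕ} (T : DistQ d)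
    (hT : ∀ (k : ℕ) (φ : 𝓓(Q d, ℂ)), ∃ C : ℝ, ∀ y : Q d, ‖mulConv (weightMul k T) φ y‖ ≤ C)
    (k : ℕ) : ∃ (B : Finset (Fin d → ℕ)) (t : (Fin d → ℕ) → (Fin d → ℝ) → ℂ),
      (∀ β ∈ B, MemLp (fun x => (weight k x : ℂ) * t β x) ⊤ (volume.restrict (Q d))) ∧
      T = ∑ β ∈ B, thetaPow β (ofFun (t β)) := by
  -- `w_3 / w_{k+4}` is comparable with the integrable weight `w_{k+1}⁻¹`
  set S := weightMul (k + 4) T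
  have hS : ∀ φ : 𝓓(Q d, ℂ), ∃ C : ℝ, ∀ y : Q d, ‖S (dilTest y φ)‖ ≤ C * weight 1 y.1 := by
    intro φ
    obtain ⟨C, hC⟩ := hT (k + 4) (convTest ⟨1, one_mem_Q⟩ φ)
    refine ⟨C, fun y => ?_⟩
    have hp : 0 ≤ (∏ j, y.1 j)⁻¹ := inv_nonneg.2 (Finset.prod_nonneg fun j _ => (y.2 j).le)
    rw [dilTest_eq_smul_convTest, map_smul, norm_smul, Complex.norm_real, Real.norm_of_nonneg hp,
      mul_comm]
    exact mul_le_mul (hC (invQ y)) (inv_prod_le_weight_one y.2) hp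
      ((norm_nonneg _).trans (hC (invQ y)))
  obtain ⟨C₁, hC₁, hcmp⟩ := exists_weight_compare (d := d) 3 (isCompact_cube d) (cube_subset_Q d)
  obtain ⟨C, hC0, n, hC⟩ := exists_integral_bound S (fun y => weight 1 y.1)
    (fun y => weight_pos _ y.2) hS (weight 3) (fun x hx => (weight_pos _ hx).le)
    (continuousOn_weight _) <| by
      refine ⟨2 ^ d * 2 ^ d * C₁, by positivity, fun c x hx hxc => ?_⟩
      have h1 := weight_pos 1 c.2
      calc (∏ j, c.1 j) * weight 1 c.1 * weight 1 c.1
          ≤ weight 1 c.1 * weight 1 c.1 * weight 1 c.1 := by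
            gcongr
            exact prod_le_weight_one c.2
        _ ≤ 2 ^ d * weight 2 c.1 * weight 1 c.1 :=
            mul_le_mul_of_nonneg_right (weight_mul_le 1 1 c.2) h1.le
        _ = 2 ^ d * (weight 2 c.1 * weight 1 c.1) := mul_assoc _ _ _
        _ ≤ 2 ^ d * (2 ^ d * (C₁ * weight 3 x)) := by
            refine mul_le_mul_of_nonneg_left ((weight_mul_le 2 1 c.2).trans ?_) (by positivity)
            gcongr
            exact hcmp c.1 c.2 x hx (by rwa [mul_comm])
        _ = _ := by ring
  obtain ⟨C₂, hC₂, hinv⟩ := exists_eulerSum_inv_weight_le (d := d) (k + 4) n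
  have hTS : ∀ φ, T φ = S (mulCLM _ (contDiffOn_inv_weight (k + 4)) φ) := by
    intro φ
    change T φ = T (mulCLM _ (contDiffOn_weight (k + 4))
      (mulCLM _ (contDiffOn_inv_weight (k + 4)) φ))
    congr 1
    ext x
    rw [mulCLM_apply, mulCLM_apply]
    by_cases hx : x ∈ Q d
    · have : (weight (k + 4) x : ℂ) ≠ 0 := by exact_mod_cast (weight_pos (k + 4) hx).ne'
      rw [inv_mul_cancel_right₀ this]
    · rw [image_eq_zero_of_notMem_tsupport (notMem_tsupport_of_notMem_Q φ hx)]
      simp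
  have hTb : ∀ φ : 𝓓(Q d, ℂ), ‖T φ‖ ≤ (C * (2 ^ n * C₂ * 2 ^ d)) *
      ∫ x, eulerSum n φ x * (weight (k + 1) x)⁻¹ := by
    intro φ
    rw [hTS, mul_assoc, ← integral_const_mul]
    refine (hC _).trans (mul_le_mul_of_nonneg_left ?_ hC0)
    refine integral_mono_of_nonneg (.of_forall fun x => mul_nonneg (eulerSum_nonneg _ _ _)
      (weight_nonneg _ _)) (Integrable.const_mul ?_ _) (.of_forall fun x => ?_)
    · rw [← integrableOn_iff_integrable_of_support_subset (s := tsupport φ)]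
      · exact ((continuous_eulerSum _ φ.contDiff).continuousOn.mul
          (((continuousOn_weight _).inv₀ fun x hx => (weight_pos _ hx).ne').mono
            φ.tsupport_subset)).integrableOn_compact φ.hasCompactSupport
      · intro x hx
        by_contra h
        exact hx (by simp [eulerSum_eq_zero _ h])
    · by_cases hx : x ∈ Q d
      · have h1 := weight_pos (k + 1) hx
        have h3 := weight_pos 3 hx
        have h4 := weight_pos (k + 4) hx
        have hG := eulerSum_nonneg n φ x
        have h5 : weight 3 x * (weight (k + 4) x)⁻¹ ≤ 2 ^ d * (weight (k + 1) x)⁻¹ := by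
          rw [← div_eq_mul_inv, ← div_eq_mul_inv, div_le_div_iff₀ h4 h1]
          have := weight_mul_le 3 (k + 1) hx
          rwa [show 3 + (k + 1) = k + 4 by omega] at this
        calc eulerSum n (fun x => φ x * ((weight (k + 4) x : ℝ) : ℂ)⁻¹) x * weight 3 x
            ≤ 2 ^ n * (eulerSum n φ x * (C₂ * (weight (k + 4) x)⁻¹)) * weight 3 x := by
              gcongr
              refine (eulerSum_mul_le n φ.contDiff.contDiffOn (contDiffOn_inv_weight (k + 4))
                hx).trans ?_
              gcongr
              exact hinv x hx
          _ = 2 ^ n * C₂ * eulerSum n φ x * (weight 3 x * (weight (k + 4) x)⁻¹) := by ring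
          _ ≤ 2 ^ n * C₂ * eulerSum n φ x * (2 ^ d * (weight (k + 1) x)⁻¹) := by gcongr
          _ = _ := by ring
      · have h1 := eulerSum_eq_zero n
          (notMem_tsupport_of_notMem_Q (mulCLM _ (contDiffOn_inv_weight (k + 4)) φ) hx)
        beta_reduce
        rw [h1, zero_mul]
        exact mul_nonneg (by positivity) (mul_nonneg (eulerSum_nonneg _ _ _)
          (inv_nonneg.2 (weight_nonneg _ _)))
  obtain ⟨B, t, ht, hTt⟩ := exists_representation T k n (by positivity) hTb
  exact ⟨B, t, fun β hβ => memLp_weight_mul_of_le k.le_succ (ht β hβ), hTt⟩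

/-- The monomial of `w_k` with exponents `2 k` for `j ∈ s` and `-2 k` for `j ∉ s`. -/
def weightTerm {d : ℕ} (k : ℕ) (s : Finset (Fin d)) (x : Fin d → ℝ) : ℝ :=
  (∏ j ∈ s, x j ^ (2 * k)) * ∏ j ∈ Finset.univ \ s, (x j ^ (2 * k))⁻¹

theorem weight_eq_sum {d : ℕ} (k : ℕ) (x : Fin d → ℝ) :
    weight k x = ∑ s : Finset (Fin d), weightTerm k s x := by
  rw [weight, Finset.prod_add, Finset.powerset_univ]
  rfl

theorem weightTerm_pos {d : ℕ} (k : ℕ) (s : Finset (Fin d)) {x : Fin d → ℝ} (hx : x ∈ Q d) :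
    0 < weightTerm k s x :=
  mul_pos (Finset.prod_pos fun j _ => pow_pos (hx j) _)
    (Finset.prod_pos fun j _ => inv_pos.2 (pow_pos (hx j) _))

theorem weightTerm_le_weight {d : ℕ} (k : ℕ) (s : Finset (Fin d)) {x : Fin d → ℝ} (hx : x ∈ Q d) :
    weightTerm k s x ≤ weight k x := by
  rw [weight_eq_sum]
  exact Finset.single_le_sum (f := fun s => weightTerm k s x)
    (fun s _ => (weightTerm_pos k s hx).le) (Finset.mem_univ s)

theorem weightTerm_mul {d : ℕ} (k : ℕ) (s : Finset (Fin d)) (x y : Fin d → ℝ) :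
    weightTerm k s (x * y) = weightTerm k s x * weightTerm k s y := by
  simp only [weightTerm, Pi.mul_apply, mul_pow, mul_inv, Finset.prod_mul_distrib]
  ring

theorem contDiffOn_weightTerm {d : ℕ} (k : ℕ) (s : Finset (Fin d)) :
    ContDiffOn ℝ ∞ (fun x : Fin d → ℝ => ((weightTerm k s x : ℝ) : ℂ)) (Q d) := by
  have h : ∀ j, ContDiffOn ℝ ∞ (fun x : Fin d → ℝ => (x j) ^ (2 * k)) (Q d) := fun j =>
    ((contDiff_apply ℝ ℝ j).pow _).contDiffOn
  exact Complex.ofRealCLM.contDiff.comp_contDiffOn ((contDiffOn_prod fun j _ => h j).mul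
    (contDiffOn_prod fun j _ => (h j).inv fun x hx => pow_ne_zero _ (mem_Q.1 hx j).ne'))

theorem continuous_invQ {d : ℕ} : Continuous (invQ (d := d)) := by
  refine Continuous.subtype_mk (continuous_pi fun j => ?_) _
  exact ((continuous_apply j).comp continuous_subtype_val).inv₀ fun y => (y.2 j).ne'

/-- The multiplicative convolutions of `w_k T` in terms of the functions `y ↦ T_x φ(x y)`: with
`w_k` written as a sum of monomials `x^η`, use `x^η = y^η (x / y)^η`. -/
theorem mulConv_weightMul {d : ℕ} (T : DistQ d) (k : ℕ) (φ : 𝓓(Q d, ℂ)) (y : Q d) :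
    mulConv (weightMul k T) φ y = ∑ s : Finset (Fin d),
      (((∏ j, y.1 j)⁻¹ * weightTerm k s y.1 : ℝ) : ℂ) *
        T (dilTest (invQ y) (mulTest _ (contDiffOn_weightTerm k s)
          (convTest ⟨1, one_mem_Q⟩ φ))) := by
  set χ := convTest ⟨1, one_mem_Q⟩ φ
  have h : mulCLM _ (contDiffOn_weight k) (convTest y φ) = ∑ s : Finset (Fin d),
      (((∏ j, y.1 j)⁻¹ * weightTerm k s y.1 : ℝ) : ℂ) •
        dilTest (invQ y) (mulTest _ (contDiffOn_weightTerm k s) χ) := by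
    rw [← convTest_one_convTest_one φ, convTest_convTest_one, map_smul]
    ext x
    have e1 : ∀ f : Finset (Fin d) → 𝓓(Q d, ℂ), (∑ s, f s) x = ∑ s, f s x := fun f => by
      induction (Finset.univ : Finset (Finset (Fin d))) using Finset.induction_on with
      | empty => rfl
      | insert a u ha ih =>
        rw [Finset.sum_insert ha, Finset.sum_insert ha, ← ih]
        rfl
    rw [e1]
    change (((∏ j, y.1 j)⁻¹ : ℝ) : ℂ) * (χ (x * (invQ y).1) * ((weight k x : ℝ) : ℂ)) =
      ∑ s, (((∏ j, y.1 j)⁻¹ * weightTerm k s y.1 : ℝ) : ℂ) *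
        (χ (x * (invQ y).1) * ((weightTerm k s (x * (invQ y).1) : ℝ) : ℂ))
    have e2 : ∀ s, weightTerm k s x = weightTerm k s (x * (invQ y).1) * weightTerm k s y.1 :=
      fun s => by rw [← weightTerm_mul, invQ_mul_cancel]
    rw [weight_eq_sum]
    simp only [e2]
    push_cast
    rw [Finset.mul_sum, Finset.mul_sum]
    exact Finset.sum_congr rfl fun s _ => by ring
  change T (mulCLM _ (contDiffOn_weight k) (convTest y φ)) = _
  rw [h, map_sum]
  simp only [map_smul, smul_eq_mul]

theorem mulConv_continuous_and_bounded {d : ℕ} (T : DistQ d)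
    (hT : ∀ φ : 𝓓(Q d, ℂ), Continuous (fun y : Q d => T (dilTest y φ)) ∧
      ∀ k : ℕ, ∃ C : ℝ, ∀ y : Q d, ‖T (dilTest y φ)‖ * weight k y.1 ≤ C)
    (k : ℕ) (φ : 𝓓(Q d, ℂ)) : Continuous (mulConv (weightMul k T) φ) ∧
      ∃ C : ℝ, ∀ y : Q d, ‖mulConv (weightMul k T) φ y‖ ≤ C := by
  set χ := convTest ⟨1, one_mem_Q⟩ φ
  have hc : ∀ j, Continuous fun y : Q d => y.1 j := fun j =>
    (continuous_apply j).comp continuous_subtype_val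
  constructor
  · have h := funext (mulConv_weightMul T k φ)
    rw [h]
    refine continuous_finsetSum _ fun s _ => Continuous.mul ?_ ((hT _).1.comp continuous_invQ)
    refine Complex.continuous_ofReal.comp (Continuous.mul ?_ (Continuous.mul ?_ ?_))
    · exact (continuous_finsetProd _ fun j _ => hc j).inv₀ fun y =>
        Finset.prod_ne_zero_iff.2 fun j _ => (y.2 j).ne'
    · exact continuous_finsetProd _ fun j _ => (hc j).pow _
    · exact continuous_finsetProd _ fun j _ => ((hc j).pow _).inv₀ fun y =>
        pow_ne_zero _ (y.2 j).ne'
  · choose C hC using fun s =>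
      (hT (mulTest _ (contDiffOn_weightTerm k s) χ)).2 (1 + k)
    refine ⟨∑ s, 2 ^ d * C s, fun y => ?_⟩
    rw [mulConv_weightMul]
    refine (norm_sum_le _ _).trans (Finset.sum_le_sum fun s _ => ?_)
    have h0 := hC s (invQ y)
    have e : weight (1 + k) (invQ y).1 = weight (1 + k) y.1 := weight_inv _ _
    rw [e] at h0
    have hp : 0 ≤ (∏ j, y.1 j)⁻¹ := inv_nonneg.2 (Finset.prod_nonneg fun j _ => (y.2 j).le)
    have ht := (weightTerm_pos k s y.2).le
    have hw := weight_pos 1 y.2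
    rw [norm_mul, Complex.norm_real, Real.norm_of_nonneg (mul_nonneg hp ht)]
    set N := ‖T (dilTest (invQ y) (mulTest _ (contDiffOn_weightTerm k s) χ))‖
    calc (∏ j, y.1 j)⁻¹ * weightTerm k s y.1 * N ≤ weight 1 y.1 * weight k y.1 * N := by
          gcongr
          · exact inv_prod_le_weight_one y.2
          · exact weightTerm_le_weight k s y.2
      _ ≤ 2 ^ d * weight (1 + k) y.1 * N := by
          exact mul_le_mul_of_nonneg_right (weight_mul_le 1 k y.2) (norm_nonneg _)
      _ = 2 ^ d * (N * weight (1 + k) y.1) := by ring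
      _ ≤ _ := by gcongr

/-! ### Decay of the elements of `𝓢(Q)` -/

open scoped LineDeriv in
/-- The partial derivative `∂_j` on `𝓢(Q)`. -/
def partialSQ {d : ℕ} (j : Fin d) (ψ : SQ d) : SQ d :=
  ⟨∂_{(Pi.single j 1 : Fin d → ℝ)} ψ.1, (SchwartzMap.tsupport_lineDerivOp_subset _ ψ.1).trans ψ.2⟩

theorem partialSQ_apply {d : ℕ} (j : Fin d) (ψ : SQ d) (x : Fin d → ℝ) :
    (partialSQ j ψ).1 x = fderiv ℝ ψ.1 x (Pi.single j 1) := rfl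

theorem closure_Q_subset {d : ℕ} : closure (Q d : Set (Fin d → ℝ)) ⊆ {x | ∀ j, 0 ≤ x j} := by
  refine closure_minimal (fun x hx j => (hx j).le) ?_
  have : {x : Fin d → ℝ | ∀ j, 0 ≤ x j} = ⋂ j, {x | 0 ≤ x j} := by ext; simp
  rw [this]
  exact isClosed_iInter fun j => isClosed_le continuous_const (continuous_apply j)

theorem SQ_apply_eq_zero {d : ℕ} (ψ : SQ d) {x : Fin d → ℝ} (hx : x ∉ Q d) : ψ.1 x = 0 := by
  obtain ⟨j, hj⟩ : ∃ j, x j ≤ 0 := by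
    by_contra! h
    exact hx h
  have hc : Continuous fun s : ℝ => ψ.1 (Function.update x j s) :=
    ψ.1.continuous.comp (continuous_const.update j continuous_id)
  have h1 : Iio 0 ⊆ {s : ℝ | ψ.1 (Function.update x j s) = 0} := fun s (hs : s < 0) =>
    image_eq_zero_of_notMem_tsupport fun h => by
      have := closure_Q_subset (ψ.2 h) j
      rw [Function.update_self] at this
      exact this.not_gt hs
  have h2 := closure_minimal h1 (isClosed_eq hc continuous_const)
  rw [closure_Iio] at h2
  have h3 : ψ.1 (Function.update x j (x j)) = 0 := h2 hj
  rwa [Function.update_eq_self] at h3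

/-- The elements of `𝓢(Q)` vanish to infinite order on the boundary of `Q`, by integration of their
derivatives from the boundary. -/
theorem exists_norm_le_coord_pow {d : ℕ} (N : ℕ) (ψ : SQ d) (j : Fin d) :
    ∃ C : ℝ, 0 ≤ C ∧ ∀ x ∈ Q d, ‖ψ.1 x‖ ≤ C * x j ^ N := by
  induction N generalizing ψ with
  | zero =>
    obtain ⟨C, -, hC⟩ := ψ.1.decay 0 0
    have hC' : ∀ x, ‖ψ.1 x‖ ≤ C := fun x => by simpa using hC x
    exact ⟨C, (norm_nonneg _).trans (hC' 0), fun x _ => by simpa using hC' x⟩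
  | succ N ih =>
    obtain ⟨C, hC0, hC⟩ := ih (partialSQ j ψ)
    refine ⟨C, hC0, fun x hx => ?_⟩
    have hd : ∀ s, HasDerivAt (fun s => ψ.1 (Function.update x j s))
        ((partialSQ j ψ).1 (Function.update x j s)) s := fun s =>
      (ψ.1.differentiableAt.hasFDerivAt (x := Function.update x j s)).comp_hasDerivAt s
        (hasDerivAt_update x j s)
    have h := norm_image_sub_le_of_norm_deriv_le_segment' (a := 0) (b := x j) (C := C * x j ^ N)
      (fun s _ => (hd s).hasDerivWithinAt) (fun s hs => ?_) (x j) (right_mem_Icc.2 (hx j).le)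
    · rw [Function.update_eq_self, SQ_apply_eq_zero ψ (x := Function.update x j 0)
        fun h => (lt_irrefl (0 : ℝ)) (by simpa using h j), sub_zero, sub_zero] at h
      rwa [pow_succ, ← mul_assoc]
    · have hxj := hx j
      rcases hs.1.eq_or_lt with rfl | hs0
      · rw [SQ_apply_eq_zero _ fun h => (lt_irrefl (0 : ℝ)) (by simpa using h j), norm_zero]
        positivity
      · have hu : Function.update x j s ∈ Q d := fun i => by
          rcases eq_or_ne i j with rfl | hij
          · simpa using hs0
          · simpa [hij] using hx i
        have h1 := hC _ hu
        rw [Function.update_self] at h1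
        exact h1.trans (mul_le_mul_of_nonneg_left (pow_le_pow_left₀ hs0.le hs.2.le N) hC0)

theorem prod_le_one_add_sum_pow {d : ℕ} (a : Fin d → ℝ) (ha : ∀ j, 0 ≤ a j) :
    ∏ j, a j ≤ 1 + ∑ j, a j ^ d := by
  rcases Nat.eq_zero_or_pos d with rfl | hd
  · simp
  have : Nonempty (Fin d) := ⟨⟨0, hd⟩⟩
  obtain ⟨j, -, hj⟩ := Finset.exists_max_image Finset.univ a Finset.univ_nonempty
  calc ∏ i, a i ≤ ∏ _i : Fin d, a j := Finset.prod_le_prod (fun i _ => ha i) hj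
    _ = a j ^ d := by simp
    _ ≤ ∑ j, a j ^ d := Finset.single_le_sum (f := fun j => a j ^ d)
        (fun i _ => pow_nonneg (ha i) d) (Finset.mem_univ j)
    _ ≤ _ := by linarith

/-- The weight is at most `1` plus the sum of the `d`-th powers of its factors, so that only powers of
one coordinate at a time have to be estimated. -/
theorem exists_norm_mul_weight_le {d : ℕ} (ψ : SQ d) (k : ℕ) :
    ∃ C : ℝ, ∀ x ∈ Q d, ‖ψ.1 x‖ * weight k x ≤ C := by
  obtain ⟨A, -, hA⟩ := ψ.1.decay 0 0
  obtain ⟨D, -, hD⟩ := ψ.1.decay (2 * k * d) 0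
  choose E hE0 hE using exists_norm_le_coord_pow (2 * k * d) ψ
  simp only [norm_iteratedFDeriv_zero] at hA hD
  refine ⟨A + ∑ j, 2 ^ (d - 1) * (D + E j), fun x hx => ?_⟩
  have ha : ∀ j, 0 ≤ weightOne k (x j) := fun j => (weightOne_pos k (hx j)).le
  calc ‖ψ.1 x‖ * weight k x ≤ ‖ψ.1 x‖ * (1 + ∑ j, weightOne k (x j) ^ d) :=
        mul_le_mul_of_nonneg_left (prod_le_one_add_sum_pow _ ha) (norm_nonneg _)
    _ = ‖ψ.1 x‖ + ∑ j, ‖ψ.1 x‖ * weightOne k (x j) ^ d := by rw [mul_add, mul_one, Finset.mul_sum]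
    _ ≤ _ := ?_
  refine add_le_add (by simpa using hA x) (Finset.sum_le_sum fun j _ => ?_)
  have hxj := hx j
  have h1 : weightOne k (x j) ^ d ≤
      2 ^ (d - 1) * (x j ^ (2 * k * d) + (x j ^ (2 * k * d))⁻¹) := by
    refine (add_pow_le (by positivity) (by positivity) d).trans_eq ?_
    rw [inv_pow, ← pow_mul]
  refine (mul_le_mul_of_nonneg_left h1 (norm_nonneg _)).trans ?_
  rw [mul_left_comm]
  refine mul_le_mul_of_nonneg_left ?_ (by positivity)
  rw [mul_add]
  refine add_le_add ?_ ((mul_inv_le_iff₀ (by positivity)).2 (hE j x hx))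
  rw [mul_comm]
  refine (mul_le_mul_of_nonneg_right (pow_le_pow_left₀ hxj.le ?_ _) (norm_nonneg _)).trans (hD x)
  exact (Real.le_norm_self _).trans (norm_le_pi_norm x j)

theorem testToSQ_dilTest {d : ℕ} (y : Q d) (φ : 𝓓(Q d, ℂ)) :
    testToSQ (dilTest y φ) = dilSQ y (testToSQ φ) := by
  ext x
  rw [dilSQ_apply]
  rfl

theorem dilTest_continuous_and_decay {d : ℕ} (T : DistQ d)
    (hT : ∃ U : SQ d →L[ℂ] ℂ, Extends U T ∧
        ∀ φ : SQ d, ∃ ψ : SQ d, ∀ y : Q d, ψ.1 y.1 = U (dilSQ y φ))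
    (φ : 𝓓(Q d, ℂ)) : Continuous (fun y : Q d => T (dilTest y φ)) ∧
        ∀ k : ℕ, ∃ C : ℝ, ∀ y : Q d, ‖T (dilTest y φ)‖ * weight k y.1 ≤ C := by
  obtain ⟨U, hU, h⟩ := hT
  obtain ⟨ψ, hψ⟩ := h (testToSQ φ)
  have e : ∀ y : Q d, T (dilTest y φ) = ψ.1 y.1 := fun y => by
    rw [hψ, ← testToSQ_dilTest, hU]
  simp only [e]
  exact ⟨ψ.1.continuous.comp continuous_subtype_val,
    fun k => (exists_norm_mul_weight_le ψ k).imp fun C hC y => hC _ y.2⟩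

/-! ### Dilation integrals -/

/-- The function `y ↦ ∫_Q t(x) f(x y) dx` on `ℝ^d`. -/
def dilIntegral {d : ℕ} (t f : (Fin d → ℝ) → ℂ) (y : Fin d → ℝ) : ℂ :=
  ∫ x in Q d, t x * f (x * y)

theorem exists_norm_SQ_le {d : ℕ} (f : SQ d) (p : ℕ) :
    ∃ C : ℝ, 0 ≤ C ∧ ∀ x, ‖x‖ ^ p * ‖f.1 x‖ ≤ C := by
  obtain ⟨C, hC0, hC⟩ := f.1.decay p 0
  exact ⟨C, hC0.le, fun x => by simpa using hC x⟩

theorem aestronglyMeasurable_mul_dil {d : ℕ} {t : (Fin d → ℝ) → ℂ}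
    (ht : AEStronglyMeasurable t (volume.restrict (Q d))) (f : SQ d) (y : Fin d → ℝ) :
    AEStronglyMeasurable (fun x => t x * f.1 (x * y)) (volume.restrict (Q d)) :=
  ht.mul (f.1.continuous.comp (continuous_id.mul continuous_const)).aestronglyMeasurable

theorem integrableOn_mul_dil {d : ℕ} {t : (Fin d → ℝ) → ℂ} (ht : IntegrableOn t (Q d)) (f : SQ d)
    (y : Fin d → ℝ) : IntegrableOn (fun x => t x * f.1 (x * y)) (Q d) := by
  obtain ⟨C, hC0, hC⟩ := exists_norm_SQ_le f 0
  simp only [pow_zero, one_mul] at hC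
  refine Integrable.mono' (ht.norm.mul_const C) (aestronglyMeasurable_mul_dil ht.1 f y)
    (.of_forall fun x => ?_)
  rw [norm_mul]
  exact mul_le_mul_of_nonneg_left (hC _) (norm_nonneg _)

theorem memLp_coord_mul {d k : ℕ} (j : Fin d) {t : (Fin d → ℝ) → ℂ}
    (ht : MemLp (fun x => (weight (k + 1) x : ℂ) * t x) ⊤ (volume.restrict (Q d))) :
    MemLp (fun x => (weight k x : ℂ) * ((x j : ℂ) * t x)) ⊤ (volume.restrict (Q d)) := by
  refine memLp_weight_mul_mul (2 ^ d) (by fun_prop) (fun x hx => ?_) ht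
  rw [Complex.norm_real]
  refine (mul_le_mul_of_nonneg_left ((norm_le_pi_norm x j).trans ?_) (weight_nonneg k x)).trans
    (weight_mul_le k 1 hx)
  simpa using norm_pow_le_weight (k := 1) (n := 1) (by norm_num) hx

theorem continuous_dilIntegral {d : ℕ} {t : (Fin d → ℝ) → ℂ} (ht : IntegrableOn t (Q d))
    (f : SQ d) : Continuous (dilIntegral t f.1) := by
  obtain ⟨C, hC0, hC⟩ := exists_norm_SQ_le f 0
  simp only [pow_zero, one_mul] at hC
  refine continuous_of_dominated (bound := fun x => ‖t x‖ * C)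
    (fun y => aestronglyMeasurable_mul_dil ht.1 f y) (fun y => .of_forall fun x => ?_)
    (ht.norm.mul_const C) (.of_forall fun x => ?_)
  · rw [norm_mul]
    exact mul_le_mul_of_nonneg_left (hC _) (norm_nonneg _)
  · exact continuous_const.mul (f.1.continuous.comp (continuous_const.mul continuous_id))

/-- Differentiation under the integral: `∂_j` of the dilation integral of `t` and `f` is the dilation
integral of `x_j t` and `∂_j f`. -/
theorem hasFDerivAt_dilIntegral {d : ℕ} {t : (Fin d → ℝ) → ℂ} (ht : IntegrableOn t (Q d))
    (ht' : ∀ j, IntegrableOn (fun x => (x j : ℂ) * t x) (Q d)) (f : SQ d) (y : Fin d → ℝ) :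
    HasFDerivAt (dilIntegral t f.1)
      (∑ j, coordSmul j (dilIntegral (fun x => (x j : ℂ) * t x) (partialSQ j f).1 y)) y := by
  choose C hC0 hC using fun j => exists_norm_SQ_le (partialSQ j f) 0
  simp only [pow_zero, one_mul] at hC
  have hi : ∀ j y, IntegrableOn (fun x => (x j : ℂ) * t x * (partialSQ j f).1 (x * y)) (Q d) :=
    fun j y => integrableOn_mul_dil (ht' j) (partialSQ j f) y
  have h := hasFDerivAt_integral_of_dominated_of_fderiv_le (𝕜 := ℝ)
    (μ := volume.restrict (Q d : Set (Fin d → ℝ)))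
    (F := fun y x => t x * f.1 (x * y)) (s := univ)
    (F' := fun y x => ∑ j, coordSmul j ((x j : ℂ) * t x * (partialSQ j f).1 (x * y)))
    (bound := fun x => ∑ j, ‖coordSmul j‖ * (‖(x j : ℂ) * t x‖ * C j)) (x₀ := y)
    Filter.univ_mem (.of_forall fun y => aestronglyMeasurable_mul_dil ht.1 f y)
    (integrableOn_mul_dil ht f y)
    (integrable_finsetSum _ fun j _ =>
      (coordSmul j).integrable_comp (hi j y)).aestronglyMeasurable
    (.of_forall fun x z _ => (norm_sum_le _ _).trans (Finset.sum_le_sum fun j _ =>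
      ((coordSmul j).le_opNorm _).trans (mul_le_mul_of_nonneg_left ?_ (norm_nonneg _))))
    (integrable_finsetSum _ fun j _ => ((ht' j).norm.mul_const _).const_mul _)
    (.of_forall fun x z _ => ?_)
  · convert! h using 1
    rw [integral_finsetSum _ fun j _ => (coordSmul j).integrable_comp (hi j y)]
    exact Finset.sum_congr rfl fun j _ => ((coordSmul j).integral_comp_comm (hi j y)).symm
  · rw [norm_mul]
    exact mul_le_mul_of_nonneg_left (hC j _) (norm_nonneg _)
  · have h1 := ((f.1.hasFDerivAt (x * z)).comp z
      ((ContinuousLinearMap.mul ℝ (Fin d → ℝ) x).hasFDerivAt)).const_mul (t x)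
    convert! h1 using 1
    rw [← sum_coordSmul (t x • _)]
    refine Finset.sum_congr rfl fun j _ => congrArg _ ?_
    have e : ContinuousLinearMap.mul ℝ (Fin d → ℝ) x (Pi.single j 1) =
        x j • (Pi.single j 1 : Fin d → ℝ) := by
      ext i
      rcases eq_or_ne i j with rfl | hij <;> simp [*]
    rw [smul_apply, ContinuousLinearMap.comp_apply, e, map_smul,
      partialSQ_apply, smul_eq_mul, Complex.real_smul]
    ring

theorem fderiv_dilIntegral {d k : ℕ} {t : (Fin d → ℝ) → ℂ}
    (ht : MemLp (fun x => (weight (k + 2) x : ℂ) * t x) ⊤ (volume.restrict (Q d))) (f : SQ d) :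
    Differentiable ℝ (dilIntegral t f.1) ∧ fderiv ℝ (dilIntegral t f.1) = fun y =>
      ∑ j, coordSmul j (dilIntegral (fun x => (x j : ℂ) * t x) (partialSQ j f).1 y) := by
  have h := hasFDerivAt_dilIntegral (integrableOn_of_weight_mul (k := k + 1) ht)
    (fun j => integrableOn_of_weight_mul (k := k) (memLp_coord_mul j ht)) f
  exact ⟨fun y => (h y).differentiableAt, funext fun y => (h y).fderiv⟩

theorem contDiff_dilIntegral {d : ℕ} (n : ℕ) {t : (Fin d → ℝ) → ℂ}
    (ht : MemLp (fun x => (weight (n + 1) x : ℂ) * t x) ⊤ (volume.restrict (Q d))) (f : SQ d) :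
    ContDiff ℝ n (dilIntegral t f.1) := by
  induction n generalizing t f with
  | zero =>
    rw [Nat.cast_zero, contDiff_zero]
    exact continuous_dilIntegral (integrableOn_of_weight_mul ht) f
  | succ n ih =>
    obtain ⟨h1, h2⟩ := fderiv_dilIntegral ht f
    rw [Nat.cast_succ, contDiff_succ_iff_fderiv]
    refine ⟨h1, by simp, ?_⟩
    rw [h2]
    exact ContDiff.sum fun j _ => (coordSmul j).contDiff.comp (ih (memLp_coord_mul j ht) _)

/-- The factor `‖y‖ ≤ ‖x⁻¹‖ ‖x y‖` is shared out between `t` and `f`. -/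
theorem exists_norm_pow_mul_dilIntegral_le {d : ℕ} (p : ℕ) {t : (Fin d → ℝ) → ℂ}
    (ht : MemLp (fun x => (weight (p + 1) x : ℂ) * t x) ⊤ (volume.restrict (Q d))) (f : SQ d) :
    ∃ C : ℝ, ∀ y, ‖y‖ ^ p * ‖dilIntegral t f.1 y‖ ≤ C := by
  obtain ⟨C, hC0, hC⟩ := exists_norm_SQ_le f p
  have h1 : IntegrableOn (fun x => ((weight p x : ℝ) : ℂ) * t x) (Q d) := by
    refine integrableOn_of_weight_mul (k := 0) (memLp_weight_mul_mul (2 ^ d)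
      (Complex.measurable_ofReal.comp (measurable_weight p)) (fun x hx => ?_) ht)
    rw [Complex.norm_real, Real.norm_of_nonneg (weight_nonneg p x), add_comm p 1]
    exact weight_mul_le 1 p hx
  refine ⟨∫ x in Q d, ‖((weight p x : ℝ) : ℂ) * t x‖ * C, fun y => ?_⟩
  rw [← Real.norm_of_nonneg (pow_nonneg (norm_nonneg y) p), ← Complex.norm_real, ← norm_mul,
    dilIntegral, ← integral_const_mul]
  refine norm_integral_le_of_norm_le (h1.norm.mul_const C) ?_
  filter_upwards [ae_mem_Q] with x hx
  have h2 : ‖y‖ ≤ ‖x⁻¹‖ * ‖x * y‖ := by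
    have : y = x⁻¹ * (x * y) := by
      ext j
      simp [(hx j).ne']
    conv_lhs => rw [this]
    exact norm_mul_le _ _
  have h3 : ‖x⁻¹‖ ^ p ≤ weight p x := by
    rw [← weight_inv]
    exact norm_pow_le_weight (by omega) fun j => inv_pos.2 (hx j)
  rw [norm_mul, norm_mul, norm_mul, Complex.norm_real, Complex.norm_real,
    Real.norm_of_nonneg (pow_nonneg (norm_nonneg y) p), Real.norm_of_nonneg (weight_nonneg p x)]
  calc ‖y‖ ^ p * (‖t x‖ * ‖f.1 (x * y)‖)
      ≤ (‖x⁻¹‖ * ‖x * y‖) ^ p * (‖t x‖ * ‖f.1 (x * y)‖) := by gcongr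
    _ = ‖x⁻¹‖ ^ p * ‖t x‖ * (‖x * y‖ ^ p * ‖f.1 (x * y)‖) := by rw [mul_pow]; ring
    _ ≤ weight p x * ‖t x‖ * C := by
      have := hC (x * y)
      have := weight_nonneg p x
      gcongr

theorem exists_norm_iteratedFDeriv_dilIntegral_le {d : ℕ} (p n : ℕ) {t : (Fin d → ℝ) → ℂ}
    (ht : MemLp (fun x => (weight (n + p + 1) x : ℂ) * t x) ⊤ (volume.restrict (Q d))) (f : SQ d) :
    ∃ C : ℝ, ∀ y, ‖y‖ ^ p * ‖iteratedFDeriv ℝ n (dilIntegral t f.1) y‖ ≤ C := by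
  induction n generalizing t f with
  | zero =>
    simp only [norm_iteratedFDeriv_zero]
    exact exists_norm_pow_mul_dilIntegral_le p (by simpa using ht) f
  | succ n ih =>
    have e : n + 1 + p + 1 = n + p + 1 + 1 := by omega
    rw [e] at ht
    have h2 := (fderiv_dilIntegral ht f).2
    choose C hC using fun j => ih (memLp_coord_mul j ht) (partialSQ j f)
    have hs : ∀ j, ContDiff ℝ n (dilIntegral (fun x => (x j : ℂ) * t x) (partialSQ j f).1) :=
      fun j => contDiff_dilIntegral n (memLp_weight_mul_of_le (by omega) (memLp_coord_mul j ht)) _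
    refine ⟨∑ j, ‖coordSmul j‖ * C j, fun y => ?_⟩
    have h3 : iteratedFDeriv ℝ n (fun y => ∑ j, coordSmul j
        (dilIntegral (fun x => (x j : ℂ) * t x) (partialSQ j f).1 y)) y = ∑ j, iteratedFDeriv ℝ n
          (fun y => coordSmul j (dilIntegral (fun x => (x j : ℂ) * t x) (partialSQ j f).1 y)) y :=
      iteratedFDeriv_fun_sum_apply fun j _ => ((coordSmul j).contDiff.comp (hs j)).contDiffAt
    rw [← norm_iteratedFDeriv_fderiv, h2, h3]
    refine (mul_le_mul_of_nonneg_left (norm_sum_le _ _) (by positivity)).trans ?_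
    rw [Finset.mul_sum]
    refine Finset.sum_le_sum fun j _ => ?_
    refine (mul_le_mul_of_nonneg_left ((coordSmul j).norm_iteratedFDeriv_comp_left
      (hs j).contDiffAt le_rfl) (by positivity)).trans ?_
    rw [mul_left_comm]
    exact mul_le_mul_of_nonneg_left (hC j y) (norm_nonneg _)

theorem dilIntegral_eq_zero {d : ℕ} (t : (Fin d → ℝ) → ℂ) (f : SQ d) {y : Fin d → ℝ}
    (hy : y ∉ Q d) : dilIntegral t f.1 y = 0 := by
  rw [dilIntegral, ← integral_zero (Fin d → ℝ) ℂ (μ := volume.restrict (Q d))]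
  refine integral_congr_ae ?_
  filter_upwards [ae_mem_Q] with x hx
  have hxy : x * y ∉ Q d := fun h => hy fun j => pos_of_mul_pos_right (h j) (hx j).le
  rw [SQ_apply_eq_zero f hxy, mul_zero]

/-! ### Euler operators on `𝓢(Q)` -/

theorem hasTemperateGrowth_coord {d : ℕ} (j : Fin d) :
    Function.HasTemperateGrowth fun x : Fin d → ℝ => ((x j : ℝ) : ℂ) :=
  (Complex.ofRealCLM.comp
    (ContinuousLinearMap.proj (R := ℝ) (φ := fun _ : Fin d => ℝ) j)).hasTemperateGrowth

open scoped LineDeriv in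
/-- The adjoint `-θ_j - 1` of `θ_j` on `𝓢(Q)`. -/
def eulerAdjSQ {d : ℕ} (j : Fin d) : SQ d →L[ℂ] SQ d :=
  -(((SchwartzMap.smulLeftCLM ℂ (fun x : Fin d → ℝ => ((x j : ℝ) : ℂ))).comp
    ((LineDeriv.lineDerivOpCLM ℂ 𝓢(Fin d → ℝ, ℂ) (Pi.single j 1 : Fin d → ℝ)).comp
      (SQ d).subtypeL)).codRestrict (SQ d) fun f => by
        refine (closure_mono fun x hx => ?_).trans ((partialSQ j f).2)
        intro h
        refine hx ?_
        change SchwartzMap.smulLeftCLM ℂ (fun x : Fin d → ℝ => ((x j : ℝ) : ℂ))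
          (partialSQ j f).1 x = 0
        rw [SchwartzMap.smulLeftCLM_apply_apply (hasTemperateGrowth_coord j), h, smul_zero]) -
    ContinuousLinearMap.id ℂ (SQ d)

theorem coe_eulerAdjSQ {d : ℕ} (j : Fin d) (f : SQ d) :
    ⇑(eulerAdjSQ j f).1 = eulerAdj j f.1 := by
  ext x
  change -(SchwartzMap.smulLeftCLM ℂ (fun x : Fin d → ℝ => ((x j : ℝ) : ℂ))
          (partialSQ j f).1 x) - f.1 x = _
  rw [SchwartzMap.smulLeftCLM_apply_apply (hasTemperateGrowth_coord j)]
  rfl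

/-- The adjoint of `θ^β` on `𝓢(Q)`. -/
def eulerAdjPowSQ {d : ℕ} (β : Fin d → ℕ) : SQ d →L[ℂ] SQ d :=
  opPow eulerAdjSQ β (List.finRange d)

theorem coe_eulerAdjPowSQ {d : ℕ} (β : Fin d → ℕ) (f : SQ d) :
    ⇑(eulerAdjPowSQ β f).1 = eulerAdjPow β (List.finRange d) f.1 :=
  coe_opPow_smul (X := SQ d) (a := eulerAdjSQ) (h := fun f => ⇑f.1) coe_eulerAdjSQ β _ f

theorem exists_eulerSum_SQ_le {d : ℕ} (n : ℕ) (f : SQ d) :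
    ∃ C : ℝ, ∀ x ∈ Q d, eulerSum n f.1 x ≤ C := by
  induction n generalizing f with
  | zero =>
    obtain ⟨C, -, hC⟩ := exists_norm_SQ_le f 0
    exact ⟨C, fun x _ => by simpa [eulerSum] using hC x⟩
  | succ n ih =>
    obtain ⟨C, hC⟩ := ih f
    choose D hD using fun j => ih (eulerAdjSQ j f)
    refine ⟨C + ∑ j, (D j + C), fun x hx => add_le_add (hC x hx) (Finset.sum_le_sum fun j _ => ?_)⟩
    refine (eulerSum_euler_le_eulerAdj n j (f.1.smooth ⊤).contDiffOn hx).trans ?_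
    rw [← coe_eulerAdjSQ]
    exact add_le_add (hD j x hx) (hC x hx)

theorem eulerAdjPow_comp_mul {d : ℕ} (β : Fin d → ℕ) (l : List (Fin d)) (y : Q d)
    (f : (Fin d → ℝ) → ℂ) :
    eulerAdjPow β l (fun x => f (x * y.1)) = fun x => eulerAdjPow β l f (x * y.1) := by
  have h : ∀ j n f, (eulerAdj j)^[n] (fun x => f (x * y.1)) =
      fun x => (eulerAdj j)^[n] f (x * y.1) := fun j n => by
    induction n with
    | zero => intro f; rfl
    | succ n ih => intro f; rw [Function.iterate_succ_apply, eulerAdj_comp_mul, ih]; rfl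
  induction l generalizing f with
  | nil => rfl
  | cons j l ih => rw [eulerAdjPow, h, ih]; rfl

theorem eventuallyEq_eulerAdjPow {d : ℕ} (β : Fin d → ℕ) (l : List (Fin d))
    {f g : (Fin d → ℝ) → ℂ} {x : Fin d → ℝ} (hfg : f =ᶠ[nhds x] g) :
    eulerAdjPow β l f =ᶠ[nhds x] eulerAdjPow β l g := by
  have h : ∀ j n (f g : (Fin d → ℝ) → ℂ), f =ᶠ[nhds x] g →
      (eulerAdj j)^[n] f =ᶠ[nhds x] (eulerAdj j)^[n] g := fun j n => by
    induction n with
    | zero => exact fun f g h => h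
    | succ n ih => exact fun f g h => ih _ _ (eventuallyEq_eulerAdj j h)
  induction l generalizing f g with
  | nil => exact hfg
  | cons j l ih => exact ih (h j _ _ _ hfg)

theorem exists_norm_eulerAdjPow_le {d : ℕ} (β : Fin d → ℕ) (l : List (Fin d)) :
    ∃ m : ℕ, ∀ f : (Fin d → ℝ) → ℂ, ContDiffOn ℝ ∞ f (Q d) → ∀ x ∈ Q d,
      ‖eulerAdjPow β l f x‖ ≤ eulerSum m f x := by
  have h : ∀ j b f, ContDiffOn ℝ ∞ f (Q d) → ContDiffOn ℝ ∞ ((eulerAdj j)^[b] f) (Q d) ∧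
      ∀ n, ∀ x ∈ Q d, eulerSum n ((eulerAdj j)^[b] f) x ≤ eulerSum (n + b) f x := fun j b => by
    induction b with
    | zero => exact fun f hf => ⟨hf, fun n x _ => le_rfl⟩
    | succ b ih =>
      intro f hf
      obtain ⟨h1, h2⟩ := ih _ ((contDiffOn_euler j hf).neg.sub hf)
      exact ⟨h1, fun n x hx => (h2 n x hx).trans (eulerSum_eulerAdj_le (n + b) j hf hx)⟩
  induction l with
  | nil => exact ⟨0, fun f _ x _ => le_rfl⟩
  | cons j l ih =>
    obtain ⟨m, hm⟩ := ih
    exact ⟨m + β j, fun f hf x hx => (hm _ (h j (β j) f hf).1 x hx).trans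
      ((h j (β j) f hf).2 m x hx)⟩

/-! ### The extension to `𝓢(Q)` -/

/-- The value `∑_β ∫_Q t_β ((θ^β)^* f)` of the distribution `∑_β θ^β t_β` at a function `f`. -/
def pairing {d : ℕ} (B : Finset (Fin d → ℕ)) (t : (Fin d → ℕ) → (Fin d → ℝ) → ℂ)
    (f : (Fin d → ℝ) → ℂ) : ℂ :=
  ∑ β ∈ B, ∫ x in Q d, t β x * eulerAdjPow β (List.finRange d) f x

theorem sum_thetaPow_ofFun_apply {d : ℕ} {B : Finset (Fin d → ℕ)}
    {t : (Fin d → ℕ) → (Fin d → ℝ) → ℂ} (ht : ∀ β ∈ B, IntegrableOn (t β) (Q d))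
    (φ : 𝓓(Q d, ℂ)) : (∑ β ∈ B, thetaPow β (ofFun (t β))) φ = pairing B t φ := by
  rw [sum_apply]
  refine Finset.sum_congr rfl fun β hβ => ?_
  rw [thetaPow_apply, ofFun_apply (ht β hβ), coe_eulerAdjPowTest]

/-- The form `f ↦ ∫_Q t f` is continuous on `𝓢(Q)` for `t` integrable on `Q`. -/
theorem exists_integral_SQ {d : ℕ} {t : (Fin d → ℝ) → ℂ} (ht : IntegrableOn t (Q d)) :
    ∃ I : SQ d →L[ℂ] ℂ, ∀ f, I f = ∫ x in Q d, t x * f.1 x := by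
  have hi : ∀ f : 𝓢(Fin d → ℝ, ℂ), ∃ C : ℝ, ∀ x, ‖f x‖ ≤ C := fun f => by
    obtain ⟨C, -, hC⟩ := f.decay 0 0
    exact ⟨C, fun x => by simpa using hC x⟩
  have hint : ∀ f : 𝓢(Fin d → ℝ, ℂ), IntegrableOn (fun x => t x * f x) (Q d) := fun f => by
    obtain ⟨C, hC⟩ := hi f
    exact (ht.bdd_mul f.continuous.aestronglyMeasurable (.of_forall hC)).congr
      (.of_forall fun x => mul_comm _ _)
  refine ⟨(SchwartzMap.mkCLMtoNormedSpace (σ := RingHom.id ℂ) (fun f : 𝓢(Fin d → ℝ, ℂ) =>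
    ∫ x in Q d, t x * f x) (fun f g => ?_) (fun c f => ?_) ?_).comp (SQ d).subtypeL, fun f => rfl⟩
  · rw [← integral_add (hint f) (hint g)]
    exact integral_congr_ae (.of_forall fun x => mul_add _ _ _)
  · rw [RingHom.id_apply, smul_eq_mul, ← integral_const_mul]
    exact integral_congr_ae (.of_forall fun x => mul_left_comm _ _ _)
  · refine ⟨{(0, 0)}, ∫ x in Q d, ‖t x‖, integral_nonneg fun x => norm_nonneg _, fun f => ?_⟩
    rw [Finset.sup_singleton, ← integral_mul_const]
    refine norm_integral_le_of_norm_le (ht.norm.mul_const _) (.of_forall fun x => ?_)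
    rw [norm_mul]
    exact mul_le_mul_of_nonneg_left (f.norm_le_seminorm ℂ x) (norm_nonneg _)

/-- The pairing is a continuous linear form on `𝓢(Q)`. -/
theorem exists_pairing_SQ {d : ℕ} {B : Finset (Fin d → ℕ)}
    {t : (Fin d → ℕ) → (Fin d → ℝ) → ℂ} (ht : ∀ β ∈ B, IntegrableOn (t β) (Q d)) :
    ∃ U : SQ d →L[ℂ] ℂ, ∀ f, U f = pairing B t f.1 := by
  choose I hI using fun β : B => exists_integral_SQ (ht β.1 β.2)
  refine ⟨∑ β : B, (I β).comp (eulerAdjPowSQ β.1), fun f => ?_⟩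
  rw [pairing, ← Finset.sum_coe_sort B, sum_apply]
  refine Finset.sum_congr rfl fun β _ => ?_
  rw [ContinuousLinearMap.comp_apply, hI, coe_eulerAdjPowSQ]

theorem pairing_dilSQ {d : ℕ} (B : Finset (Fin d → ℕ)) (t : (Fin d → ℕ) → (Fin d → ℝ) → ℂ)
    (y : Q d) (f : SQ d) : pairing B t (dilSQ y f).1 =
      ∑ β ∈ B, dilIntegral (t β) (eulerAdjPowSQ β f).1 y.1 := by
  have e : ⇑(dilSQ y f).1 = fun x => f.1 (x * y.1) := funext fun x => dilSQ_apply y f x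
  rw [pairing, e]
  refine Finset.sum_congr rfl fun β _ => ?_
  rw [dilIntegral, coe_eulerAdjPowSQ, eulerAdjPow_comp_mul]

/-- The partial sums of the dyadic partition of unity. -/
def cutoff (d N : ℕ) : 𝓓(Q d, ℂ) := ∑ i ∈ dyadicBox d N, dilTest (dyadic N i) (bump d)

theorem cutoff_apply {d N : ℕ} (x : Fin d → ℝ) :
    cutoff d N x = ∑ i ∈ dyadicBox d N, bump d (x * (dyadic N i).1) := by
  have h : (cutoff d N) x = ∑ i ∈ dyadicBox d N, dilTest (dyadic N i) (bump d) x := by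
    simp [cutoff]
  exact h

/-- The overlap of the pieces is estimated by the sum of all `w_1(x) / w_1(c)` with `c` dyadic, which is
enough because the functions of the representation decay. -/
theorem exists_eulerSum_cutoff_le (d n : ℕ) : ∃ C : ℝ, 0 ≤ C ∧ ∀ N, ∀ x ∈ Q d,
    eulerSum n (cutoff d N) x ≤ C * weight 1 x := by
  obtain ⟨B, hB0, hB⟩ := exists_eulerSum_bump_le d n
  obtain ⟨C, hC0, hC⟩ := exists_weight_compare 1 (isCompact_cube d) (cube_subset_Q d)
  refine ⟨4 ^ d * (B * C), by positivity, fun N x hx => ?_⟩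
  have hw := weight_pos 1 hx
  have h1 : ⇑(cutoff d N) = fun x => ∑ i ∈ dyadicBox d N, bump d (x * (dyadic N i).1) :=
    funext fun x => cutoff_apply x
  rw [h1]
  calc eulerSum n (fun x => ∑ i ∈ dyadicBox d N, bump d (x * (dyadic N i).1)) x
      ≤ ∑ i ∈ dyadicBox d N, eulerSum n (fun x => bump d (x * (dyadic N i).1)) x :=
        eulerSum_sum_le n _ (fun i _ =>
          (dilTest (dyadic N i) (bump d)).contDiff.contDiffOn) hx
    _ ≤ ∑ i ∈ dyadicBox d N, (weight 1 (dyadic N i).1)⁻¹ * (B * C * weight 1 x) := by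
        refine Finset.sum_le_sum fun i _ => ?_
        have hc := weight_pos 1 (dyadic N i).2
        rw [eulerSum_comp_mul, inv_mul_eq_div, le_div_iff₀ hc]
        by_cases hxc : x * (dyadic N i).1 ∈ cube d
        · rw [mul_assoc B C]
          exact mul_le_mul (hB _) (hC _ (dyadic N i).2 x hx (by rwa [mul_comm])) hc.le hB0
        · rw [eulerSum_eq_zero n fun h => hxc (tsupport_bump_subset d h), zero_mul]
          positivity
    _ ≤ 4 ^ d * (B * C * weight 1 x) := by
        rw [← Finset.sum_mul]
        exact mul_le_mul_of_nonneg_right (sum_inv_weight_dyadic_le d N) (by positivity)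
    _ = _ := by ring

theorem eventually_cutoff_eq_one {d : ℕ} {x : Fin d → ℝ} (hx : x ∈ Q d) :
    ∀ᶠ N in Filter.atTop, cutoff d N =ᶠ[nhds x] fun _ => 1 := by
  obtain ⟨K, hK, hxK, hKQ⟩ := exists_compact_subset (Q d).isOpen hx
  obtain ⟨N₀, hN₀⟩ := exists_sum_bump_eq_one hK hKQ
  filter_upwards [Filter.eventually_ge_atTop N₀] with N hN
  filter_upwards [isOpen_interior.mem_nhds hxK] with z hz
  rw [cutoff_apply, hN₀ N hN z (interior_subset hz)]

/-- A distribution with a representation by sufficiently small functions is determined on `𝓢(Q)` by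
its values at test functions. -/
theorem tendsto_pairing_cutoff {d : ℕ} {B : Finset (Fin d → ℕ)}
    {t : (Fin d → ℕ) → (Fin d → ℝ) → ℂ}
    (ht : ∀ β ∈ B, MemLp (fun x => (weight 2 x : ℂ) * t β x) ⊤ (volume.restrict (Q d)))
    (f : SQ d) : Filter.Tendsto
      (fun N => pairing B t (mulTest f.1 (f.1.smooth ⊤).contDiffOn (cutoff d N))) Filter.atTop
      (nhds (pairing B t f.1)) := by
  refine tendsto_finsetSum _ fun β hβ => ?_
  obtain ⟨m, hm⟩ := exists_norm_eulerAdjPow_le β (List.finRange d)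
  obtain ⟨C, hC0, hC⟩ := exists_eulerSum_cutoff_le d m
  obtain ⟨D, hD⟩ := exists_eulerSum_SQ_le m f
  have ht1 : IntegrableOn (fun x => ((weight 1 x : ℝ) : ℂ) * t β x) (Q d) := by
    refine integrableOn_of_weight_mul (k := 0) (memLp_weight_mul_mul (2 ^ d)
      (Complex.measurable_ofReal.comp (measurable_weight 1)) (fun x hx => ?_) (ht β hβ))
    rw [Complex.norm_real, Real.norm_of_nonneg (weight_nonneg 1 x)]
    exact weight_mul_le 1 1 hx
  refine tendsto_integral_of_dominated_convergence
    (fun x => ‖((weight 1 x : ℝ) : ℂ) * t β x‖ * (2 ^ m * (C * D)))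
    (fun N => ?_) (ht1.norm.mul_const _) (fun N => ?_) ?_
  · rw [← coe_eulerAdjPowTest]
    exact (aestronglyMeasurable_of_weight_mul (ht β hβ)).mul
      (eulerAdjPowTest β _).continuous.aestronglyMeasurable
  · filter_upwards [ae_mem_Q] with x hx
    set g := mulTest f.1 (f.1.smooth ⊤).contDiffOn (cutoff d N)
    have hw := weight_pos 1 hx
    have h1 : eulerSum m g x ≤ 2 ^ m * (eulerSum m (cutoff d N) x * eulerSum m f.1 x) :=
      eulerSum_mul_le m (cutoff d N).contDiff.contDiffOn (f.1.smooth ⊤).contDiffOn hx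
    have h2 : ‖eulerAdjPow β (List.finRange d) g x‖ ≤ 2 ^ m * (C * weight 1 x * D) := by
      refine ((hm g g.contDiff.contDiffOn x hx).trans h1).trans ?_
      exact mul_le_mul_of_nonneg_left (mul_le_mul (hC N x hx) (hD x hx) (eulerSum_nonneg _ _ _)
        (by positivity)) (by positivity)
    rw [norm_mul, norm_mul, Complex.norm_real, Real.norm_of_nonneg hw.le]
    refine (mul_le_mul_of_nonneg_left h2 (norm_nonneg _)).trans_eq ?_
    ring
  · filter_upwards [ae_mem_Q] with x hx
    refine tendsto_const_nhds.congr' ?_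
    filter_upwards [eventually_cutoff_eq_one hx] with N hN
    have h1 : ⇑(mulTest f.1 (f.1.smooth ⊤).contDiffOn (cutoff d N)) =ᶠ[nhds x] f.1 := by
      filter_upwards [hN] with z hz
      rw [mulTest_apply, hz, one_mul]
    rw [(eventuallyEq_eulerAdjPow β _ h1).eq_of_nhds]

/-- The functions `y ↦ U_x f(x y)` of a distribution with representations of arbitrary decay are
Schwartz functions: each representation gives derivatives of some orders and their decay. -/
theorem exists_extension_dilSQ {d : ℕ} (T : DistQ d)
    (hT : ∀ k : ℕ, ∃ (B : Finset (Fin d → ℕ)) (t : (Fin d → ℕ) → (Fin d → ℝ) → ℂ),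
      (∀ β ∈ B, MemLp (fun x => (weight k x : ℂ) * t β x) ⊤ (volume.restrict (Q d))) ∧
      T = ∑ β ∈ B, thetaPow β (ofFun (t β))) :
    ∃ U : SQ d →L[ℂ] ℂ, Extends U T ∧
      ∀ φ : SQ d, ∃ ψ : SQ d, ∀ y : Q d, ψ.1 y.1 = U (dilSQ y φ) := by
  choose B t ht hTt using hT
  have hint : ∀ k ≥ 1, ∀ β ∈ B k, IntegrableOn (t k β) (Q d) := fun k hk β hβ =>
    integrableOn_of_weight_mul (k := 0) (memLp_weight_mul_of_le hk (ht k β hβ))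
  have hTp : ∀ k ≥ 1, ∀ φ, T φ = pairing (B k) (t k) φ := fun k hk φ => by
    rw [← sum_thetaPow_ofFun_apply (hint k hk), ← hTt k]
  obtain ⟨U, hU⟩ := exists_pairing_SQ (hint 2 (by norm_num))
  -- every representation gives the same form on `𝓢(Q)`
  have hUp : ∀ k ≥ 2, ∀ f, U f = pairing (B k) (t k) f.1 := fun k hk f => by
    have h := fun l (hl : 2 ≤ l) => tendsto_pairing_cutoff (B := B l) (t := t l)
      (fun β hβ => memLp_weight_mul_of_le hl (ht l β hβ)) f
    have h2 := h 2 le_rfl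
    have hk := h k hk
    simp only [← hTp 2 (by norm_num), ← hTp k (by omega)] at h2 hk
    rw [hU]
    exact tendsto_nhds_unique h2 hk
  refine ⟨U, fun φ => ?_, fun φ => ?_⟩
  · rw [hU, hTp 2 (by norm_num)]
    rfl
  set g : (Fin d → ℝ) → ℂ := fun y => ∑ β ∈ B 2, dilIntegral (t 2 β) (eulerAdjPowSQ β φ).1 y
  have hgU : ∀ y : Q d, g y.1 = U (dilSQ y φ) := fun y => by rw [hU, pairing_dilSQ]
  have hg0 : ∀ y ∉ Q d, g y = 0 := fun y hy =>
    Finset.sum_eq_zero fun β _ => dilIntegral_eq_zero _ _ hy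
  have hg : ∀ k ≥ 2, g = fun y => ∑ β ∈ B k, dilIntegral (t k β) (eulerAdjPowSQ β φ).1 y :=
    fun k hk => by
      ext y
      by_cases hy : y ∈ Q d
      · rw [hgU ⟨y, hy⟩, hUp k hk, pairing_dilSQ]
      · rw [hg0 y hy]
        exact (Finset.sum_eq_zero fun β _ => dilIntegral_eq_zero _ _ hy).symm
  -- the representation with index `n + 2` gives derivatives of order `n`
  have hsm : ContDiff ℝ ∞ g := by
    refine contDiff_infty.2 fun n => ?_
    rw [hg (n + 2) (by omega)]
    exact ContDiff.sum fun β hβ => contDiff_dilIntegral n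
      (memLp_weight_mul_of_le (by omega) (ht (n + 2) β hβ)) _
  have hdec : ∀ p n : ℕ, ∃ C : ℝ, ∀ y, ‖y‖ ^ p * ‖iteratedFDeriv ℝ n g y‖ ≤ C := by
    intro p n
    rw [hg (n + p + 2) (by omega)]
    choose C hC using fun β : B (n + p + 2) => exists_norm_iteratedFDeriv_dilIntegral_le p n
      (memLp_weight_mul_of_le (k := n + p + 1) (by omega) (ht (n + p + 2) β.1 β.2))
      (eulerAdjPowSQ β.1 φ)
    refine ⟨∑ β, C β, fun y => ?_⟩
    have h1 : iteratedFDeriv ℝ n (fun y => ∑ β ∈ B (n + p + 2),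
        dilIntegral (t (n + p + 2) β) (eulerAdjPowSQ β φ).1 y) y = ∑ β ∈ B (n + p + 2),
          iteratedFDeriv ℝ n (dilIntegral (t (n + p + 2) β) (eulerAdjPowSQ β φ).1) y :=
      iteratedFDeriv_fun_sum_apply fun β hβ => (contDiff_dilIntegral n
        (memLp_weight_mul_of_le (by omega) (ht (n + p + 2) β hβ)) _).contDiffAt
    rw [h1, ← Finset.sum_coe_sort (B (n + p + 2))]
    refine (mul_le_mul_of_nonneg_left (norm_sum_le _ _) (by positivity)).trans ?_
    rw [Finset.mul_sum]
    exact Finset.sum_le_sum fun β _ => hC β y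
  refine ⟨⟨⟨g, hsm, hdec⟩, closure_mono fun y hy => ?_⟩, hgU⟩
  by_contra h
  exact hy (hg0 y h)

end HadamardQ

end

open HadamardQ in
theorem theorem3p1 (d : ℕ) (T : DistQ d) :
    List.TFAE [
      T ∈ OHQ d,
      ∀ k : ℕ, ∃ (B : Finset (Fin d → ℕ)) (t : (Fin d → ℕ) → (Fin d → ℝ) → ℂ),
        (∀ β ∈ B, MemLp (fun x => (weight k x : ℂ) * t β x) ⊤ (volume.restrict (Q d))) ∧
        T = ∑ β ∈ B, thetaPow β (ofFun (t β)),
      ∃ U : SQ d →L[ℂ] ℂ, Extends U T ∧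
        ∀ φ : SQ d, ∃ ψ : SQ d, ∀ y : Q d, ψ.1 y.1 = U (dilSQ y φ),
      ∀ φ : 𝓓(Q d, ℂ), Continuous (fun y : Q d => T (dilTest y φ)) ∧
        ∀ k : ℕ, ∃ C : ℝ, ∀ y : Q d, ‖T (dilTest y φ)‖ * weight k y.1 ≤ C,
      ∀ (k : ℕ) (φ : 𝓓(Q d, ℂ)), Continuous (mulConv (weightMul k T) φ) ∧
        ∃ C : ℝ, ∀ y : Q d, ‖mulConv (weightMul k T) φ y‖ ≤ C] := by
  tfae_have 1 ↔ 2 := Iff.rfl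
  tfae_have 2 → 3 := exists_extension_dilSQ T
  tfae_have 3 → 4 := dilTest_continuous_and_decay T
  tfae_have 4 → 2 := fun h => exists_representation_of_dilTest_decay T fun φ => (h φ).2
  tfae_have 4 → 5 := mulConv_continuous_and_bounded T
  tfae_have 5 → 2 := fun h => exists_representation_of_mulConv_bounded T fun k φ => (h k φ).2
  tfae_finish
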